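/- Let $(M^n,g)$, $n\ge 2$, be a compact smooth Riemannian manifold with smooth (possibly empty) boundary $\partial M$; write $\nabla$ for its Levi-Civita connection. Let $\Gamma\subset\mathbb R^n$ be an open, convex, symmetric cone with vertex at the origin, $\{\lambda:\lambda_i>0\ \forall i\}\subseteq\Gamma\ne\mathbb R^n$, and let $f$ be a smooth symmetric concave function on $\Gamma$ with $f_i=\partial f/\partial\lambda_i>0$ in $\Gamma$ for all $i$ and $\limsup_{\lambda\to\lambda_0}f(\lambda)\le 0$ for every $\lambda_0\in\partial\Gamma$. Assume that $$\sum_i f_i(\lambda)\lambda_i\ge 0\quad\text{for all }\lambda\in\Gamma,$$ and that for every $\sigma>0$ there is $\nu_0=\nu_0(\sigma)>0$ such that, for every $\lambda\in\Gamma$ with $f(\lambda)>\sigma$ and every $j$, $$\lambda_j<0\ \Longrightarrow\ f_j(\lambda)\ge\nu_0\Big(1+\sum_i f_i(\lambda)\Big).$$ For $x\in M$, $z\in\mathbb R$, $p\in T^*_xM$ let $A(x,z,p)$ be a symmetric $(0,2)$ tensor at $x$ and $\psi(x,z,p)>0$ a number, both depending smoothly on $(x,z,p)$ (up to the boundary);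 write $A^{\xi\eta}=A(\xi,\eta)$ for $\xi,\eta\in T_xM$. Assume that $\psi(x,z,p)$ is convex in $p$ and that $A^{\xi\xi}(x,z,p)$ is concave in $p$ for every $\xi$. Let $\bar\psi_1,\bar\psi_2>0$ and $\bar\psi\ge 0$ be functions on $M\times\mathbb R$ that are locally bounded (for instance continuous), let $\gamma_1,\gamma_2\in(0,4)$ and $\gamma\in(0,2)$, and assume that for all $x,z,p$ and $\xi\in T_xM$ $$p\cdot\nabla_xA^{\xi\xi}+|p|^2A^{\xi\xi}_z\le\bar\psi_1(x,z)|\xi|^2(1+|p|^{\gamma_1}),\qquad p\cdot\nabla_x\psi+|p|^2\psi_z\ge-\bar\psi_2(x,z)(1+|p|^{\gamma_2}),$$ $$-\psi_z\le\bar\psi(x,z)(1+|p|^\gamma),\qquad p\cdot D_p\psi\le\bar\psi(x,z)(1+|p|^\gamma),\qquad -\frac{p\cdot D_pA^{\xi\xi}}{|\xi|^2}\le\bar\psi(x,z)(1+|p|^\gamma)\ \ (\xi\neq 0),$$ $$|A^{\xi\eta}(x,z,p)|\le\bar\psi(x,z)|\xi||\eta|(1+|p|^\gamma)\quad\text{for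 all }\xi,\eta\in T_xM\text{ with }\xi\perp\eta.$$ Here $\nabla_x$ is the partial covariant derivative in $x$, with $z$ fixed and $p$ (and, for $A^{\xi\xi}$, also $\xi$) extended by parallel transport, and $p\cdot\nabla_x$ is this derivative in the direction of the vector dual to $p$. Then for every $K$ there is a constant $C_1>0$, depending only on $K$ and the data $M,g,\Gamma,f,A,\psi,\bar\psi_1,\bar\psi_2,\bar\psi,\gamma_1,\gamma_2,\gamma$, such that every $u\in C^3(M)$ (up to the boundary) with $|u|_{C^0(M)}\le K$ which is an admissible solution of $$f(\lambda(\nabla^2u+A(x,u,\nabla u)))=\psi(x,u,\nabla u)\quad\text{on }M,$$ that is, the vector $\lambda(\nabla^2u+A(x,u,\nabla u))$ of eigenvalues with respect to $g$ lies in $\Gamma$ at every point and the equation holds, satisfies $$\max_M|\nabla u|\le C_1\Big(1+\max_{\partial M}|\nabla u|\Big),$$ where the maximum over $\partial M$ is read as $0$ if $\partial M=\emptyset$. -/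

import Mathlib

open scoped Manifold ContDiff

noncomputable section

namespace HessianEquation

/-! ### Coordinates on a manifold with boundary

`M` is an `n`-dimensional manifold, possibly with boundary, modelled on the closed half-space.
A chart is named by the point `c` at which it is the preferred chart. -/

section Coordinates

variable {n : ℕ} [NeZero n] {M : Type*} [TopologicalSpace M] [ChartedSpace (EuclideanHalfSpace n) M]

/-- The coordinate one-form `dx^i` at `x`, for the chart at `c`. -/
def coordForm (c x : M) (i : Fin n) : TangentSpace (𝓡∂ n) x →L[ℝ] ℝ :=
  (EuclideanSpace.proj i : EuclideanSpace ℝ (Fin n) →L[ℝ] ℝ).comp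
    (mfderiv (𝓡∂ n) 𝓘(ℝ, EuclideanSpace ℝ (Fin n)) (extChartAt (𝓡∂ n) c) x)

/-- The coordinate vector `∂_i` at `x`, for the chart at `c` (meaningful for `x` in its domain). -/
def coordVec (c x : M) (i : Fin n) : TangentSpace (𝓡∂ n) x :=
  (mfderiv (𝓡∂ n) 𝓘(ℝ, EuclideanSpace ℝ (Fin n)) (extChartAt (𝓡∂ n) c) x).inverse
    (EuclideanSpace.single i (1 : ℝ) : EuclideanSpace ℝ (Fin n))

/-- The partial derivative `∂_i h` at `x`, for the chart at `c`
(one-sided at boundary points, where necessary). -/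
def chartDeriv (c : M) (h : M → ℝ) (i : Fin n) (x : M) : ℝ :=
  fderivWithin ℝ (fun y => h ((extChartAt (𝓡∂ n) c).symm y)) (Set.range (𝓡∂ n))
    (extChartAt (𝓡∂ n) c x) (EuclideanSpace.single i (1 : ℝ))

/-- The covector `∑ q_i dx^i` at `x`. -/
def covec (c x : M) (q : Fin n → ℝ) : TangentSpace (𝓡∂ n) x →L[ℝ] ℝ :=
  ∑ i, q i • coordForm c x i

/-- The components `p_i = p (∂_i)` of a covector at `x`. -/
def comps (c x : M) (p : TangentSpace (𝓡∂ n) x →L[ℝ] ℝ) : Fin n → ℝ :=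
  fun i => p (coordVec c x i)

/-- The differential of a function. -/
def diff (u : M → ℝ) (x : M) : TangentSpace (𝓡∂ n) x →L[ℝ] ℝ :=
  mfderiv (𝓡∂ n) 𝓘(ℝ, ℝ) u x

/-- `ψ ∈ C^∞(T*M × ℝ)`: in the coordinates `(y, z, q)` induced by each chart, `ψ` is smooth,
up to the boundary. -/
def SmoothScalar (ψ : (x : M) → ℝ → (TangentSpace (𝓡∂ n) x →L[ℝ] ℝ) → ℝ) : Prop :=
  ∀ c : M, ContDiffOn ℝ ∞
    (fun w : EuclideanSpace ℝ (Fin n) × ℝ × (Fin n → ℝ) =>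
      ψ ((extChartAt (𝓡∂ n) c).symm w.1) w.2.1 (covec c _ w.2.2))
    ((extChartAt (𝓡∂ n) c).target ×ˢ Set.univ)

/-- `A = A(x, z, p)` is a smooth family of `(0,2)` tensors: in the coordinates `(y, z, q)`
induced by each chart, all components `A_ij` are smooth, up to the boundary. -/
def SmoothTensor (A : (x : M) → ℝ → (TangentSpace (𝓡∂ n) x →L[ℝ] ℝ) →
    LinearMap.BilinForm ℝ (TangentSpace (𝓡∂ n) x)) : Prop :=
  ∀ (c : M) (i j : Fin n), ContDiffOn ℝ ∞
    (fun w : EuclideanSpace ℝ (Fin n) × ℝ × (Fin n → ℝ) =>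
      A ((extChartAt (𝓡∂ n) c).symm w.1) w.2.1 (covec c _ w.2.2) (coordVec c _ i) (coordVec c _ j))
    ((extChartAt (𝓡∂ n) c).target ×ˢ Set.univ)

variable [IsManifold (𝓡∂ n) ∞ M]
  (g : Bundle.ContMDiffRiemannianMetric (𝓡∂ n) ∞ (EuclideanSpace ℝ (Fin n))
    (fun x : M => TangentSpace (𝓡∂ n) x))

/-- The components `g_ij` of the metric at `x`. -/
def gram (c x : M) : Matrix (Fin n) (Fin n) ℝ :=
  Matrix.of fun i j => g.inner x (coordVec c x i) (coordVec c x j)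

/-- The Christoffel symbols `Γ^k_ij` of the Levi-Civita connection at `x`. -/
def christoffel (c x : M) (k i j : Fin n) : ℝ :=
  (1 / 2) * ∑ l, (gram g c x)⁻¹ k l *
    (chartDeriv c (fun x' => gram g c x' j l) i x + chartDeriv c (fun x' => gram g c x' i l) j x
      - chartDeriv c (fun x' => gram g c x' i j) l x)

/-- The components `∂_i ∂_j u - Γ^k_ij ∂_k u` of the Hessian at `x`. -/
def hessCoord (u : M → ℝ) (c x : M) (i j : Fin n) : ℝ :=
  chartDeriv c (fun x' => chartDeriv c u j x') i x - ∑ k, christoffel g c x k i j * chartDeriv c u k x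

/-- The Hessian `∇²u (ξ, η)` at `x`. -/
def hess (u : M → ℝ) (x : M) (ξ η : TangentSpace (𝓡∂ n) x) : ℝ :=
  ∑ i, ∑ j, hessCoord g u x x i j * coordForm x x i ξ * coordForm x x j η

/-- The norm `|ξ|` of a tangent vector. -/
def vecNorm (x : M) (ξ : TangentSpace (𝓡∂ n) x) : ℝ := √(g.inner x ξ ξ)

/-- The components `p^k = g^{kl} p_l` of the vector dual to a covector `p` (in the chart at `x`). -/
def raised (x : M) (p : TangentSpace (𝓡∂ n) x →L[ℝ] ℝ) (k : Fin n) : ℝ :=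
  ∑ l, (gram g x x)⁻¹ k l * comps x x p l

/-- The norm `|p| = (g^{kl} p_k p_l)^{1/2}` of a covector. -/
def covNorm (x : M) (p : TangentSpace (𝓡∂ n) x →L[ℝ] ℝ) : ℝ :=
  √(∑ k, raised g x p k * comps x x p k)

/-- `|∇u|` at `x`. -/
def gradNorm (u : M → ℝ) (x : M) : ℝ := covNorm g x (diff u x)

/-- The partial covariant derivative `∇'_k ψ` in `x` (for fixed `z`, and `p` parallel):
`∂_k ψ + Γ^m_kl p_m ∂ψ/∂p_l`, in the chart at `x`. -/
def covDerivScalar (ψ : (x : M) → ℝ → (TangentSpace (𝓡∂ n) x →L[ℝ] ℝ) → ℝ)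
    (x : M) (z : ℝ) (p : TangentSpace (𝓡∂ n) x →L[ℝ] ℝ) (k : Fin n) : ℝ :=
  chartDeriv x (fun x' => ψ x' z (covec x x' (comps x x p))) k x
    + ∑ l, ∑ m, christoffel g x x m k l * comps x x p m *
        fderiv ℝ (fun q => ψ x z (covec x x q)) (comps x x p) (Pi.single l 1)

/-- The components `∇'_k A_ij` of the partial covariant derivative of `A` in `x` (for fixed `z`,
and `p` parallel): `∂_k A_ij + Γ^m_kl p_m ∂A_ij/∂p_l - Γ^m_ki A_mj - Γ^m_kj A_im`,
in the chart at `x`. -/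
def covDerivTensor (A : (x : M) → ℝ → (TangentSpace (𝓡∂ n) x →L[ℝ] ℝ) →
      LinearMap.BilinForm ℝ (TangentSpace (𝓡∂ n) x))
    (x : M) (z : ℝ) (p : TangentSpace (𝓡∂ n) x →L[ℝ] ℝ) (k i j : Fin n) : ℝ :=
  chartDeriv x
      (fun x' => A x' z (covec x x' (comps x x p)) (coordVec x x' i) (coordVec x x' j)) k x
    + ∑ l, ∑ m, christoffel g x x m k l * comps x x p m *
        fderiv ℝ (fun q => A x z (covec x x q) (coordVec x x i) (coordVec x x j))
          (comps x x p) (Pi.single l 1)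
    - ∑ m, christoffel g x x m k i * A x z p (coordVec x x m) (coordVec x x j)
    - ∑ m, christoffel g x x m k j * A x z p (coordVec x x i) (coordVec x x m)

/-- `p · ∇_x ψ (x, z, p)`. -/
def pDotGradScalar (ψ : (x : M) → ℝ → (TangentSpace (𝓡∂ n) x →L[ℝ] ℝ) → ℝ)
    (x : M) (z : ℝ) (p : TangentSpace (𝓡∂ n) x →L[ℝ] ℝ) : ℝ :=
  ∑ k, raised g x p k * covDerivScalar g ψ x z p k

/-- `p · ∇_x A^{ξξ} (x, z, p)`. -/
def pDotGradTensor (A : (x : M) → ℝ → (TangentSpace (𝓡∂ n) x →L[ℝ] ℝ) →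
      LinearMap.BilinForm ℝ (TangentSpace (𝓡∂ n) x))
    (x : M) (z : ℝ) (p : TangentSpace (𝓡∂ n) x →L[ℝ] ℝ) (ξ : TangentSpace (𝓡∂ n) x) : ℝ :=
  ∑ k, raised g x p k *
    ∑ i, ∑ j, covDerivTensor g A x z p k i j * coordForm x x i ξ * coordForm x x j ξ

/-- `l = (λ_1, …, λ_n)` are the eigenvalues of the form `U` on `T_x M` with respect to `g`:
`U` is diagonal with these entries in some `g`-orthonormal basis. -/
def IsEigenvalues (x : M) (U : TangentSpace (𝓡∂ n) x → TangentSpace (𝓡∂ n) x → ℝ)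
    (l : Fin n → ℝ) : Prop :=
  ∃ e : Fin n → TangentSpace (𝓡∂ n) x,
    (∀ i j, g.inner x (e i) (e j) = if i = j then 1 else 0) ∧
    ∀ i j, U (e i) (e j) = if i = j then l i else 0

/-- `u` is an admissible solution of `f (λ (∇²u + A[u])) = ψ (x, u, ∇u)`. As the cone and `f` are
symmetric, the order of the eigenvalues does not matter. -/
def IsAdmissibleSolution (cone : Set (Fin n → ℝ)) (f : (Fin n → ℝ) → ℝ)
    (A : (x : M) → ℝ → (TangentSpace (𝓡∂ n) x →L[ℝ] ℝ) →
      LinearMap.BilinForm ℝ (TangentSpace (𝓡∂ n) x))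
    (ψ : (x : M) → ℝ → (TangentSpace (𝓡∂ n) x →L[ℝ] ℝ) → ℝ) (u : M → ℝ) : Prop :=
  ∀ x : M, ∃ l : Fin n → ℝ,
    IsEigenvalues g x (fun ξ η => hess g u x ξ η + A x (u x) (diff u x) ξ η) l ∧
    l ∈ cone ∧ f l = ψ x (u x) (diff u x)

/-- The growth conditions on the `x`- and `z`-derivatives of `A` and `ψ`, with bounds
`b₁`, `b₂` and exponents `γ₁`, `γ₂`. -/
def GrowthXZ (A : (x : M) → ℝ → (TangentSpace (𝓡∂ n) x →L[ℝ] ℝ) →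
      LinearMap.BilinForm ℝ (TangentSpace (𝓡∂ n) x))
    (ψ : (x : M) → ℝ → (TangentSpace (𝓡∂ n) x →L[ℝ] ℝ) → ℝ)
    (b₁ b₂ : M → ℝ → ℝ) (γ₁ γ₂ : ℝ) : Prop :=
  ∀ (x : M) (z : ℝ) (p : TangentSpace (𝓡∂ n) x →L[ℝ] ℝ),
    (∀ ξ : TangentSpace (𝓡∂ n) x,
      pDotGradTensor g A x z p ξ + covNorm g x p ^ 2 * deriv (fun s => A x s p ξ ξ) z
        ≤ b₁ x z * vecNorm g x ξ ^ 2 * (1 + covNorm g x p ^ γ₁)) ∧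
    pDotGradScalar g ψ x z p + covNorm g x p ^ 2 * deriv (fun s => ψ x s p) z
      ≥ -(b₂ x z * (1 + covNorm g x p ^ γ₂))

/-- The bounds of `-ψ_z`, `p · D_p ψ` and `-p · D_p A^{ξξ} / |ξ|²` by `b (x, z) (1 + |p|^γ)`.
The radial derivative `p · D_p` is the derivative in `t` at `t = 1` along `t ↦ t p`. -/
def GrowthP (A : (x : M) → ℝ → (TangentSpace (𝓡∂ n) x →L[ℝ] ℝ) →
      LinearMap.BilinForm ℝ (TangentSpace (𝓡∂ n) x))
    (ψ : (x : M) → ℝ → (TangentSpace (𝓡∂ n) x →L[ℝ] ℝ) → ℝ)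
    (b : M → ℝ → ℝ) (γ : ℝ) : Prop :=
  ∀ (x : M) (z : ℝ) (p : TangentSpace (𝓡∂ n) x →L[ℝ] ℝ),
    -deriv (fun s => ψ x s p) z ≤ b x z * (1 + covNorm g x p ^ γ) ∧
    deriv (fun t : ℝ => ψ x z (t • p)) 1 ≤ b x z * (1 + covNorm g x p ^ γ) ∧
    ∀ ξ : TangentSpace (𝓡∂ n) x, ξ ≠ 0 →
      -deriv (fun t : ℝ => A x z (t • p) ξ ξ) 1 / vecNorm g x ξ ^ 2
        ≤ b x z * (1 + covNorm g x p ^ γ)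

/-- The bound of `A^{ξη}` for `ξ ⊥ η` by `b (x, z) |ξ| |η| (1 + |p|^γ)`. -/
def GrowthOffDiagonal (A : (x : M) → ℝ → (TangentSpace (𝓡∂ n) x →L[ℝ] ℝ) →
      LinearMap.BilinForm ℝ (TangentSpace (𝓡∂ n) x))
    (b : M → ℝ → ℝ) (γ : ℝ) : Prop :=
  ∀ (x : M) (z : ℝ) (p : TangentSpace (𝓡∂ n) x →L[ℝ] ℝ) (ξ η : TangentSpace (𝓡∂ n) x),
    g.inner x ξ η = 0 →
      |A x z p ξ η| ≤ b x z * vecNorm g x ξ * vecNorm g x η * (1 + covNorm g x p ^ γ)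

end Coordinates

/-- A function on `M × ℝ` (with `M` compact) that is locally bounded above. -/
def LocBddAbove {M : Type*} (b : M → ℝ → ℝ) : Prop :=
  ∀ K : ℝ, ∃ B : ℝ, ∀ (x : M) (z : ℝ), |z| ≤ K → b x z ≤ B

/-! ### The symmetric function `f` on its cone -/

section Cone

variable {n : ℕ}

/-- The partial derivative `f_i` at `l`. -/
def partialF (f : (Fin n → ℝ) → ℝ) (i : Fin n) (l : Fin n → ℝ) : ℝ :=
  fderiv ℝ f l (Pi.single i 1)

/-- An open, convex, symmetric cone with vertex at the origin which contains the positive cone and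
is not the whole space. -/
structure IsSymmetricCone (cone : Set (Fin n → ℝ)) : Prop where
  isOpen : IsOpen cone
  convex : Convex ℝ cone
  smul_mem : ∀ t : ℝ, 0 < t → ∀ l ∈ cone, t • l ∈ cone
  perm_mem : ∀ τ : Equiv.Perm (Fin n), ∀ l ∈ cone, l ∘ τ ∈ cone
  positive_subset : {l : Fin n → ℝ | ∀ i, 0 < l i} ⊆ cone
  ne_univ : cone ≠ Set.univ

/-- The standard structure conditions: `f` is smooth, symmetric, strictly increasing in each
variable and concave on the cone, and `limsup f ≤ 0` at each boundary point of the cone. -/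
structure IsStructureFunction (cone : Set (Fin n → ℝ)) (f : (Fin n → ℝ) → ℝ) : Prop where
  smooth : ContDiffOn ℝ ∞ f cone
  symm : ∀ τ : Equiv.Perm (Fin n), ∀ l ∈ cone, f (l ∘ τ) = f l
  partial_pos : ∀ l ∈ cone, ∀ i, 0 < partialF f i l
  concave : ConcaveOn ℝ cone f
  boundary : ∀ l₀ ∈ frontier cone,
    Filter.limsup (fun l => ((f l : ℝ) : EReal)) (nhdsWithin l₀ cone) ≤ 0

end Cone

end HessianEquation

end

open HessianEquation

open scoped Manifold ContDiff

noncomputable section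

namespace HessianEquation


/-! ### The gradient of a symmetric concave function on a convex cone. -/

section ConeLemmas

variable {n : ℕ} {cone : Set (Fin n → ℝ)} {f : (Fin n → ℝ) → ℝ}

/-! The proof is a maximum principle for `|∇u|⁴ / (κ - u)` with `κ = |K| + 1`, so that `κ - u` lies
between 1 and `2|K| + 1`. At a boundary maximum the estimate is immediate. At an interior maximum
write `r = |∇u|`, `m = κ - u`, `k = r² / (4m)`, and choose an orthonormal frame diagonalising `∇²u +
A` with eigenvalues `λ_i`; let `p_i` be the components of `∇u`.

The first order condition is `∇²u(·, ∇u) = -k du`, that is `λ_i p_i = -k p_i + ∑_j A_ij p_j`. Choose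
`i` with `p_i² ≥ r² / n`. Concavity in `p` makes `A_ii` grow at most linearly from above, and the
entries off the diagonal grow like `r^γ` with `γ < 2`, whereas `k` is of order `r²`. Hence `λ_i < 0`
once `r` is large (`eigenvalue_neg_of_large`), and the structure condition gives `f_i ≥ ν (1 + ∑
f_j)`.

The second order condition, contracted with `f_i` and combined with the commutation of third
covariant derivatives and with the equation differentiated along `∇u`, leaves the positive term `(r²
/ 8m²) ∑ f_i p_i²`, which is at least a multiple of `r⁴ (1 + ∑ f_j)` by the choice of `i`. The term
`k ∑ f_i λ_i` is nonnegative, and everything else is of lower order in `r` times `1 + ∑ f_j`: the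
powers are `γ₁`, `γ₂`, `2 + γ`, 2 (curvature) and 3 (linear growth of `A`). The first order
condition also turns the variation of `du` along `∇u` into `-k du` plus parallel transport; this is
why only radial derivatives in `p` of `A` and `ψ` enter. So `r` is bounded:
`interior_maximum_conditions` collects the inequality and `gradNorm_le_of_interior_maximum` draws
the contradiction.

Two points need care. First, `ψ` is positive but need not have a positive lower bound as `p` varies,
so the condition at negative eigenvalues, given only on `{f > σ}`, must be extended to `{f > 0}`
with one constant. Where `f` is small, concavity bounds `∑ f_i` from below, and `f_j ≥ c ∑ f_i` at
every negative entry because the gradient of `f` lies in the dual cone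
(`IsStructureFunction.exists_partialF_lower_bound`). Second, eigenvalues need not be differentiable
where they coincide. By Schur–Horn, `f` of the diagonal in any orthonormal frame is at least `f` of
the eigenvalues; along a frame that diagonalises at one point, the difference has a minimum there,
and its vanishing derivative is the differentiated equation (`differentiated_equation`).

The Hessian, the gradient norm and the covariant derivatives of the data are defined at `x` in the
preferred chart at `x`. To differentiate near a point, and to get uniform constants by compactness,
everything is moved into a single chart by the transformation laws of Christoffel symbols, Hessians
and horizontal derivatives. -/

theorem IsSymmetricCone.add_mem (hc : IsSymmetricCone cone) {l m : Fin n → ℝ}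
    (hl : l ∈ cone) (hm : m ∈ cone) : l + m ∈ cone := by
  have h := hc.convex hl hm (a := 1 / 2) (b := 1 / 2) (by norm_num) (by norm_num) (by norm_num)
  have h2 := hc.smul_mem 2 (by norm_num) _ h
  convert h2 using 1
  ext i
  simp
  ring

theorem IsStructureFunction.differentiableAt (hc : IsSymmetricCone cone)
    (hf : IsStructureFunction cone f) {l : Fin n → ℝ} (hl : l ∈ cone) :
    DifferentiableAt ℝ f l :=
  (hf.smooth.contDiffAt (hc.isOpen.mem_nhds hl)).differentiableAt (by simp)

theorem fderiv_eq_sum_partialF (l m : Fin n → ℝ) :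
    fderiv ℝ f l m = ∑ i, partialF f i l * m i := by
  conv_lhs => rw [← Finset.univ_sum_single m, map_sum]
  refine Finset.sum_congr rfl fun i _ => ?_
  have : (Pi.single i (m i) : Fin n → ℝ) = m i • Pi.single i 1 := by
    rw [← Pi.single_smul]; simp
  rw [this, map_smul, partialF, smul_eq_mul, mul_comm]

/-- A concave function lies below its tangent plane. -/
theorem IsStructureFunction.le_tangent (hc : IsSymmetricCone cone)
    (hf : IsStructureFunction cone f) {l m : Fin n → ℝ} (hl : l ∈ cone) (hm : m ∈ cone) :
    f m ≤ f l + ∑ i, partialF f i l * (m i - l i) := by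
  have hd := (hf.differentiableAt hc hl).hasFDerivAt
  have hline : HasDerivAt (fun t : ℝ => l + t • (m - l)) (m - l) 0 := by
    simpa using ((hasDerivAt_id (0 : ℝ)).smul_const (m - l)).const_add l
  have hd0 : HasFDerivAt f (fderiv ℝ f l) (l + (0 : ℝ) • (m - l)) := by simpa using hd
  have hcomp := hd0.comp_hasDerivAt 0 hline
  have hcomp' := hcomp.hasDerivWithinAt (s := Set.Ioi 0)
  have hs := (hasDerivWithinAt_iff_tendsto_slope' (by simp)).1 hcomp'
  have key : f m - f l ≤ fderiv ℝ f l (m - l) := by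
    refine ge_of_tendsto hs ?_
    filter_upwards [Ioo_mem_nhdsGT (show (0 : ℝ) < 1 by norm_num)] with t ht
    have hcv := hf.concave.2 hl hm (show (0 : ℝ) ≤ 1 - t by linarith [ht.2]) ht.1.le (by ring)
    have e : (1 - t) • l + t • m = l + t • (m - l) := by
      ext i; simp; ring
    rw [e] at hcv
    simp only [smul_eq_mul] at hcv
    rw [slope_def_field]
    simp only [Function.comp, zero_smul, add_zero, sub_zero]
    rw [le_div_iff₀ ht.1]
    nlinarith
  rw [fderiv_eq_sum_partialF] at key
  simp only [Pi.sub_apply] at key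
  linarith

/-- The radial derivative of `f` is nonnegative by hypothesis; compare with the tangent plane at the
far point `t • m`. -/
theorem IsStructureFunction.le_smul (hc : IsSymmetricCone cone)
    (hf : IsStructureFunction cone f) (hfl : ∀ l ∈ cone, 0 ≤ ∑ i, partialF f i l * l i)
    {m : Fin n → ℝ} (hm : m ∈ cone) {t : ℝ} (ht : 1 ≤ t) : f m ≤ f (t • m) := by
  have h1 := hf.le_tangent hc (hc.smul_mem t (by linarith) _ hm) hm
  have h2 := hfl _ (hc.smul_mem t (by linarith) _ hm)
  have e : t * ∑ i, partialF f i (t • m) * (m i - (t • m) i)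
      = -((t - 1) * ∑ i, partialF f i (t • m) * (t • m) i) := by
    rw [Finset.mul_sum, Finset.mul_sum, ← Finset.sum_neg_distrib]
    refine Finset.sum_congr rfl fun i _ => ?_
    simp only [Pi.smul_apply, smul_eq_mul]; ring
  have : t * ∑ i, partialF f i (t • m) * (m i - (t • m) i) ≤ 0 := by
    rw [e]; have := mul_nonneg (sub_nonneg.2 ht) h2; linarith
  have : ∑ i, partialF f i (t • m) * (m i - (t • m) i) ≤ 0 := by
    by_contra! h
    have := mul_pos (show (0 : ℝ) < t by linarith) h
    linarith
  linarith

/-- The gradient of `f` lies in the dual cone. -/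
theorem IsStructureFunction.sum_partialF_mul_nonneg (hc : IsSymmetricCone cone)
    (hf : IsStructureFunction cone f) (hfl : ∀ l ∈ cone, 0 ≤ ∑ i, partialF f i l * l i)
    {l m : Fin n → ℝ} (hl : l ∈ cone) (hm : m ∈ cone) :
    0 ≤ ∑ i, partialF f i l * m i := by
  set d := ∑ i, partialF f i l * m i with hd
  set C := f l - (1 / 2 * f ((2 : ℝ) • l) + 1 / 2 * f ((2 : ℝ) • m)) with hC
  -- Estimate `f (l + t m)` twice. The tangent plane at `l` gives the upper bound `f l + t d`. Since
  -- `l + t m` is the midpoint of `2l` and `2tm`, concavity and monotonicity along rays give a lower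
  -- bound independent of `t`.
  have key : ∀ t : ℝ, 1 ≤ t → -C ≤ t * d := by
    intro t ht
    have htm := hc.smul_mem t (by linarith) _ hm
    have h1 := hf.le_tangent hc hl (hc.add_mem hl htm)
    have e : ∑ i, partialF f i l * ((l + t • m) i - l i) = t * d := by
      rw [hd, Finset.mul_sum]
      refine Finset.sum_congr rfl fun i _ => ?_
      simp only [Pi.add_apply, Pi.smul_apply, smul_eq_mul]; ring
    have h2 := hf.concave.2 (hc.smul_mem 2 (by norm_num) _ hl) (hc.smul_mem 2 (by norm_num) _ htm)
      (show (0 : ℝ) ≤ 1 / 2 by norm_num) (show (0 : ℝ) ≤ 1 / 2 by norm_num) (by norm_num)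
    have e2 : (1 / 2 : ℝ) • (2 : ℝ) • l + (1 / 2 : ℝ) • (2 : ℝ) • t • m = l + t • m := by
      ext i; simp
    rw [e2] at h2
    have h3 := hf.le_smul hc hfl (hc.smul_mem 2 (by norm_num) _ hm) ht
    rw [smul_comm] at h3
    simp only [smul_eq_mul] at h2
    rw [e] at h1
    linarith
  by_contra! hneg
  have hC1 := key 1 le_rfl
  -- This `t` makes `t d = d - (C + 1)`, which is below `-C` as `d < 0`.
  have h2 := key (1 + (C + 1) / (-d)) (by
    have : 0 ≤ (C + 1) / (-d) := div_nonneg (by linarith) (by linarith)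
    linarith)
  have : (1 + (C + 1) / (-d)) * d = d - (C + 1) := by
    have hd0 : d ≠ 0 := hneg.ne
    field_simp
    ring
  linarith

/-- Compare `f` at `l` with the tangent plane at `l` evaluated at the point where entries `i` and
`j` are swapped: symmetry gives `0 ≤ (f_i - f_j) (l_j - l_i)`. -/
theorem IsStructureFunction.partialF_le_of_lt (hc : IsSymmetricCone cone)
    (hf : IsStructureFunction cone f) {l : Fin n → ℝ} (hl : l ∈ cone) {i j : Fin n}
    (hij : l j < l i) : partialF f i l ≤ partialF f j l := by
  have hne : i ≠ j := by rintro rfl; exact lt_irrefl _ hij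
  have h := hf.le_tangent hc hl (hc.perm_mem (Equiv.swap i j) l hl)
  rw [hf.symm _ _ hl] at h
  have e : ∑ k, partialF f k l * ((l ∘ Equiv.swap i j) k - l k)
      = (partialF f i l - partialF f j l) * (l j - l i) := by
    rw [← Finset.sum_subset (Finset.subset_univ {i, j}), Finset.sum_pair hne]
    · simp; ring
    · intro k _ hk
      simp only [Finset.mem_insert, Finset.mem_singleton, not_or] at hk
      simp [Equiv.swap_apply_of_ne_of_ne hk.1 hk.2]
  rw [e] at h
  by_contra! hcon
  nlinarith

/-- At a negative entry the partial derivative controls the whole gradient. -/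
theorem IsStructureFunction.exists_partialF_ratio (hc : IsSymmetricCone cone)
    (hf : IsStructureFunction cone f) (hfl : ∀ l ∈ cone, 0 ≤ ∑ i, partialF f i l * l i) :
    ∃ c : ℝ, 0 < c ∧ ∀ l ∈ cone, ∀ j, l j < 0 → c * ∑ i, partialF f i l ≤ partialF f j l := by
  classical
  -- One constant is found for each set `S` of negative entries; there are finitely many such sets.
  -- For a set that occurs, a fixed point `m` of the cone with this sign pattern serves as a test
  -- vector for all `l` with the same pattern.
  have hS : ∀ S : Finset (Fin n), ∃ C : ℝ, 0 < C ∧ ∀ l ∈ cone,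
      (∀ i, i ∈ S ↔ l i < 0) → ∀ j, l j < 0 → ∑ i, partialF f i l ≤ C * partialF f j l := by
    intro S
    by_cases hex : ∃ m ∈ cone, ∀ i, i ∈ S ↔ m i < 0
    · obtain ⟨m, hm, hmS⟩ := hex
      set T := ∑ i, |m i| with hT
      have hT0 : 0 ≤ T := Finset.sum_nonneg fun i _ => abs_nonneg _
      -- The sum bounds the ratios `f_i / f_j` one by one: at a nonnegative entry the ratio is at
      -- most 1, at a negative one at most `T / (-m i)`.
      refine ⟨∑ i, (1 + if m i < 0 then T / (-m i) else 0), ?_, ?_⟩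
      · by_cases hn : (Finset.univ : Finset (Fin n)).Nonempty
        · refine Finset.sum_pos (fun i _ => ?_) hn
          split_ifs with h
          · have := div_nonneg hT0 (neg_nonneg.2 h.le); linarith
          · norm_num
        -- Without indices the space is a single point, so a nonempty cone would be the whole space.
        · exfalso
          apply hc.ne_univ
          have : IsEmpty (Fin n) := by
            rw [Finset.univ_nonempty_iff, not_nonempty_iff] at hn; exact hn
          ext l
          simp [Subsingleton.elim l m, hm]
      · intro l hl hlS j hj
        rw [Finset.sum_mul]
        refine Finset.sum_le_sum fun i _ => ?_
        have hFj := hf.partial_pos l hl j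
        by_cases hi : l i < 0
        · have hmi : m i < 0 := (hmS i).1 ((hlS i).2 hi)
          rw [if_pos hmi]
          -- Pair the gradient at `l` with `m`. Other negative entries only lower the sum, and
          -- nonnegative entries carry `f_k ≤ f_j`; hence `f_i (-m_i) ≤ f_j T`.
          have hdual := hf.sum_partialF_mul_nonneg hc hfl hl hm
          have h1 : ∑ k, partialF f k l * m k ≤ partialF f i l * m i + partialF f j l * T := by
            rw [hT, Finset.mul_sum, ← Finset.add_sum_erase _ _ (Finset.mem_univ i)]
            refine add_le_add le_rfl ?_
            calc _ ≤ ∑ k ∈ Finset.univ.erase i, partialF f j l * |m k| := ?_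
              _ ≤ _ := Finset.sum_le_sum_of_subset_of_nonneg (Finset.subset_univ _)
                  (fun k _ _ => mul_nonneg hFj.le (abs_nonneg _))
            refine Finset.sum_le_sum fun k _ => ?_
            by_cases hk : l k < 0
            · have hmk : m k < 0 := (hmS k).1 ((hlS k).2 hk)
              have := mul_pos_of_neg_of_neg (neg_lt_zero.2 (hf.partial_pos l hl k)) hmk
              have := mul_nonneg hFj.le (abs_nonneg (m k))
              nlinarith
            · have hle := hf.partialF_le_of_lt hc hl (i := k) (j := j) (by linarith)
              have hmk : 0 ≤ m k := by
                by_contra! h; exact hk ((hlS k).1 ((hmS k).2 h))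
              rw [abs_of_nonneg hmk]
              exact mul_le_mul_of_nonneg_right hle hmk
          have h2 : partialF f i l * (-m i) ≤ partialF f j l * T := by linarith
          have h3 : partialF f i l ≤ partialF f j l * T / (-m i) := by
            rw [le_div_iff₀ (by linarith)]; exact h2
          have e : (1 + T / -m i) * partialF f j l
              = partialF f j l + partialF f j l * T / (-m i) := by ring
          rw [e]; linarith
        · have hmi : ¬ m i < 0 := fun h => hi ((hlS i).1 ((hmS i).2 h))
          rw [if_neg hmi]
          have := hf.partialF_le_of_lt hc hl (i := i) (j := j) (by linarith)
          linarith
    · refine ⟨1, one_pos, fun l hl hlS => ?_⟩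
      exact (hex ⟨l, hl, hlS⟩).elim
  choose C hC0 hC using hS
  have hpos : 0 < ∑ S, C S := Finset.sum_pos (fun S _ => hC0 S) Finset.univ_nonempty
  refine ⟨(∑ S, C S)⁻¹, inv_pos.2 hpos, fun l hl j hj => ?_⟩
  rw [inv_mul_le_iff₀ hpos]
  have h := hC (Finset.univ.filter fun i => l i < 0) l hl (by simp) j hj
  refine h.trans ?_
  refine mul_le_mul_of_nonneg_right ?_ (hf.partial_pos l hl j).le
  exact Finset.single_le_sum (f := C) (fun S _ => (hC0 S).le) (Finset.mem_univ _)

/-- The lower bound for `f_j` at negative entries holds on all of `{f > 0}`. -/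
theorem IsStructureFunction.exists_partialF_lower_bound (hc : IsSymmetricCone cone)
    (hf : IsStructureFunction cone f) (hfl : ∀ l ∈ cone, 0 ≤ ∑ i, partialF f i l * l i)
    (hneg : ∀ σ : ℝ, 0 < σ → ∃ ν₀ : ℝ, 0 < ν₀ ∧ ∀ l ∈ cone, σ < f l → ∀ j, l j < 0 →
      ν₀ * (1 + ∑ i, partialF f i l) ≤ partialF f j l) :
    ∃ ν : ℝ, 0 < ν ∧ ∀ l ∈ cone, 0 < f l → ∀ j, l j < 0 →
      ν * (1 + ∑ i, partialF f i l) ≤ partialF f j l := by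
  obtain ⟨c, hc0, hcr⟩ := hf.exists_partialF_ratio hc hfl
  by_cases hex : ∃ l ∈ cone, 0 < f l
  · obtain ⟨m, hm, hfm⟩ := hex
    -- The diagonal point `(t, …, t)` exceeds `m` in every entry, so `f` is positive there too; `s`
    -- below is a positive lower bound for its value.
    set t : ℝ := 1 + ∑ i, |m i| with ht
    have ht0 : 0 < t := by
      have : 0 ≤ ∑ i, |m i| := Finset.sum_nonneg fun i _ => abs_nonneg _
      linarith
    have htm : ∀ i, m i < t := fun i => by
      have h1 := Finset.single_le_sum (f := fun i => |m i|) (fun i _ => abs_nonneg _)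
        (Finset.mem_univ i)
      have h2 := le_abs_self (m i)
      linarith
    have hT : (fun _ => t : Fin n → ℝ) ∈ cone := hc.positive_subset fun _ => ht0
    obtain ⟨s, hs0, hs⟩ : ∃ s : ℝ, 0 < s ∧ s ≤ f (fun _ => t) := by
      have h1 := hf.le_tangent hc hT hm
      refine ⟨f m, hfm, h1.trans ?_⟩
      have : ∑ i, partialF f i (fun _ => t) * (m i - t) ≤ 0 :=
        Finset.sum_nonpos fun i _ => mul_nonpos_of_nonneg_of_nonpos
          (hf.partial_pos _ hT i).le (by linarith [htm i])
      linarith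
    obtain ⟨ν₀, hν₀, hν⟩ := hneg (s / 2) (by linarith)
    -- On `{f ≤ s/2}` one half of `c ∑ f_i` will pay for `ν ∑ f_i` and the other half for `ν`; `s /
    -- (2t)` is the lower bound for `∑ f_i` there.
    set ν := min ν₀ (min (c / 2) (c / 2 * (s / (2 * t)))) with hν'
    have hνpos : 0 < ν := lt_min hν₀ (lt_min (by linarith) (by positivity))
    refine ⟨ν, hνpos, fun l hl hfl0 j hj => ?_⟩
    have hS : 0 ≤ ∑ i, partialF f i l := Finset.sum_nonneg fun i _ => (hf.partial_pos l hl i).le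
    by_cases hσ : s / 2 < f l
    · exact (mul_le_mul_of_nonneg_right (min_le_left _ _) (by linarith)).trans (hν l hl hσ j hj)
    -- Here `f l ≤ s/2`. Evaluating the tangent plane at `(t, …, t)` gives `s ≤ s/2 + t ∑ f_i - ∑
    -- f_i l_i`, whence `∑ f_i ≥ s / (2t)`.
    · have h1 := hf.le_tangent hc hl hT
      have h2 := hfl l hl
      have e : ∑ i, partialF f i l * (t - l i)
          = t * ∑ i, partialF f i l - ∑ i, partialF f i l * l i := by
        rw [Finset.mul_sum, ← Finset.sum_sub_distrib]
        exact Finset.sum_congr rfl fun i _ => by ring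
      rw [e] at h1
      have h3 : s / (2 * t) ≤ ∑ i, partialF f i l := by
        rw [div_le_iff₀ (by positivity)]; linarith
      have h4 := hcr l hl j hj
      have h5 : ν * 1 ≤ c / 2 * ∑ i, partialF f i l := by
        rw [mul_one]
        exact ((min_le_right _ _).trans (min_le_right _ _)).trans
          (mul_le_mul_of_nonneg_left h3 (by linarith))
      have h6 : ν * ∑ i, partialF f i l ≤ c / 2 * ∑ i, partialF f i l :=
        mul_le_mul_of_nonneg_right ((min_le_right _ _).trans (min_le_left _ _)) hS
      linarith
  · exact ⟨1, one_pos, fun l hl h => (hex ⟨l, hl, h⟩).elim⟩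

/-- **Schur–Horn inequality** for symmetric concave functions. -/
theorem IsStructureFunction.le_doublyStochastic (hc : IsSymmetricCone cone)
    (hf : IsStructureFunction cone f) {l : Fin n → ℝ} (hl : l ∈ cone)
    {P : Matrix (Fin n) (Fin n) ℝ} (hP : P ∈ doublyStochastic ℝ (Fin n)) :
    P.mulVec l ∈ cone ∧ f l ≤ f (P.mulVec l) := by
  -- By Birkhoff, `P l` is a convex combination of rearrangements of `l`; all of these lie in the
  -- cone and share one value of `f`.
  obtain ⟨w, hw0, hw1, hw⟩ := exists_eq_sum_perm_of_mem_doublyStochastic hP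
  have e : P.mulVec l = ∑ σ, w σ • (l ∘ σ) := by
    rw [← hw]
    ext i
    simp [Matrix.sum_mulVec, Matrix.smul_mulVec, Finset.sum_apply, Matrix.permMatrix_mulVec]
  rw [e]
  refine ⟨hc.convex.sum_mem (fun σ _ => hw0 σ) hw1 fun σ _ => hc.perm_mem σ l hl, ?_⟩
  have := hf.concave.le_map_sum (t := Finset.univ) (fun σ _ => hw0 σ) hw1
    (p := fun σ : Equiv.Perm (Fin n) => l ∘ σ) fun σ _ => hc.perm_mem σ l hl
  refine le_trans ?_ this
  simp [hf.symm _ _ hl, ← Finset.sum_mul, hw1]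

end ConeLemmas

/-! ### Orthonormal frames, diagonal entries and orthonormalisation of curves of frames. -/

section Frames

/-- Expansion of a vector in an orthonormal frame. -/
theorem eq_sum_of_orthonormal {n : ℕ} {V : Type*} [AddCommGroup V] [Module ℝ V]
    [FiniteDimensional ℝ V] (hV : Module.finrank ℝ V = n) (ip : LinearMap.BilinForm ℝ V)
    {e : Fin n → V} (he : ∀ i j, ip (e i) (e j) = if i = j then 1 else 0) (v : V) :
    v = ∑ j, ip v (e j) • e j := by
  have hli : LinearIndependent ℝ e := by
    rw [Fintype.linearIndependent_iff]
    intro c hc i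
    have h := congrArg (fun w => ip w (e i)) hc
    simpa [map_sum, he] using h
  have hspan := hli.span_eq_top_of_card_eq_finrank' (by simp [hV])
  have hv : v ∈ Submodule.span ℝ (Set.range e) := by rw [hspan]; trivial
  obtain ⟨c, rfl⟩ := (Submodule.mem_span_range_iff_exists_fun ℝ).1 hv
  refine Finset.sum_congr rfl fun j _ => ?_
  simp [map_sum, he]

/-- The diagonal entries of a form in an orthonormal frame are obtained from its eigenvalues by a
doubly stochastic matrix. -/
theorem exists_doublyStochastic_diagonal {n : ℕ} {V : Type*} [AddCommGroup V] [Module ℝ V]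
    [FiniteDimensional ℝ V] (hV : Module.finrank ℝ V = n) (ip U : LinearMap.BilinForm ℝ V)
    (hsymm : ∀ v w, ip v w = ip w v)
    {e e' : Fin n → V} (he : ∀ i j, ip (e i) (e j) = if i = j then 1 else 0)
    (he' : ∀ i j, ip (e' i) (e' j) = if i = j then 1 else 0) {l : Fin n → ℝ}
    (hU : ∀ i j, U (e' i) (e' j) = if i = j then l i else 0) :
    ∃ P ∈ doublyStochastic ℝ (Fin n), ∀ i, U (e i) (e i) = P.mulVec l i := by
  -- The change of frame is orthogonal, so the squares of its entries sum to 1 along rows and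
  -- columns.
  set O : Matrix (Fin n) (Fin n) ℝ := Matrix.of fun i j => ip (e i) (e' j) with hO
  have hexp : ∀ i, e i = ∑ j, O i j • e' j := fun i => eq_sum_of_orthonormal hV ip he' (e i)
  have hOO : O * O.transpose = 1 := by
    ext i j
    have h := he i j
    rw [hexp i] at h
    simp only [map_sum, map_smul, LinearMap.sum_apply, LinearMap.smul_apply, smul_eq_mul] at h
    simp only [Matrix.mul_apply, Matrix.transpose_apply, Matrix.one_apply]
    rw [← h]
    refine Finset.sum_congr rfl fun k _ => ?_
    rw [hsymm (e' k)]; rfl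
  have hOO' := mul_eq_one_comm.1 hOO
  refine ⟨Matrix.of fun i j => O i j ^ 2, ?_, ?_⟩
  · rw [mem_doublyStochastic_iff_sum]
    refine ⟨fun i j => sq_nonneg _, fun i => ?_, fun j => ?_⟩
    · have := congrFun (congrFun hOO i) i
      simpa [Matrix.mul_apply, sq] using this
    · have := congrFun (congrFun hOO' j) j
      simpa [Matrix.mul_apply, sq] using this
  · intro i
    conv_lhs => rw [hexp i]
    simp only [map_sum, map_smul, LinearMap.sum_apply, LinearMap.smul_apply, smul_eq_mul, hU,
      Matrix.mulVec, dotProduct, Matrix.of_apply]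
    refine Finset.sum_congr rfl fun j _ => ?_
    simp
    ring

/-- Near the identity of a Banach algebra with an anti-involution `τ`, a `τ`-symmetric curve with
vanishing velocity has a `τ`-symmetric inverse square root with vanishing velocity. -/
theorem exists_invSqrt_curve {𝔸 : Type*} [NormedRing 𝔸] [NormedAlgebra ℝ 𝔸] [CompleteSpace 𝔸]
    (τ : 𝔸 →L[ℝ] 𝔸) (hτ : ∀ a b, τ (a * b) = τ b * τ a) (hτ1 : τ 1 = 1) {B : ℝ → 𝔸}
    (hB0 : B 0 = 1) (hBd : HasDerivAt B 0 0) (hsymm : ∀ᶠ s in nhds (0 : ℝ), τ (B s) = B s) :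
    ∃ S : ℝ → 𝔸, S 0 = 1 ∧ HasDerivAt S 0 0 ∧
      ∀ᶠ s in nhds (0 : ℝ), S s * B s * τ (S s) = 1 := by
  let L : 𝔸 ≃L[ℝ] 𝔸 := ContinuousLinearEquiv.smulLeft (Units.mk0 (2 : ℝ) two_ne_zero)
  have hsq : HasStrictFDerivAt (fun X : 𝔸 => X * X) (L : 𝔸 →L[ℝ] 𝔸) 1 := by
    have h := (hasStrictFDerivAt_id (𝕜 := ℝ) (1 : 𝔸)).fun_mul' (hasStrictFDerivAt_id (1 : 𝔸))
    refine h.congr_fderiv ?_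
    ext X
    simp [L, two_smul, Units.smul_def]
  -- `R` is the square root of `B` near 1 given by the inverse function theorem: squaring has
  -- derivative twice the identity at 1.
  set R : ℝ → 𝔸 := fun s => hsq.localInverse _ _ _ (B s) with hR
  have hinv1 : hsq.localInverse _ _ _ (1 : 𝔸) = 1 := by
    have := hsq.localInverse_apply_image; simpa using this
  have hR0 : R 0 = 1 := by simp only [hR, hB0]; exact hinv1
  have hRd : HasDerivAt R 0 0 := by
    have h1 := hsq.to_localInverse.hasFDerivAt
    have h2 : HasFDerivAt (hsq.localInverse _ _ _) (L.symm : 𝔸 →L[ℝ] 𝔸) (B 0) := by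
      rw [hB0]; simpa using h1
    have h3 : HasDerivAt R _ 0 := h2.comp_hasDerivAt (0 : ℝ) hBd
    simpa using h3
  have hBc : Filter.Tendsto B (nhds 0) (nhds ((fun X : 𝔸 => X * X) 1)) := by
    have := hBd.continuousAt.tendsto
    rw [hB0] at this; simpa using this
  have hRR : ∀ᶠ s in nhds (0 : ℝ), R s * R s = B s :=
    hBc.eventually hsq.eventually_right_inverse
  -- `τ (R s)` is also a square root of `B s` close to 1, and such a root is unique.
  have hRT : ∀ᶠ s in nhds (0 : ℝ), τ (R s) = R s := by
    have ht : Filter.Tendsto (fun s => τ (R s)) (nhds 0) (nhds (1 : 𝔸)) := by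
      have := (τ.continuous.tendsto (R 0)).comp hRd.continuousAt.tendsto
      rwa [hR0, hτ1] at this
    filter_upwards [hRR, ht.eventually hsq.eventually_left_inverse, hsymm] with s h1 h2 h3
    rw [← h2]
    simp only [hR]
    congr 1
    rw [← hτ, h1, h3]
  have hRu : ∀ᶠ s in nhds (0 : ℝ), IsUnit (R s) := by
    have ho : IsOpen {X : 𝔸 | IsUnit X} := Units.isOpen
    refine hRd.continuousAt.eventually_mem (ho.mem_nhds ?_)
    rw [hR0]; exact isUnit_one
  refine ⟨fun s => Ring.inverse (R s), by simp [hR0], ?_, ?_⟩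
  · have h1 : HasFDerivAt Ring.inverse
        (-ContinuousLinearMap.mulLeftRight ℝ 𝔸 ↑(1 : 𝔸ˣ)⁻¹ ↑(1 : 𝔸ˣ)⁻¹) (R 0) := by
      rw [hR0]; exact hasFDerivAt_ringInverse (𝕜 := ℝ) (1 : 𝔸ˣ)
    have h3 : HasDerivAt (fun s => Ring.inverse (R s)) _ 0 := h1.comp_hasDerivAt (0 : ℝ) hRd
    simpa using h3
  · filter_upwards [hRR, hRT, hRu] with s h1 h2 h3
    have h4 : τ (Ring.inverse (R s)) = Ring.inverse (R s) := by
      have h5 : R s * τ (Ring.inverse (R s)) = 1 := by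
        nth_rewrite 1 [← h2]
        rw [← hτ, Ring.inverse_mul_cancel _ h3, hτ1]
      calc _ = Ring.inverse (R s) * R s * τ (Ring.inverse (R s)) := by
            rw [Ring.inverse_mul_cancel _ h3, one_mul]
        _ = _ := by rw [mul_assoc, h5, mul_one]
    rw [h4, ← h1, ← mul_assoc, Ring.inverse_mul_cancel _ h3, one_mul, Ring.mul_inverse_cancel _ h3]

attribute [local instance] Matrix.linftyOpNormedRing Matrix.linftyOpNormedAlgebra

theorem hasDerivAt_matrix_of_entries {m : ℕ} {B : ℝ → Matrix (Fin m) (Fin m) ℝ}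
    {B' : Matrix (Fin m) (Fin m) ℝ} {t : ℝ}
    (h : ∀ i j, HasDerivAt (fun s => B s i j) (B' i j) t) : HasDerivAt B B' t := by
  have e : ∀ C : Matrix (Fin m) (Fin m) ℝ, C = ∑ i, ∑ j, C i j • Matrix.single i j (1 : ℝ) := by
    intro C
    conv_lhs => rw [Matrix.matrix_eq_sum_single C]
    simp
  rw [e B']
  have : B = fun s => ∑ i, ∑ j, B s i j • Matrix.single i j (1 : ℝ) := by
    funext s; exact e _
  rw [this]
  refine HasDerivAt.fun_sum fun i _ => HasDerivAt.fun_sum fun j _ => ?_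
  exact (h i j).smul_const _

theorem hasDerivAt_matrix_entry {m : ℕ} {B : ℝ → Matrix (Fin m) (Fin m) ℝ}
    {B' : Matrix (Fin m) (Fin m) ℝ} {t : ℝ} (h : HasDerivAt B B' t) (i j : Fin m) :
    HasDerivAt (fun s => B s i j) (B' i j) t := by
  have := ((LinearMap.toContinuousLinearMap
    (Matrix.entryLinearMap ℝ ℝ i j)).hasFDerivAt (x := B t)).comp_hasDerivAt t h
  exact this

/-- A symmetric matrix curve through the identity with vanishing velocity there can be
normalised by congruence with a matrix curve of vanishing velocity. -/
theorem exists_orthonormalizing_curve {m : ℕ} {B : ℝ → Matrix (Fin m) (Fin m) ℝ}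
    (hB0 : B 0 = 1) (hB : ∀ i j, HasDerivAt (fun s => B s i j) 0 0)
    (hsymm : ∀ᶠ s in nhds (0 : ℝ), ∀ i j, B s i j = B s j i) :
    ∃ S : ℝ → Matrix (Fin m) (Fin m) ℝ, S 0 = 1 ∧
      (∀ i j, HasDerivAt (fun s => S s i j) 0 0) ∧
      ∀ᶠ s in nhds (0 : ℝ), S s * B s * (S s).transpose = 1 := by
  have : CompleteSpace (Matrix (Fin m) (Fin m) ℝ) := FiniteDimensional.complete ℝ _
  obtain ⟨S, hS0, hS, hSB⟩ := exists_invSqrt_curve (LinearMap.toContinuousLinearMap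
    (Matrix.transposeLinearEquiv (Fin m) (Fin m) ℝ ℝ).toLinearMap)
    (fun a b => Matrix.transpose_mul a b) Matrix.transpose_one hB0
    (hasDerivAt_matrix_of_entries (B' := 0) hB) (hsymm.mono fun s hs => Matrix.ext fun i j => hs j i)
  exact ⟨S, hS0, fun i j => hasDerivAt_matrix_entry hS i j, hSB⟩

end Frames

/-! ### Covariant derivatives in coordinates and the conditions at a maximum. -/

section CovariantCalculus

variable {E : Type*} [NormedAddCommGroup E] [NormedSpace ℝ E]

/-- The covariant Hessian `D²u - Du ∘ Γ` in coordinates. -/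
def covHess (u : E → ℝ) (Γ : E → E →L[ℝ] E →L[ℝ] E) (y : E) : E →L[ℝ] E →L[ℝ] ℝ :=
  fderiv ℝ (fderiv ℝ u) y - (ContinuousLinearMap.compL ℝ E E ℝ (fderiv ℝ u y)).comp (Γ y)

theorem covHess_apply (u : E → ℝ) (Γ : E → E →L[ℝ] E →L[ℝ] E) (y a b : E) :
    covHess u Γ y a b = fderiv ℝ (fderiv ℝ u) y a b - fderiv ℝ u y (Γ y a b) := rfl

/-- The covariant derivative `(∇_c ∇²u)(a, b)` in coordinates. -/
def covHessDeriv (u : E → ℝ) (Γ : E → E →L[ℝ] E →L[ℝ] E) (y c a b : E) : ℝ :=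
  fderiv ℝ (covHess u Γ) y c a b - covHess u Γ y (Γ y c a) b - covHess u Γ y a (Γ y c b)

/-- The curvature expression `R(x, v) v` in coordinates. -/
def curvatureVec (Γ : E → E →L[ℝ] E →L[ℝ] E) (y v x : E) : E :=
  fderiv ℝ Γ y x v v - fderiv ℝ Γ y v v x + Γ y x (Γ y v v) - Γ y v (Γ y v x)

theorem covHess_symm {u : E → ℝ} {Γ : E → E →L[ℝ] E →L[ℝ] E} {y : E} (hu : ContDiffAt ℝ 2 u y)
    (hΓ : ∀ a b, Γ y a b = Γ y b a) (a b : E) : covHess u Γ y a b = covHess u Γ y b a := by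
  rw [covHess_apply, covHess_apply, hΓ a b, (hu.isSymmSndFDerivAt (by simp)).eq]

theorem hasFDerivAt_covHess {u : E → ℝ} {Γ : E → E →L[ℝ] E →L[ℝ] E} {y : E}
    (hu : ContDiffAt ℝ 3 u y) (hΓ : DifferentiableAt ℝ Γ y) :
    DifferentiableAt ℝ (covHess u Γ) y ∧ ∀ c a b, fderiv ℝ (covHess u Γ) y c a b =
      fderiv ℝ (fderiv ℝ (fderiv ℝ u)) y c a b - fderiv ℝ (fderiv ℝ u) y c (Γ y a b)
        - fderiv ℝ u y (fderiv ℝ Γ y c a b) := by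
  have h1 : ContDiffAt ℝ 2 (fderiv ℝ u) y := hu.fderiv_right (by norm_num)
  have h2 : ContDiffAt ℝ 1 (fderiv ℝ (fderiv ℝ u)) y := h1.fderiv_right (by norm_num)
  have d1 := (h1.differentiableAt (by norm_num)).hasFDerivAt
  have d2 := (h2.differentiableAt (by norm_num)).hasFDerivAt
  have d3 : HasFDerivAt (fun z => ContinuousLinearMap.compL ℝ E E ℝ (fderiv ℝ u z))
      ((ContinuousLinearMap.compL ℝ E E ℝ).comp (fderiv ℝ (fderiv ℝ u) y)) y :=
    HasFDerivAt.comp (g := fun q => ContinuousLinearMap.compL ℝ E E ℝ q) y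
      (ContinuousLinearMap.compL ℝ E E ℝ).hasFDerivAt d1
  have d4 := d3.clm_comp hΓ.hasFDerivAt
  have d5 : HasFDerivAt (covHess u Γ) _ y := d2.sub d4
  refine ⟨d5.differentiableAt, fun c a b => ?_⟩
  rw [d5.fderiv]
  change fderiv ℝ (fderiv ℝ (fderiv ℝ u)) y c a b - (fderiv ℝ u y (fderiv ℝ Γ y c a b)
    + fderiv ℝ (fderiv ℝ u) y c (Γ y a b)) = _
  ring

/-- Two exchanges: the last two arguments, since `D²u` is symmetric in a whole neighbourhood, and
then the first two, by symmetry of the second derivative of `Du`. -/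
theorem third_fderiv_symm {u : E → ℝ} {y : E} (hu : ContDiffAt ℝ 3 u y) (v x : E) :
    fderiv ℝ (fderiv ℝ (fderiv ℝ u)) y v v x = fderiv ℝ (fderiv ℝ (fderiv ℝ u)) y x v v := by
  have h1 : ContDiffAt ℝ 2 (fderiv ℝ u) y := hu.fderiv_right (by norm_num)
  have h2 : ContDiffAt ℝ 1 (fderiv ℝ (fderiv ℝ u)) y := h1.fderiv_right (by norm_num)
  have d2 := (h2.differentiableAt (by norm_num)).hasFDerivAt
  have hs : ∀ᶠ z in nhds y, ∀ a b, fderiv ℝ (fderiv ℝ u) z a b = fderiv ℝ (fderiv ℝ u) z b a := by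
    filter_upwards [hu.eventually (by simp)] with z hz a b
    exact ((hz.of_le (by norm_num : (2 : WithTop ℕ∞) ≤ 3)).isSymmSndFDerivAt (by simp)).eq a b
  have e1 : fderiv ℝ (fderiv ℝ (fderiv ℝ u)) y v v x = fderiv ℝ (fderiv ℝ (fderiv ℝ u)) y v x v := by
    have a1 := (d2.clm_apply (hasFDerivAt_const v y)).clm_apply (hasFDerivAt_const x y)
    have a2 := (d2.clm_apply (hasFDerivAt_const x y)).clm_apply (hasFDerivAt_const v y)
    have a3 := a2.congr_of_eventuallyEq (f₁ := fun z => fderiv ℝ (fderiv ℝ u) z v x)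
      (hs.mono fun z hz => hz v x)
    have := congrArg (fun L => L v) (a1.unique a3)
    simpa using this
  rw [e1, (h1.isSymmSndFDerivAt (by simp)).eq v x]

/-- The commutation formula for third covariant derivatives. -/
theorem covHessDeriv_comm {u : E → ℝ} {Γ : E → E →L[ℝ] E →L[ℝ] E} {y : E}
    (hu : ContDiffAt ℝ 3 u y) (hΓ : DifferentiableAt ℝ Γ y) (hs : ∀ a b, Γ y a b = Γ y b a)
    (v x : E) : covHessDeriv u Γ y v v x =
      covHessDeriv u Γ y x v v + fderiv ℝ u y (curvatureVec Γ y v x) := by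
  have hd := (hasFDerivAt_covHess hu hΓ).2
  have hH := covHess_symm (hu.of_le (by norm_num)) hs
  simp only [covHessDeriv, hd, curvatureVec, map_add, map_sub]
  rw [third_fderiv_symm hu v x, hs x v, hH (Γ y v x) v, hH (Γ y v v) x]
  simp only [covHess_apply]
  ring

/-- The basic identities for the gradient vector field `X`. -/
theorem gradient_identities {u : E → ℝ} {G : E → E →L[ℝ] E →L[ℝ] ℝ}
    {Γ : E → E →L[ℝ] E →L[ℝ] E} {X : E → E} {y : E} (hu : ContDiffAt ℝ 2 u y)
    (hG : DifferentiableAt ℝ G y) (hX : DifferentiableAt ℝ X y)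
    (hGs : ∀ v w, G y v w = G y w v)
    (hcompat : ∀ a v w, fderiv ℝ G y a v w = G y (Γ y a v) w + G y v (Γ y a w))
    (hgrad : ∀ᶠ z in nhds y, G z (X z) = fderiv ℝ u z) :
    (∀ a w, G y (fderiv ℝ X y a + Γ y a (X y)) w = covHess u Γ y a w) ∧
    ∃ W' : E →L[ℝ] ℝ, HasFDerivAt (fun z => fderiv ℝ u z (X z)) W' y ∧
      ∀ a, W' a = 2 * covHess u Γ y a (X y) := by
  have h1 : ContDiffAt ℝ 1 (fderiv ℝ u) y := hu.fderiv_right (by norm_num)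
  have d1 := (h1.differentiableAt (by norm_num)).hasFDerivAt
  -- Differentiate `G(X) = du` and expand the derivative of `G` by metric compatibility: the
  -- covariant derivative of `X` is dual to the Hessian.
  have key : ∀ a w, G y (fderiv ℝ X y a + Γ y a (X y)) w = covHess u Γ y a w := by
    intro a w
    have a1 := (hG.hasFDerivAt.clm_apply hX.hasFDerivAt).congr_of_eventuallyEq
      (hgrad.mono fun z hz => hz.symm)
    have := congrArg (fun L => L a w) (d1.unique a1)
    simp only [add_apply, ContinuousLinearMap.comp_apply,
      ContinuousLinearMap.flip_apply, hcompat] at this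
    rw [covHess_apply, this, ← hgrad.self_of_nhds]
    simp only [map_add, add_apply]
    ring
  refine ⟨key, _, d1.clm_apply hX.hasFDerivAt, fun a => ?_⟩
  have h2 := key a (X y)
  rw [map_add, add_apply, covHess_apply, hGs (Γ y a (X y)), hGs (fderiv ℝ X y a),
    hgrad.self_of_nhds] at h2
  simp only [add_apply, ContinuousLinearMap.comp_apply, ContinuousLinearMap.flip_apply,
    covHess_apply]
  linarith

/-- Second derivative test along a direction. -/
theorem IsLocalMax.second_fderiv_nonpos {Φ : E → ℝ} {Φ' : E → E →L[ℝ] ℝ} {y v : E}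
    (hmax : IsLocalMax Φ y) (hΦ : ∀ᶠ z in nhds y, HasFDerivAt Φ (Φ' z) z)
    {Ψ' : E →L[ℝ] ℝ} (hΨ : HasFDerivAt (fun z => Φ' z v) Ψ' y) : Ψ' v ≤ 0 := by
  have hline : ∀ s : ℝ, HasDerivAt (fun s : ℝ => y + s • v) v s := fun s => by
    simpa using ((hasDerivAt_id s).smul_const v).const_add y
  have hlim : Filter.Tendsto (fun s : ℝ => y + s • v) (nhds 0) (nhds y) := by
    have := (hline 0).continuousAt.tendsto
    simpa using this
  have hd : ∀ᶠ s in nhds (0 : ℝ), HasDerivAt (fun s : ℝ => Φ (y + s • v)) (Φ' (y + s • v) v) s := by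
    filter_upwards [hlim.eventually hΦ] with s hs
    exact hs.comp_hasDerivAt s (hline s)
  have hmax' : IsLocalMax (fun s : ℝ => Φ (y + s • v)) 0 := by
    have := hlim.eventually hmax
    filter_upwards [this] with s hs
    simpa using hs
  have hderiv : deriv (fun s : ℝ => Φ (y + s • v)) =ᶠ[nhds 0] fun s => Φ' (y + s • v) v :=
    hd.mono fun s hs => hs.deriv
  have hd2 : HasDerivAt (fun s : ℝ => Φ' (y + s • v) v) (Ψ' v) 0 := by
    have h0 : HasFDerivAt (fun z => Φ' z v) Ψ' (y + (0 : ℝ) • v) := by simpa using hΨ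
    exact h0.comp_hasDerivAt 0 (hline 0)
  have hd2' : deriv (deriv (fun s : ℝ => Φ (y + s • v))) 0 = Ψ' v := by
    rw [hderiv.deriv_eq]; exact hd2.deriv
  by_contra! hpos
  -- A positive second derivative would make the maximum also a local minimum; the function would be
  -- locally constant along the line and its second derivative zero.
  have hmin := isLocalMin_of_deriv_deriv_pos (by rw [hd2']; exact hpos) hmax'.deriv_eq_zero
    hd.self_of_nhds.continuousAt
  have hconst : (fun s : ℝ => Φ (y + s • v)) =ᶠ[nhds 0] fun _ => Φ (y + (0 : ℝ) • v) := by
    filter_upwards [hmin, hmax'] with s h1 h2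
    exact le_antisymm h2 h1
  have h3 : deriv (deriv (fun s : ℝ => Φ (y + s • v))) 0 = 0 := by
    rw [hconst.deriv.deriv_eq]; simp
  linarith

/-- The first and second order conditions at an interior maximum of
`log |∇u|² - (1/2) log (κ - u)`. -/
theorem maximum_conditions {u : E → ℝ} {G : E → E →L[ℝ] E →L[ℝ] ℝ}
    {Γ : E → E →L[ℝ] E →L[ℝ] E} {X : E → E} {y : E} {κ : ℝ} (hu : ContDiffAt ℝ 3 u y)
    (hG : ContDiffAt ℝ 1 G y) (hX : ContDiffAt ℝ 1 X y) (hΓ : DifferentiableAt ℝ Γ y)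
    (hGs : ∀ᶠ z in nhds y, ∀ v w, G z v w = G z w v) (hGpos : ∀ v, 0 ≤ G y v v)
    (hcompat : ∀ᶠ z in nhds y, ∀ a v w,
      fderiv ℝ G z a v w = G z (Γ z a v) w + G z v (Γ z a w))
    (hgrad : ∀ᶠ z in nhds y, G z (X z) = fderiv ℝ u z)
    (hW : 0 < fderiv ℝ u y (X y)) (hκ : u y < κ)
    (hmax : IsLocalMax (fun z => Real.log (fderiv ℝ u z (X z)) - 1 / 2 * Real.log (κ - u z)) y) :
    (∀ a, covHess u Γ y a (X y)
      = -(fderiv ℝ u y (X y) / (4 * (κ - u y))) * fderiv ℝ u y a) ∧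
    ∀ v, covHessDeriv u Γ y v v (X y) / fderiv ℝ u y (X y) + covHess u Γ y v v / (4 * (κ - u y))
      + (fderiv ℝ u y v) ^ 2 / (8 * (κ - u y) ^ 2) ≤ 0 := by
  have hu1 : ContDiffAt ℝ 2 (fderiv ℝ u) y := hu.fderiv_right (by norm_num)
  have du1 := (hu1.differentiableAt (by norm_num)).hasFDerivAt
  have dX := (hX.differentiableAt (by norm_num)).hasFDerivAt
  obtain ⟨hHd, hHd'⟩ := hasFDerivAt_covHess hu hΓ
  -- Metric compatibility removes the derivative of `X` from the first derivative, so one further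
  -- differentiation is possible although `X` is only assumed to be `C¹`.
  set Φ' : E → E →L[ℝ] ℝ := fun z =>
    (2 / fderiv ℝ u z (X z)) • (covHess u Γ z).flip (X z) + (1 / 2 / (κ - u z)) • fderiv ℝ u z
    with hΦ'
  have ev1 : ∀ᶠ z in nhds y, 0 < fderiv ℝ u z (X z) :=
    (du1.clm_apply dX).continuousAt.eventually (lt_mem_nhds hW)
  have ev2 : ∀ᶠ z in nhds y, 0 < κ - u z :=
    (continuousAt_const.sub hu.continuousAt).eventually (lt_mem_nhds (sub_pos.2 hκ))
  have hΦ : ∀ᶠ z in nhds y, HasFDerivAt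
      (fun z => Real.log (fderiv ℝ u z (X z)) - 1 / 2 * Real.log (κ - u z)) (Φ' z) z := by
    filter_upwards [ev1, ev2, hu.eventually (by simp), hG.eventually (by simp),
      hX.eventually (by simp), hcompat, hgrad.eventually_nhds, hGs] with z e1 e2 e3 e4 e5 e6 e7 e8
    obtain ⟨-, W', hW', hW''⟩ := gradient_identities (e3.of_le (by norm_num))
      (e4.differentiableAt (by norm_num)) (e5.differentiableAt (by norm_num)) e8 e6 e7
    have hl1 := hW'.log e1.ne'
    have hl2 := (((e3.differentiableAt (by norm_num)).hasFDerivAt.const_sub κ).log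
      e2.ne').const_mul (1 / 2)
    refine (hl1.sub hl2).congr_fderiv ?_
    ext a
    simp only [hΦ', sub_apply, add_apply, smul_apply, neg_apply, smul_eq_mul, hW'',
      ContinuousLinearMap.flip_apply]
    field_simp
    ring
  have hm : 0 < κ - u y := sub_pos.2 hκ
  have hfirst : ∀ a, covHess u Γ y a (X y)
      = -(fderiv ℝ u y (X y) / (4 * (κ - u y))) * fderiv ℝ u y a := by
    intro a
    have h0 := hmax.hasFDerivAt_eq_zero hΦ.self_of_nhds
    have := congrArg (fun L => L a) h0
    simp only [hΦ', add_apply, smul_apply, smul_eq_mul, ContinuousLinearMap.flip_apply,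
      zero_apply] at this
    field_simp at this ⊢
    linarith
  refine ⟨hfirst, fun v => ?_⟩
  set W := fderiv ℝ u y (X y) with hWdef
  set m := κ - u y with hmdef
  have dW : HasFDerivAt (fun z => fderiv ℝ u z (X z)) _ y := du1.clm_apply dX
  have dH : HasFDerivAt (fun z => covHess u Γ z v (X z)) _ y :=
    (hHd.hasFDerivAt.clm_apply (hasFDerivAt_const v y)).clm_apply dX
  obtain ⟨hgi, W', hW', hW''⟩ := gradient_identities (hu.of_le (by norm_num))
      (hG.differentiableAt (by norm_num)) (hX.differentiableAt (by norm_num))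
      hGs.self_of_nhds hcompat.self_of_nhds hgrad
  have dm : HasFDerivAt (fun z => κ - u z) _ y :=
    (hu.differentiableAt (by norm_num)).hasFDerivAt.const_sub κ
  have t1 := (((hasDerivAt_inv hW.ne').comp_hasFDerivAt y hW').const_mul 2).mul dH
  have t2 := (((hasDerivAt_inv hm.ne').comp_hasFDerivAt y dm).const_mul (1 / 2)).mul
    (du1.clm_apply (hasFDerivAt_const v y))
  have hΨ := t1.add t2
  have hΨ' : HasFDerivAt (fun z => Φ' z v) _ y := hΨ.congr_of_eventuallyEq (by
    refine Filter.Eventually.of_forall fun z => ?_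
    simp only [hΦ', add_apply, smul_apply, smul_eq_mul, ContinuousLinearMap.flip_apply,
      Pi.add_apply, Pi.mul_apply, Function.comp]
    ring)
  have hneg := IsLocalMax.second_fderiv_nonpos hmax hΦ hΨ'
  simp only [Function.comp, add_apply, smul_apply, smul_eq_mul, ContinuousLinearMap.comp_apply,
    ContinuousLinearMap.flip_apply, neg_apply, zero_apply, hW'', map_zero, zero_add, ← hWdef,
    ← hmdef, hfirst v] at hneg
  -- This is the square of `∇_v ∇u`, which enters the second derivative with a favourable sign and
  -- is dropped.
  have hpos := hGpos (fderiv ℝ X y v + Γ y v (X y))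
  rw [hgi, map_add] at hpos
  have hle : 0 ≤ (covHess u Γ y v (fderiv ℝ X y v) + covHess u Γ y v (Γ y v (X y))) / W :=
    div_nonneg hpos hW.le
  rw [covHessDeriv, hfirst (Γ y v v), covHess_apply u Γ y v v]
  -- By the first order condition the term from the square of the logarithmic derivative of `W` is
  -- `-u_v² / (4m²)`, against `u_v² / (2m²)` from the logarithm of `m`. Half of what remains is the
  -- coefficient `1 / (8m²)`; the exponent 1/2 makes this gain largest.
  have e1 : (fderiv ℝ (covHess u Γ) y v v (X y)
        - -(W / (4 * m)) * fderiv ℝ u y (Γ y v v) - covHess u Γ y v (Γ y v (X y))) / W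
      + (fderiv ℝ (fderiv ℝ u) y v v - fderiv ℝ u y (Γ y v v)) / (4 * m)
      + (fderiv ℝ u y v) ^ 2 / (8 * m ^ 2)
      = 1 / 2 * (2 * W⁻¹ * (covHess u Γ y v (fderiv ℝ X y v)
          + fderiv ℝ (covHess u Γ) y v v (X y))
        + -(W / (4 * m)) * fderiv ℝ u y v
          * (2 * (-(W ^ 2)⁻¹ * (2 * (-(W / (4 * m)) * fderiv ℝ u y v))))
        + (1 / 2 * m⁻¹ * fderiv ℝ (fderiv ℝ u) y v v
          + fderiv ℝ u y v * (1 / 2 * (-(m ^ 2)⁻¹ * -fderiv ℝ u y v))))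
        - (covHess u Γ y v (fderiv ℝ X y v) + covHess u Γ y v (Γ y v (X y))) / W := by
    field_simp
    ring
  rw [e1]
  linarith

end CovariantCalculus

/-! ### Differentiating the equation without differentiating eigenvalues. -/

section DifferentiatedEquation

variable {E : Type*} [NormedAddCommGroup E] [NormedSpace ℝ E]

theorem hasDerivAt_add_smul (y x : E) : HasDerivAt (fun s : ℝ => y + s • x) x 0 := by
  simpa using ((hasDerivAt_id (0 : ℝ)).smul_const x).const_add y

theorem DifferentiableAt.hasDerivAt_comp_line {F : Type*} [NormedAddCommGroup F]
    [NormedSpace ℝ F] {h : E → F} {y : E} (hh : DifferentiableAt ℝ h y) (x : E) :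
    HasDerivAt (fun s : ℝ => h (y + s • x)) (fderiv ℝ h y x) 0 := by
  have h0 : HasFDerivAt h (fderiv ℝ h y) (y + (0 : ℝ) • x) := by simpa using hh.hasFDerivAt
  exact HasFDerivAt.comp_hasDerivAt (l := h) (0 : ℝ) h0 (hasDerivAt_add_smul y x)

/-- An orthonormal frame extends along a line to an orthonormal frame which is parallel to first
order. -/
theorem exists_orthonormal_frame_curve {n : ℕ} {G : E → E →L[ℝ] E →L[ℝ] ℝ}
    {Γ : E →L[ℝ] E →L[ℝ] E} {y x : E} (hG : DifferentiableAt ℝ G y)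
    (hGs : ∀ᶠ z in nhds y, ∀ v w, G z v w = G z w v)
    (hcompat : ∀ a v w, fderiv ℝ G y a v w = G y (Γ a v) w + G y v (Γ a w))
    {e : Fin n → E} (he : ∀ i j, G y (e i) (e j) = if i = j then 1 else 0) :
    ∃ ε : ℝ → Fin n → E, ε 0 = e ∧ (∀ i, HasDerivAt (fun s => ε s i) (-Γ x (e i)) 0) ∧
      ∀ᶠ s in nhds (0 : ℝ), ∀ i j, G (y + s • x) (ε s i) (ε s j) = if i = j then 1 else 0 := by
  -- This frame is parallel to first order, so its Gram matrix has zero derivative at 0 by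
  -- compatibility. Normalising it therefore does not change its velocity.
  set b : ℝ → Fin n → E := fun s i => e i - s • Γ x (e i) with hb
  have hbd : ∀ i, HasDerivAt (fun s => b s i) (-Γ x (e i)) 0 := fun i => by
    simpa using ((hasDerivAt_id (0 : ℝ)).smul_const (Γ x (e i))).const_sub (e i)
  have hb0 : ∀ i, b 0 i = e i := fun i => by simp [hb]
  have hline := hasDerivAt_add_smul y x
  have hGd := DifferentiableAt.hasDerivAt_comp_line (F := E →L[ℝ] E →L[ℝ] ℝ) hG x
  set B : ℝ → Matrix (Fin n) (Fin n) ℝ :=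
    fun s => Matrix.of fun i j => G (y + s • x) (b s i) (b s j) with hB
  have hB0 : B 0 = 1 := by
    ext i j
    simp [hB, hb0, he, Matrix.one_apply]
  have hBd : ∀ i j, HasDerivAt (fun s => B s i j) 0 0 := by
    intro i j
    have h := (hGd.clm_apply (hbd i)).clm_apply (hbd j)
    refine h.congr_deriv ?_
    simp [hb0, hcompat]
  have hlim : Filter.Tendsto (fun s : ℝ => y + s • x) (nhds 0) (nhds y) := by
    simpa using hline.continuousAt.tendsto
  obtain ⟨S, hS0, hSd, hSB⟩ := exists_orthonormalizing_curve hB0 hBd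
    ((hlim.eventually hGs).mono fun s hs i j => hs _ _)
  refine ⟨fun s i => ∑ j, S s i j • b s j, ?_, ?_, ?_⟩
  · ext i
    simp [hS0, hb0, Matrix.one_apply]
  · intro i
    have h := HasDerivAt.fun_sum (u := Finset.univ) fun j _ => (hSd i j).fun_smul (hbd j)
    refine h.congr_deriv ?_
    simp [hS0, Matrix.one_apply]
  · filter_upwards [hSB] with s hs i j
    have h := congrFun (congrFun hs i) j
    rw [Matrix.one_apply] at h
    rw [← h]
    simp only [map_sum, map_smul, sum_apply, smul_apply, smul_eq_mul,
      Matrix.mul_apply, Matrix.transpose_apply, hB, Matrix.of_apply, Finset.sum_mul, Finset.mul_sum]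
    refine Finset.sum_congr rfl fun k _ => Finset.sum_congr rfl fun k' _ => ?_
    ring

/-- The equation `f (λ (∇²u + A)) = ψ` differentiated once, in a frame of eigenvectors. -/
theorem differentiated_equation {n : ℕ} {cone : Set (Fin n → ℝ)} {f : (Fin n → ℝ) → ℝ}
    (hc : IsSymmetricCone cone) (hf : IsStructureFunction cone f) [FiniteDimensional ℝ E]
    (hE : Module.finrank ℝ E = n) {u : E → ℝ} {G : E → E →L[ℝ] E →L[ℝ] ℝ}
    {Γ : E → E →L[ℝ] E →L[ℝ] E} {y x : E} (hu : ContDiffAt ℝ 3 u y)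
    (hG : DifferentiableAt ℝ G y) (hΓ : DifferentiableAt ℝ Γ y)
    (hGs : ∀ᶠ z in nhds y, ∀ v w, G z v w = G z w v)
    (hcompat : ∀ a v w, fderiv ℝ G y a v w = G y (Γ y a v) w + G y v (Γ y a w))
    {B : E → LinearMap.BilinForm ℝ E} {T : E × ℝ × (E →L[ℝ] ℝ) × E → ℝ}
    {P : E × ℝ × (E →L[ℝ] ℝ) → ℝ}
    (hBT : ∀ᶠ z in nhds y, ∀ v, B z v v = T (z, u z, fderiv ℝ u z, v))
    (hT : ∀ v, DifferentiableAt ℝ T (y, u y, fderiv ℝ u y, v))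
    (hP : DifferentiableAt ℝ P (y, u y, fderiv ℝ u y))
    (heq : ∀ᶠ z in nhds y, ∃ e : Fin n → E, ∃ l : Fin n → ℝ,
      (∀ i j, G z (e i) (e j) = if i = j then 1 else 0) ∧
      (∀ i j, covHess u Γ z (e i) (e j) + B z (e i) (e j) = if i = j then l i else 0) ∧
      l ∈ cone ∧ f l = P (z, u z, fderiv ℝ u z))
    {e : Fin n → E} {l : Fin n → ℝ} (he : ∀ i j, G y (e i) (e j) = if i = j then 1 else 0)
    (hel : ∀ i, covHess u Γ y (e i) (e i) + B y (e i) (e i) = l i)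
    (hl : l ∈ cone) (hfl : f l = P (y, u y, fderiv ℝ u y)) :
    ∑ i, partialF f i l * (covHessDeriv u Γ y x (e i) (e i) +
        fderiv ℝ T (y, u y, fderiv ℝ u y, e i)
          (x, fderiv ℝ u y x, fderiv ℝ (fderiv ℝ u) y x, -Γ y x (e i)))
      = fderiv ℝ P (y, u y, fderiv ℝ u y) (x, fderiv ℝ u y x, fderiv ℝ (fderiv ℝ u) y x) := by
  obtain ⟨ε, hε0, hεd, hε⟩ := exists_orthonormal_frame_curve (x := x) hG hGs hcompat he
  have hε0' : ∀ i, ε 0 i = e i := fun i => congrFun hε0 i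
  have hline := hasDerivAt_add_smul y x
  have hlim : Filter.Tendsto (fun s : ℝ => y + s • x) (nhds 0) (nhds y) := by
    simpa using hline.continuousAt.tendsto
  have hu1 : ContDiffAt ℝ 2 (fderiv ℝ u) y := hu.fderiv_right (by norm_num)
  have du := DifferentiableAt.hasDerivAt_comp_line (hu.differentiableAt (by norm_num)) x
  have ddu := DifferentiableAt.hasDerivAt_comp_line (hu1.differentiableAt (by norm_num)) x
  have dH := DifferentiableAt.hasDerivAt_comp_line (F := E →L[ℝ] E →L[ℝ] ℝ) (hasFDerivAt_covHess hu hΓ).1 x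
  have dT : ∀ i, HasDerivAt
      (fun s : ℝ => T (y + s • x, u (y + s • x), fderiv ℝ u (y + s • x), ε s i))
      (fderiv ℝ T (y, u y, fderiv ℝ u y, e i)
          (x, fderiv ℝ u y x, fderiv ℝ (fderiv ℝ u) y x, -Γ y x (e i))) 0 := by
    intro i
    have hc := hline.prodMk (du.prodMk (ddu.prodMk (hεd i)))
    have h0 : HasFDerivAt T (fderiv ℝ T (y, u y, fderiv ℝ u y, e i))
        (y + (0 : ℝ) • x, u (y + (0 : ℝ) • x), fderiv ℝ u (y + (0 : ℝ) • x), ε 0 i) := by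
      simpa [hε0'] using (hT (e i)).hasFDerivAt
    exact h0.comp_hasDerivAt (0 : ℝ) hc
  have dP : HasDerivAt (fun s : ℝ => P (y + s • x, u (y + s • x), fderiv ℝ u (y + s • x)))
      (fderiv ℝ P (y, u y, fderiv ℝ u y) (x, fderiv ℝ u y x, fderiv ℝ (fderiv ℝ u) y x)) 0 := by
    have hc := hline.prodMk (du.prodMk ddu)
    have h0 : HasFDerivAt P (fderiv ℝ P (y, u y, fderiv ℝ u y))
        (y + (0 : ℝ) • x, u (y + (0 : ℝ) • x), fderiv ℝ u (y + (0 : ℝ) • x)) := by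
      simpa using hP.hasFDerivAt
    exact h0.comp_hasDerivAt (0 : ℝ) hc
  set d : ℝ → Fin n → ℝ := fun s i => covHess u Γ (y + s • x) (ε s i) (ε s i)
    + T (y + s • x, u (y + s • x), fderiv ℝ u (y + s • x), ε s i) with hd
  have dd : HasDerivAt d (fun i => covHessDeriv u Γ y x (e i) (e i) +
        fderiv ℝ T (y, u y, fderiv ℝ u y, e i)
          (x, fderiv ℝ u y x, fderiv ℝ (fderiv ℝ u) y x, -Γ y x (e i))) 0 := by
    rw [hasDerivAt_pi]
    intro i
    have h1 := (dH.clm_apply (hεd i)).clm_apply (hεd i)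
    refine (h1.add (dT i)).congr_deriv ?_
    simp only [hε0', zero_smul, add_zero, covHessDeriv, add_apply, map_neg, neg_apply]
    ring
  have hd0 : d 0 = l := by
    ext i
    simp [hd, hε0', ← hel, hBT.self_of_nhds]
  -- `d s` is the diagonal of `∇²u + A` in the moving frame, a doubly stochastic image of the
  -- eigenvalues. Hence `f (d s) ≥ P` near 0, with equality at 0 where the diagonal is `l` itself.
  have hmin : IsLocalMin (fun s => f (d s)
      - P (y + s • x, u (y + s • x), fderiv ℝ u (y + s • x))) 0 := by
    have h0 : f (d 0) - P (y + (0 : ℝ) • x, u (y + (0 : ℝ) • x), fderiv ℝ u (y + (0 : ℝ) • x))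
        = 0 := by
      rw [hd0, hfl]; simp
    filter_upwards [hε, hlim.eventually heq, hlim.eventually hBT, hlim.eventually hGs]
      with s h1 h2 h3 h4
    rw [h0]
    obtain ⟨e', l', he', hel', hl', hfl'⟩ := h2
    obtain ⟨Q, hQ, hQd⟩ := exists_doublyStochastic_diagonal hE
      (ContinuousLinearMap.toBilinForm (G (y + s • x)))
      (ContinuousLinearMap.toBilinForm (covHess u Γ (y + s • x)) + B (y + s • x))
      h4 h1 he' hel'
    have hds : d s = Q.mulVec l' := by
      ext i
      rw [← hQd i, hd]
      simp only [LinearMap.add_apply, h3]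
      rfl
    have := (hf.le_doublyStochastic hc hl' hQ).2
    rw [hds, ← hfl']
    linarith
  have h0 : HasFDerivAt f (fderiv ℝ f l) (d 0) := by
    rw [hd0]; exact (hf.differentiableAt hc hl).hasFDerivAt
  have dfd := HasFDerivAt.comp_hasDerivAt (l := f) (0 : ℝ) h0 dd
  have hz := hmin.hasDerivAt_eq_zero (dfd.sub dP)
  rw [fderiv_eq_sum_partialF] at hz
  linarith

end DifferentiatedEquation

/-! ### Transformation laws under a change of coordinates. -/

section CoordinateChange

variable {E : Type*} [NormedAddCommGroup E] [NormedSpace ℝ E]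

/-- `Γ` satisfies the Koszul formula of the Levi-Civita connection of `G` at `y`. -/
def IsChristoffelAt (G : E → E →L[ℝ] E →L[ℝ] ℝ) (Γ : E → E →L[ℝ] E →L[ℝ] E) (y : E) : Prop :=
  ∀ v w z, 2 * G y (Γ y v w) z = fderiv ℝ G y v w z + fderiv ℝ G y w v z - fderiv ℝ G y z v w

theorem fderiv_symm_of_symm {G : E → E →L[ℝ] E →L[ℝ] ℝ} {y : E} (hG : DifferentiableAt ℝ G y)
    (hGs : ∀ᶠ z in nhds y, ∀ v w, G z v w = G z w v) (a v w : E) :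
    fderiv ℝ G y a v w = fderiv ℝ G y a w v := by
  have h1 := (hG.hasFDerivAt.clm_apply (hasFDerivAt_const v y)).clm_apply (hasFDerivAt_const w y)
  have h2 := (hG.hasFDerivAt.clm_apply (hasFDerivAt_const w y)).clm_apply (hasFDerivAt_const v y)
  have h3 := h1.congr_of_eventuallyEq (f₁ := fun z => G z w v) (hGs.mono fun z hz => hz w v)
  have := congrArg (fun L => L a) (h3.unique h2)
  simpa using this

/-- Metric compatibility from the Koszul formula. -/
theorem IsChristoffelAt.compat {G : E → E →L[ℝ] E →L[ℝ] ℝ} {Γ : E → E →L[ℝ] E →L[ℝ] E} {y : E}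
    (h : IsChristoffelAt G Γ y) (hG : DifferentiableAt ℝ G y)
    (hGs : ∀ᶠ z in nhds y, ∀ v w, G z v w = G z w v) (a v w : E) :
    fderiv ℝ G y a v w = G y (Γ y a v) w + G y v (Γ y a w) := by
  have h1 := h a v w
  have h2 := h a w v
  have h3 := fderiv_symm_of_symm hG hGs
  rw [hGs.self_of_nhds v]
  rw [h3 w a v] at h1
  rw [h3 w a v, h3 a w v, h3 v a w] at h2
  rw [h3 v a w] at h1
  linarith

/-- The transformation law of the Christoffel symbols. -/
theorem christoffel_transform {G G' : E → E →L[ℝ] E →L[ℝ] ℝ} {Γ Γ' : E → E →L[ℝ] E →L[ℝ] E}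
    {φ : E → E} {y : E} (hφ : ContDiffAt ℝ 2 φ y) (hG' : DifferentiableAt ℝ G' (φ y))
    (hGs' : ∀ v w, G' (φ y) v w = G' (φ y) w v) (hpos : ∀ v, G' (φ y) v v = 0 → v = 0)
    (hsurj : Function.Surjective (fderiv ℝ φ y))
    (hpull : ∀ᶠ z in nhds y, ∀ v w, G z v w = G' (φ z) (fderiv ℝ φ z v) (fderiv ℝ φ z w))
    (hG : DifferentiableAt ℝ G y)
    (hΓ : IsChristoffelAt G Γ y) (hΓ' : IsChristoffelAt G' Γ' (φ y)) (v w : E) :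
    fderiv ℝ (fderiv ℝ φ) y v w
      = fderiv ℝ φ y (Γ y v w) - Γ' (φ y) (fderiv ℝ φ y v) (fderiv ℝ φ y w) := by
  have hφ1 : ContDiffAt ℝ 1 (fderiv ℝ φ) y := hφ.fderiv_right (by norm_num)
  have dφ := (hφ.differentiableAt (by norm_num)).hasFDerivAt
  have d2φ := (hφ1.differentiableAt (by norm_num)).hasFDerivAt
  have hs2 : ∀ a b, fderiv ℝ (fderiv ℝ φ) y a b = fderiv ℝ (fderiv ℝ φ) y b a :=
    (hφ.isSymmSndFDerivAt (by simp)).eq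
  have dG' : HasFDerivAt (fun z => G' (φ z)) ((fderiv ℝ G' (φ y)).comp (fderiv ℝ φ y)) y :=
    HasFDerivAt.comp (g := G') y hG'.hasFDerivAt dφ
  have hDG : ∀ a v w, fderiv ℝ G y a v w
      = fderiv ℝ G' (φ y) (fderiv ℝ φ y a) (fderiv ℝ φ y v) (fderiv ℝ φ y w)
        + G' (φ y) (fderiv ℝ (fderiv ℝ φ) y a v) (fderiv ℝ φ y w)
        + G' (φ y) (fderiv ℝ φ y v) (fderiv ℝ (fderiv ℝ φ) y a w) := by
    intro a v w
    have h1 := (dG'.clm_apply (d2φ.clm_apply (hasFDerivAt_const v y))).clm_apply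
      (d2φ.clm_apply (hasFDerivAt_const w y))
    have h2 := (hG.hasFDerivAt.clm_apply (hasFDerivAt_const v y)).clm_apply
      (hasFDerivAt_const w y)
    have h3 := h1.congr_of_eventuallyEq (f₁ := fun z => G z v w) (hpull.mono fun z hz => hz v w)
    have := congrArg (fun L => L a) (h2.unique h3)
    simp only [add_apply, ContinuousLinearMap.comp_apply,
      ContinuousLinearMap.flip_apply, zero_apply, map_zero, zero_add] at this
    rw [this]
    ring
  -- In the Koszul combination for the pulled back metric all second derivatives of `φ` cancel
  -- except those of type `D²φ(v, w)`. Surjectivity of `Dφ` and definiteness of `G'` then give the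
  -- law itself.
  have key : ∀ z, G' (φ y) (fderiv ℝ φ y (Γ y v w) - Γ' (φ y) (fderiv ℝ φ y v) (fderiv ℝ φ y w)
      - fderiv ℝ (fderiv ℝ φ) y v w) (fderiv ℝ φ y z) = 0 := by
    intro z
    have h1 := hΓ v w z
    have h2 := hΓ' (fderiv ℝ φ y v) (fderiv ℝ φ y w) (fderiv ℝ φ y z)
    rw [hDG, hDG, hDG, hpull.self_of_nhds, hs2 w v, hs2 z v, hs2 z w,
      hGs' (fderiv ℝ (fderiv ℝ φ) y v z) (fderiv ℝ φ y w)] at h1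
    simp only [map_sub, sub_apply]
    linarith
  obtain ⟨z, hz⟩ := hsurj (fderiv ℝ φ y (Γ y v w)
    - Γ' (φ y) (fderiv ℝ φ y v) (fderiv ℝ φ y w) - fderiv ℝ (fderiv ℝ φ) y v w)
  have h0 := key z
  rw [hz] at h0
  have := hpos _ h0
  rw [sub_eq_zero] at this
  exact this.symm

/-- The covariant Hessian is a tensor. -/
theorem covHess_transform {Γ Γ' : E → E →L[ℝ] E →L[ℝ] E} {φ : E → E} {u u' : E → ℝ} {y : E}
    (hφ : ContDiffAt ℝ 2 φ y) (hu' : ContDiffAt ℝ 2 u' (φ y))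
    (huu : ∀ᶠ z in nhds y, u z = u' (φ z))
    (hΓ : ∀ v w, fderiv ℝ (fderiv ℝ φ) y v w
      = fderiv ℝ φ y (Γ y v w) - Γ' (φ y) (fderiv ℝ φ y v) (fderiv ℝ φ y w)) (a b : E) :
    covHess u Γ y a b = covHess u' Γ' (φ y) (fderiv ℝ φ y a) (fderiv ℝ φ y b) := by
  have hφ1 : ContDiffAt ℝ 1 (fderiv ℝ φ) y := hφ.fderiv_right (by norm_num)
  have dφ := (hφ.differentiableAt (by norm_num)).hasFDerivAt
  have d2φ := (hφ1.differentiableAt (by norm_num)).hasFDerivAt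
  have hu1 : ContDiffAt ℝ 1 (fderiv ℝ u') (φ y) := hu'.fderiv_right (by norm_num)
  have hd1 : ∀ᶠ z in nhds y, fderiv ℝ u z = (fderiv ℝ u' (φ z)).comp (fderiv ℝ φ z) := by
    filter_upwards [huu.eventually_nhds, hφ.eventually (by simp),
      hφ.continuousAt.eventually (hu'.eventually (by simp))] with z h1 h2 h3
    have e : u =ᶠ[nhds z] u' ∘ φ := h1
    rw [e.fderiv_eq]
    exact fderiv_comp z (h3.differentiableAt (by norm_num)) (h2.differentiableAt (by norm_num))
  have dc : HasFDerivAt (fun z => fderiv ℝ u' (φ z))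
      ((fderiv ℝ (fderiv ℝ u') (φ y)).comp (fderiv ℝ φ y)) y :=
    HasFDerivAt.comp (g := fderiv ℝ u') y (hu1.differentiableAt (by norm_num)).hasFDerivAt dφ
  have h2 := (dc.clm_comp d2φ).congr_of_eventuallyEq hd1
  rw [covHess_apply, covHess_apply, h2.fderiv, hd1.self_of_nhds]
  simp only [add_apply, ContinuousLinearMap.comp_apply, ContinuousLinearMap.flip_apply,
    ContinuousLinearMap.compL_apply, hΓ, map_sub]
  ring

/-- The covariant derivative in the base point of a function of a point, a number, a covector and
a vector does not depend on the coordinates. -/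
theorem horizontal_fderiv_transform {Γ : E →L[ℝ] E →L[ℝ] E} {Γ' : E →L[ℝ] E →L[ℝ] E} {φ : E → E}
    {T T' : E × ℝ × (E →L[ℝ] ℝ) × E → ℝ} {y : E} (hφ : ContDiffAt ℝ 2 φ y)
    (hΓ : ∀ v w, fderiv ℝ (fderiv ℝ φ) y v w
      = fderiv ℝ φ y (Γ v w) - Γ' (fderiv ℝ φ y v) (fderiv ℝ φ y w))
    (hTT : ∀ᶠ z in nhds y, ∀ t q v,
      T (z, t, q.comp (fderiv ℝ φ z), v) = T' (φ z, t, q, fderiv ℝ φ z v))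
    {t : ℝ} {q : E →L[ℝ] ℝ} {v : E}
    (hT : DifferentiableAt ℝ T (y, t, q.comp (fderiv ℝ φ y), v))
    (hT' : DifferentiableAt ℝ T' (φ y, t, q, fderiv ℝ φ y v)) (x : E) :
    fderiv ℝ T (y, t, q.comp (fderiv ℝ φ y), v)
        (x, 0, (q.comp (fderiv ℝ φ y)).comp (Γ x), -Γ x v)
      = fderiv ℝ T' (φ y, t, q, fderiv ℝ φ y v)
        (fderiv ℝ φ y x, 0, q.comp (Γ' (fderiv ℝ φ y x)),
          -Γ' (fderiv ℝ φ y x) (fderiv ℝ φ y v)) := by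
  have hφ1 : ContDiffAt ℝ 1 (fderiv ℝ φ) y := hφ.fderiv_right (by norm_num)
  have hline := hasDerivAt_add_smul y x
  have hlim : Filter.Tendsto (fun s : ℝ => y + s • x) (nhds 0) (nhds y) := by
    simpa using hline.continuousAt.tendsto
  have dφ := DifferentiableAt.hasDerivAt_comp_line (hφ.differentiableAt (by norm_num)) x
  have d2φ := DifferentiableAt.hasDerivAt_comp_line (F := E →L[ℝ] E)
    (hφ1.differentiableAt (by norm_num)) x
  -- The covector is moved horizontally in the target coordinates and the vector horizontally in the
  -- source. The transformation law makes each of the transported curves horizontal in the other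
  -- coordinates, and the two chain rules must agree.
  have dq := hasDerivAt_add_smul q (q.comp (Γ' (fderiv ℝ φ y x)))
  have dv := hasDerivAt_add_smul v (-Γ x v)
  have dqφ := dq.clm_comp d2φ
  have dφv := d2φ.clm_apply dv
  have c1 := hline.prodMk ((hasDerivAt_const (0 : ℝ) t).prodMk (dqφ.prodMk dv))
  have c2 := dφ.prodMk ((hasDerivAt_const (0 : ℝ) t).prodMk (dq.prodMk dφv))
  have hT0 := hT.hasFDerivAt
  have hT0' := hT'.hasFDerivAt
  have a1 := HasFDerivAt.comp_hasDerivAt (l := T) (0 : ℝ) (by simpa using hT0) c1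
  have a2 := HasFDerivAt.comp_hasDerivAt (l := T') (0 : ℝ) (by simpa using hT0') c2
  have a3 := a2.congr_of_eventuallyEq (f₁ := fun s : ℝ => T (y + s • x, t,
    (q + s • q.comp (Γ' (fderiv ℝ φ y x))).comp (fderiv ℝ φ (y + s • x)), v + s • (-Γ x v))) (by
      filter_upwards [hlim.eventually hTT] with s hs
      exact hs _ _ _)
  have a4 := a1.unique a3
  convert a4 using 3
  · congr 3
    ext w
    simp [hΓ]
  · congr 3
    simp [hΓ]
    abel

end CoordinateChange

/-! ### Differentials of charts and of functions read in a chart. -/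

section Charts

variable {n : ℕ}

/-- The covector of `ℝⁿ` with given components. -/
def flatCovec (q : Fin n → ℝ) : EuclideanSpace ℝ (Fin n) →L[ℝ] ℝ :=
  ∑ i, q i • (EuclideanSpace.proj i : EuclideanSpace ℝ (Fin n) →L[ℝ] ℝ)

theorem flatCovec_apply (q : Fin n → ℝ) (v : EuclideanSpace ℝ (Fin n)) :
    flatCovec q v = ∑ i, q i * v i := by
  simp [flatCovec]

theorem euclidean_eq_sum (v : EuclideanSpace ℝ (Fin n)) :
    v = ∑ i, v i • (EuclideanSpace.single i 1 : EuclideanSpace ℝ (Fin n)) := by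
  ext j
  simp [Pi.single_apply]

theorem eq_flatCovec (q : EuclideanSpace ℝ (Fin n) →L[ℝ] ℝ) :
    q = flatCovec fun i => q (EuclideanSpace.single i 1) := by
  ext v
  conv_lhs => rw [euclidean_eq_sum v]
  simp [flatCovec_apply, mul_comm]

variable [NeZero n] {M : Type*} [TopologicalSpace M] [ChartedSpace (EuclideanHalfSpace n) M]

/-- The differential of the chart at `c`. -/
def chartD (c x : M) : TangentSpace (𝓡∂ n) x →L[ℝ] EuclideanSpace ℝ (Fin n) :=
  mfderiv (𝓡∂ n) 𝓘(ℝ, EuclideanSpace ℝ (Fin n)) (extChartAt (𝓡∂ n) c) x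

/-- The inverse of the differential of the chart at `c`. -/
def chartDInv (c x : M) : EuclideanSpace ℝ (Fin n) →L[ℝ] TangentSpace (𝓡∂ n) x :=
  (chartD c x).inverse

theorem coordForm_apply (c x : M) (i : Fin n) (ξ : TangentSpace (𝓡∂ n) x) :
    coordForm c x i ξ = chartD c x ξ i := rfl

theorem coordVec_eq (c x : M) (i : Fin n) :
    coordVec c x i = chartDInv c x (EuclideanSpace.single i 1) := rfl

theorem covec_eq (c x : M) (q : Fin n → ℝ) : covec c x q = (flatCovec q).comp (chartD c x) := by
  ext ξ
  simp only [covec, flatCovec, ContinuousLinearMap.comp_apply, sum_apply, smul_apply,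
    coordForm_apply]
  rfl

variable [IsManifold (𝓡∂ n) ∞ M]

theorem chartD_isInvertible {c x : M} (hx : x ∈ (extChartAt (𝓡∂ n) c).source) :
    (chartD c x : TangentSpace (𝓡∂ n) x →L[ℝ] EuclideanSpace ℝ (Fin n)).IsInvertible := by
  have : IsManifold (𝓡∂ n) 1 M := .of_le (n := ∞) (by simp)
  exact isInvertible_mfderiv_extChartAt (I := 𝓡∂ n) hx

theorem chartD_chartDInv {c x : M} (hx : x ∈ (extChartAt (𝓡∂ n) c).source)
    (v : EuclideanSpace ℝ (Fin n)) : chartD c x (chartDInv c x v) = v := by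
  obtain ⟨e, he⟩ := chartD_isInvertible (n := n) hx
  rw [chartDInv, ← he, ContinuousLinearMap.inverse_equiv]
  exact e.apply_symm_apply v

theorem chartDInv_chartD {c x : M} (hx : x ∈ (extChartAt (𝓡∂ n) c).source)
    (ξ : TangentSpace (𝓡∂ n) x) : chartDInv c x (chartD c x ξ) = ξ := by
  obtain ⟨e, he⟩ := chartD_isInvertible (n := n) hx
  rw [chartDInv, ← he, ContinuousLinearMap.inverse_equiv]
  exact e.symm_apply_apply ξ

/-- The differential of a function in a chart. -/
theorem mfderiv_eq_fderivWithin_comp {F : Type*} [NormedAddCommGroup F] [NormedSpace ℝ F]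
    {h : M → F} {c x : M} (hx : x ∈ (extChartAt (𝓡∂ n) c).source)
    (hd : MDifferentiableAt (𝓡∂ n) 𝓘(ℝ, F) h x) (ξ : TangentSpace (𝓡∂ n) x) :
    (mfderiv (𝓡∂ n) 𝓘(ℝ, F) h x ξ : F) =
      fderivWithin ℝ (fun y => h ((extChartAt (𝓡∂ n) c).symm y)) (Set.range (𝓡∂ n))
        (extChartAt (𝓡∂ n) c x) (chartD c x ξ) := by
  have : IsManifold (𝓡∂ n) 1 M := .of_le (n := ∞) (by simp)
  have hy := (extChartAt (𝓡∂ n) c).map_source hx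
  have hs := mdifferentiableWithinAt_extChartAt_symm (I := 𝓡∂ n) hy
  have e0 := (extChartAt (𝓡∂ n) c).left_inv hx
  have hU : UniqueMDiffWithinAt 𝓘(ℝ, EuclideanSpace ℝ (Fin n)) (Set.range (𝓡∂ n))
      (extChartAt (𝓡∂ n) c x) := (𝓡∂ n).uniqueMDiffOn _ (extChartAt_target_subset_range c hy)
  have h1 := mfderiv_comp_mfderivWithin_of_eq (g := h) (x := extChartAt (𝓡∂ n) c x) hd hs hU e0
  rw [← mfderivWithin_eq_fderivWithin]
  have h2 := mfderivWithin_extChartAt_symm_comp_mfderiv_extChartAt' (I := 𝓡∂ n) hx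
  have h3 : (mfderivWithin 𝓘(ℝ, EuclideanSpace ℝ (Fin n)) (𝓡∂ n) (extChartAt (𝓡∂ n) c).symm
      (Set.range (𝓡∂ n)) (extChartAt (𝓡∂ n) c x)) (chartD c x ξ) = ξ :=
    congrArg (fun L => L ξ) h2
  have h4 : mfderivWithin 𝓘(ℝ, EuclideanSpace ℝ (Fin n)) 𝓘(ℝ, F)
      (fun y => h ((extChartAt (𝓡∂ n) c).symm y)) (Set.range (𝓡∂ n)) (extChartAt (𝓡∂ n) c x)
      (chartD c x ξ) = mfderiv (𝓡∂ n) 𝓘(ℝ, F) h x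
        ((mfderivWithin 𝓘(ℝ, EuclideanSpace ℝ (Fin n)) (𝓡∂ n) (extChartAt (𝓡∂ n) c).symm
      (Set.range (𝓡∂ n)) (extChartAt (𝓡∂ n) c x)) (chartD c x ξ)) :=
    congrArg (fun L => L (chartD c x ξ)) h1
  exact (h4.trans (congrArg (fun η => mfderiv (𝓡∂ n) 𝓘(ℝ, F) h x η) h3)).symm

end Charts

/-! ### Smoothness of the metric and of the Christoffel symbols in a chart, and the Koszul formula.
-/

section MetricInCharts

variable {n : ℕ} [NeZero n] {M : Type*} [TopologicalSpace M] [ChartedSpace (EuclideanHalfSpace n) M]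
  [IsManifold (𝓡∂ n) ∞ M]
  (g : Bundle.ContMDiffRiemannianMetric (𝓡∂ n) ∞ (EuclideanSpace ℝ (Fin n))
    (fun x : M => TangentSpace (𝓡∂ n) x))

/-- The metric in the chart at `c`. -/
def metricCoord (c : M) (y : EuclideanSpace ℝ (Fin n)) :
    EuclideanSpace ℝ (Fin n) →L[ℝ] EuclideanSpace ℝ (Fin n) →L[ℝ] ℝ :=
  ∑ i, ∑ j, gram g c ((extChartAt (𝓡∂ n) c).symm y) i j •
    (EuclideanSpace.proj i : EuclideanSpace ℝ (Fin n) →L[ℝ] ℝ).smulRight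
      (EuclideanSpace.proj j : EuclideanSpace ℝ (Fin n) →L[ℝ] ℝ)

/-- The Christoffel symbols in the chart at `c`, as a bilinear map. -/
def christoffelCoord (c : M) (y : EuclideanSpace ℝ (Fin n)) :
    EuclideanSpace ℝ (Fin n) →L[ℝ] EuclideanSpace ℝ (Fin n) →L[ℝ] EuclideanSpace ℝ (Fin n) :=
  ∑ k, ∑ i, ∑ j, christoffel g c ((extChartAt (𝓡∂ n) c).symm y) k i j •
    (EuclideanSpace.proj i : EuclideanSpace ℝ (Fin n) →L[ℝ] ℝ).smulRight
      ((EuclideanSpace.proj j : EuclideanSpace ℝ (Fin n) →L[ℝ] ℝ).smulRight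
        (EuclideanSpace.single k (1 : ℝ) : EuclideanSpace ℝ (Fin n)))

theorem metricCoord_apply (c : M) (y v w : EuclideanSpace ℝ (Fin n)) :
    metricCoord g c y v w
      = ∑ i, ∑ j, gram g c ((extChartAt (𝓡∂ n) c).symm y) i j * (v i * w j) := by
  simp [metricCoord, sum_apply]

theorem christoffelCoord_apply (c : M) (y v w : EuclideanSpace ℝ (Fin n)) (k : Fin n) :
    christoffelCoord g c y v w k
      = ∑ i, ∑ j, christoffel g c ((extChartAt (𝓡∂ n) c).symm y) k i j * (v i * w j) := by
  simp only [christoffelCoord, sum_apply, smul_apply, ContinuousLinearMap.smulRight_apply]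
  simp [Finset.sum_apply, Pi.single_apply]

theorem metricCoord_eq_inner {c x : M} (hx : x ∈ (extChartAt (𝓡∂ n) c).source)
    (v w : EuclideanSpace ℝ (Fin n)) :
    metricCoord g c (extChartAt (𝓡∂ n) c x) v w = g.inner x (chartDInv c x v) (chartDInv c x w) := by
  rw [metricCoord_apply, (extChartAt (𝓡∂ n) c).left_inv hx]
  conv_rhs => rw [euclidean_eq_sum v, euclidean_eq_sum w]
  simp only [map_sum, map_smul, sum_apply, smul_apply, smul_eq_mul, gram, Matrix.of_apply,
    coordVec_eq, Finset.mul_sum]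
  rw [Finset.sum_comm]
  refine Finset.sum_congr rfl fun i _ => Finset.sum_congr rfl fun j _ => ?_
  ring

theorem metricCoord_chartD {c x : M} (hx : x ∈ (extChartAt (𝓡∂ n) c).source)
    (ξ η : TangentSpace (𝓡∂ n) x) :
    metricCoord g c (extChartAt (𝓡∂ n) c x) (chartD c x ξ) (chartD c x η) = g.inner x ξ η := by
  rw [metricCoord_eq_inner g hx, chartDInv_chartD hx, chartDInv_chartD hx]

theorem metricCoord_symm {c : M} {y : EuclideanSpace ℝ (Fin n)} (v w : EuclideanSpace ℝ (Fin n)) :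
    metricCoord g c y v w = metricCoord g c y w v := by
  rw [metricCoord_apply, metricCoord_apply, Finset.sum_comm]
  refine Finset.sum_congr rfl fun i _ => Finset.sum_congr rfl fun j _ => ?_
  simp only [gram, Matrix.of_apply]
  rw [g.symm, mul_comm (v j)]

theorem metricCoord_pos {c : M} {y : EuclideanSpace ℝ (Fin n)}
    (hy : y ∈ (extChartAt (𝓡∂ n) c).target) {v : EuclideanSpace ℝ (Fin n)} (hv : v ≠ 0) :
    0 < metricCoord g c y v v := by
  have hx := (extChartAt (𝓡∂ n) c).map_target hy
  have e := metricCoord_eq_inner g hx v v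
  rw [(extChartAt (𝓡∂ n) c).right_inv hy] at e
  rw [e]
  refine g.pos _ _ fun h => hv ?_
  rw [← chartD_chartDInv hx v, h, map_zero]

theorem gram_det_ne_zero {c x : M} (hx : x ∈ (extChartAt (𝓡∂ n) c).source) :
    (gram g c x).det ≠ 0 := by
  intro h
  obtain ⟨v, hv, hgv⟩ := Matrix.exists_mulVec_eq_zero_iff.2 h
  have hpos := metricCoord_pos g ((extChartAt (𝓡∂ n) c).map_source hx)
    (v := WithLp.toLp 2 v) (by simpa using hv)
  rw [metricCoord_apply, (extChartAt (𝓡∂ n) c).left_inv hx] at hpos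
  have e : ∀ i, ∑ j, gram g c x i j * (v i * v j) = 0 := fun i => by
    have := congrFun hgv i
    simp only [Matrix.mulVec, dotProduct, Pi.zero_apply] at this
    calc _ = v i * ∑ j, gram g c x i j * v j := by
          rw [Finset.mul_sum]; exact Finset.sum_congr rfl fun j _ => by ring
      _ = 0 := by rw [this, mul_zero]
  simp [e] at hpos

theorem gram_mul_inv {c x : M} (hx : x ∈ (extChartAt (𝓡∂ n) c).source) :
    gram g c x * (gram g c x)⁻¹ = 1 :=
  Matrix.mul_nonsing_inv _ (isUnit_iff_ne_zero.2 (gram_det_ne_zero g hx))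

/-- On the chart domain the coordinate vectors are the local frame induced by the trivialisation of
the tangent bundle at `c`, so smoothness of the metric as a bundle section gives smooth components.
-/
theorem contDiffOn_gram (c : M) (i j : Fin n) :
    ContDiffOn ℝ ∞ (fun y => gram g c ((extChartAt (𝓡∂ n) c).symm y) i j)
      (extChartAt (𝓡∂ n) c).target := by
  have : IsManifold (𝓡∂ n) 1 M := .of_le (n := ∞) (by simp)
  set e := trivializationAt (EuclideanSpace ℝ (Fin n)) (TangentSpace (𝓡∂ n) : M → Type _) c with he
  set bs := (EuclideanSpace.basisFun (Fin n) ℝ).toBasis with hbs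
  have hfr : ∀ i, ∀ x ∈ (chartAt (EuclideanHalfSpace n) c).source,
      e.localFrame bs i x = coordVec c x i := by
    intro i x hx
    have hx' : x ∈ e.baseSet := hx
    rw [e.localFrame_apply_of_mem_baseSet bs hx']
    have h1 := TangentBundle.continuousLinearMapAt_trivializationAt (I := 𝓡∂ n) hx
    have hx2 : x ∈ (extChartAt (𝓡∂ n) c).source := by rwa [extChartAt_source]
    rw [coordVec_eq, ← chartDInv_chartD hx2 (e.basisAt bs hx' i)]
    congr 1
    have h2 : chartD c x (e.basisAt bs hx' i) = e.continuousLinearMapAt ℝ x (e.basisAt bs hx' i) := by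
      rw [h1]; rfl
    rw [h2]
    have h3 := e.linearMapAt_symmₗ (R := ℝ) hx'
      (EuclideanSpace.single i 1 : EuclideanSpace ℝ (Fin n))
    rw [Bundle.Trivialization.coe_symmₗ (hb := hx')] at h3
    simpa [Bundle.Trivialization.basisAt, hbs] using h3
  have h1 : ContMDiffOn (𝓡∂ n) 𝓘(ℝ, ℝ) ∞ (fun x => gram g c x i j)
      (chartAt (EuclideanHalfSpace n) c).source := by
    intro x hx
    have hv : ∀ i, ContMDiffWithinAt (𝓡∂ n) ((𝓡∂ n).prod 𝓘(ℝ, EuclideanSpace ℝ (Fin n))) ∞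
        (fun m => Bundle.TotalSpace.mk' (EuclideanSpace ℝ (Fin n)) m (e.localFrame bs i m))
        (chartAt (EuclideanHalfSpace n) c).source x :=
      fun i => e.contMDiffOn_localFrame_baseSet ∞ bs i x hx
    have h : ContMDiffWithinAt (𝓡∂ n) ((𝓡∂ n).prod 𝓘(ℝ, ℝ)) ∞
        (fun m => Bundle.TotalSpace.mk' ℝ (E := Bundle.Trivial M ℝ) m
          (g.inner m (e.localFrame bs i m) (e.localFrame bs j m)))
        (chartAt (EuclideanHalfSpace n) c).source x := by
      apply ContMDiffWithinAt.clm_bundle_apply₂ (F₁ := EuclideanSpace ℝ (Fin n))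
        (F₂ := EuclideanSpace ℝ (Fin n))
      · exact g.contMDiff.contMDiffAt.contMDiffWithinAt
      · exact hv i
      · exact hv j
    simp only [Bundle.contMDiffWithinAt_totalSpace] at h
    refine h.2.congr (fun x' hx' => ?_) ?_
    · simp only [gram, Matrix.of_apply, ← hfr _ x' hx']; rfl
    · simp only [gram, Matrix.of_apply, ← hfr _ x hx]; rfl
  have h2 := h1.comp (contMDiffOn_extChartAt_symm (I := 𝓡∂ n) (n := ∞) c)
    (fun y hy => by
      have := (extChartAt (𝓡∂ n) c).map_target hy
      rwa [extChartAt_source] at this)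
  exact contMDiffOn_iff_contDiffOn.1 h2

theorem contDiffOn_smul_vector {E F : Type*} [NormedAddCommGroup E] [NormedSpace ℝ E]
    [NormedAddCommGroup F] [NormedSpace ℝ F] {k : WithTop ℕ∞} {s : Set E} {h : E → ℝ}
    (hh : ContDiffOn ℝ k h s) (v : F) : ContDiffOn ℝ k (fun y => h y • v) s :=
  hh.smul contDiffOn_const

theorem contDiffOn_metricCoord (c : M) :
    ContDiffOn ℝ ∞ (metricCoord g c) (extChartAt (𝓡∂ n) c).target :=
  ContDiffOn.sum fun i _ => ContDiffOn.sum fun j _ =>  contDiffOn_smul_vector (contDiffOn_gram g c i j) _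

-- Near each of its points the chart target coincides with the model half-space, so derivatives
-- within either set agree. This gives regularity up to the boundary.
omit [IsManifold (𝓡∂ n) ∞ M] in
theorem contDiffOn_fderivWithin_range {F : Type*} [NormedAddCommGroup F] [NormedSpace ℝ F] {c : M}
    {h : EuclideanSpace ℝ (Fin n) → F} {m k : WithTop ℕ∞} (hmk : m + 1 ≤ k)
    (hh : ContDiffOn ℝ k h (extChartAt (𝓡∂ n) c).target) :
    ContDiffOn ℝ m (fderivWithin ℝ h (Set.range (𝓡∂ n))) (extChartAt (𝓡∂ n) c).target := by
  have hU : UniqueDiffOn ℝ (extChartAt (𝓡∂ n) c).target := uniqueDiffOn_extChartAt_target c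
  refine (hh.fderivWithin hU hmk).congr fun y hy => ?_
  refine (fderivWithin_congr_set ?_).symm
  have h1 := extChartAt_target_mem_nhdsWithin_of_mem hy
  rw [mem_nhdsWithin] at h1
  obtain ⟨o, ho, hyo, hsub⟩ := h1
  filter_upwards [ho.mem_nhds hyo] with z hz
  exact propext ⟨fun h => extChartAt_target_subset_range c h, fun h => hsub ⟨hz, h⟩⟩

theorem contDiffOn_matrix_det {F : Type*} [NormedAddCommGroup F] [NormedSpace ℝ F] {m : ℕ}
    {A : F → Matrix (Fin m) (Fin m) ℝ} {s : Set F} {k : WithTop ℕ∞}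
    (hA : ∀ i j, ContDiffOn ℝ k (fun y => A y i j) s) : ContDiffOn ℝ k (fun y => (A y).det) s := by
  simp only [Matrix.det_apply]
  refine ContDiffOn.sum fun σ _ => ContDiffOn.const_smul _ ?_
  exact contDiffOn_prod fun i _ => hA _ _

theorem contDiffOn_matrix_inv {F : Type*} [NormedAddCommGroup F] [NormedSpace ℝ F] {m : ℕ}
    {A : F → Matrix (Fin m) (Fin m) ℝ} {s : Set F} {k : WithTop ℕ∞}
    (hA : ∀ i j, ContDiffOn ℝ k (fun y => A y i j) s) (hdet : ∀ y ∈ s, (A y).det ≠ 0) (i j : Fin m) :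
    ContDiffOn ℝ k (fun y => (A y)⁻¹ i j) s := by
  simp only [Matrix.inv_def, Matrix.smul_apply, smul_eq_mul, Matrix.adjugate_apply,
    Ring.inverse_eq_inv']
  refine ((contDiffOn_matrix_det hA).inv hdet).mul (contDiffOn_matrix_det fun i' j' => ?_)
  by_cases h : i' = j
  · subst h
    simp only [Matrix.updateRow_self]
    exact contDiffOn_const
  · simp only [Matrix.updateRow_ne h]
    exact hA i' j'

omit [IsManifold (𝓡∂ n) ∞ M] in
theorem chartDeriv_symm {c : M} (h : M → ℝ) (i : Fin n) {y : EuclideanSpace ℝ (Fin n)}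
    (hy : y ∈ (extChartAt (𝓡∂ n) c).target) :
    chartDeriv c h i ((extChartAt (𝓡∂ n) c).symm y)
      = fderivWithin ℝ (fun y => h ((extChartAt (𝓡∂ n) c).symm y)) (Set.range (𝓡∂ n)) y
        (EuclideanSpace.single i 1) := by
  rw [chartDeriv, (extChartAt (𝓡∂ n) c).right_inv hy]

omit [IsManifold (𝓡∂ n) ∞ M] in
theorem contDiffOn_chartDeriv {c : M} {h : M → ℝ} {m k : WithTop ℕ∞} (hmk : m + 1 ≤ k)
    (hh : ContDiffOn ℝ k (fun y => h ((extChartAt (𝓡∂ n) c).symm y)) (extChartAt (𝓡∂ n) c).target)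
    (i : Fin n) :
    ContDiffOn ℝ m (fun y => chartDeriv c h i ((extChartAt (𝓡∂ n) c).symm y))
      (extChartAt (𝓡∂ n) c).target :=
  ((contDiffOn_fderivWithin_range hmk hh).clm_apply contDiffOn_const).congr
    fun _ hy => chartDeriv_symm h i hy

theorem contDiffOn_gram_inv (c : M) (i j : Fin n) :
    ContDiffOn ℝ ∞ (fun y => (gram g c ((extChartAt (𝓡∂ n) c).symm y))⁻¹ i j)
      (extChartAt (𝓡∂ n) c).target :=
  contDiffOn_matrix_inv (contDiffOn_gram g c)
    (fun _ hy => gram_det_ne_zero g ((extChartAt (𝓡∂ n) c).map_target hy)) i j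

theorem contDiffOn_christoffel (c : M) (k i j : Fin n) :
    ContDiffOn ℝ ∞ (fun y => christoffel g c ((extChartAt (𝓡∂ n) c).symm y) k i j)
      (extChartAt (𝓡∂ n) c).target := by
  have hd : ∀ a b d, ContDiffOn ℝ ∞ (fun y => chartDeriv c (fun x' => gram g c x' a b) d
      ((extChartAt (𝓡∂ n) c).symm y)) (extChartAt (𝓡∂ n) c).target := fun a b d =>
    contDiffOn_chartDeriv (k := ∞) (by simp) (contDiffOn_gram g c a b) d
  exact contDiffOn_const.mul (ContDiffOn.sum fun l _ => (contDiffOn_gram_inv g c k l).mul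
    (((hd _ _ _).add (hd _ _ _)).sub (hd _ _ _)))

theorem contDiffOn_christoffelCoord (c : M) :
    ContDiffOn ℝ ∞ (christoffelCoord g c) (extChartAt (𝓡∂ n) c).target :=
  ContDiffOn.sum fun k _ => ContDiffOn.sum fun i _ => ContDiffOn.sum fun j _ =>
    contDiffOn_smul_vector (contDiffOn_christoffel g c k i j) _

theorem christoffel_symm (c x : M) (k i j : Fin n) :
    christoffel g c x k i j = christoffel g c x k j i := by
  have hs : ∀ x', gram g c x' i j = gram g c x' j i := fun x' => g.symm _ _ _
  simp only [christoffel, hs]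
  congr 1
  refine Finset.sum_congr rfl fun l _ => ?_
  ring

theorem christoffelCoord_symm (c : M) (y v w : EuclideanSpace ℝ (Fin n)) :
    christoffelCoord g c y v w = christoffelCoord g c y w v := by
  ext k
  rw [christoffelCoord_apply, christoffelCoord_apply, Finset.sum_comm]
  refine Finset.sum_congr rfl fun i _ => Finset.sum_congr rfl fun j _ => ?_
  rw [christoffel_symm, mul_comm (v j)]

omit [IsManifold (𝓡∂ n) ∞ M] in
theorem fderivWithin_range_eq_fderiv {F : Type*} [NormedAddCommGroup F] [NormedSpace ℝ F] {c : M}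
    {y : EuclideanSpace ℝ (Fin n)} (hy : y ∈ interior (extChartAt (𝓡∂ n) c).target)
    (h : EuclideanSpace ℝ (Fin n) → F) :
    fderivWithin ℝ h (Set.range (𝓡∂ n)) y = fderiv ℝ h y :=
  fderivWithin_of_mem_nhds (Filter.mem_of_superset (mem_interior_iff_mem_nhds.1 hy)
    (extChartAt_target_subset_range c))

omit [NeZero n] in
theorem trilinear_eq_zero
    {T : EuclideanSpace ℝ (Fin n) →L[ℝ] EuclideanSpace ℝ (Fin n) →L[ℝ]
      EuclideanSpace ℝ (Fin n) →L[ℝ] ℝ}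
    (h : ∀ i j k, T (EuclideanSpace.single i 1) (EuclideanSpace.single j 1)
      (EuclideanSpace.single k 1) = 0) (u v w : EuclideanSpace ℝ (Fin n)) : T u v w = 0 := by
  rw [euclidean_eq_sum u, euclidean_eq_sum v, euclidean_eq_sum w]
  simp [map_sum, sum_apply, h]

theorem metricCoord_single (c : M) (y : EuclideanSpace ℝ (Fin n)) (i j : Fin n) :
    metricCoord g c y (EuclideanSpace.single i 1) (EuclideanSpace.single j 1)
      = gram g c ((extChartAt (𝓡∂ n) c).symm y) i j := by
  rw [metricCoord_apply]
  simp

/-- Lowering the upper index cancels the inverse Gram matrix in the symbols and leaves the Koszul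
formula on basis vectors; trilinearity extends it. At interior points the one-sided derivatives in
the symbols are ordinary ones. -/
theorem isChristoffelAt_christoffelCoord {c : M} {y : EuclideanSpace ℝ (Fin n)}
    (hy : y ∈ interior (extChartAt (𝓡∂ n) c).target) :
    IsChristoffelAt (metricCoord g c) (christoffelCoord g c) y := by
  have hyt := interior_subset hy
  have hx := (extChartAt (𝓡∂ n) c).map_target hyt
  have hGd : DifferentiableAt ℝ (metricCoord g c) y :=
    ((contDiffOn_metricCoord g c).contDiffAt (mem_interior_iff_mem_nhds.1 hy)).differentiableAt
      (by simp)
  have hder : ∀ a i j, fderiv ℝ (metricCoord g c) y (EuclideanSpace.single a 1)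
      (EuclideanSpace.single i 1) (EuclideanSpace.single j 1)
      = chartDeriv c (fun x' => gram g c x' i j) a ((extChartAt (𝓡∂ n) c).symm y) := by
    intro a i j
    rw [chartDeriv_symm _ _ hyt, fderivWithin_range_eq_fderiv hy]
    have h1 := (hGd.hasFDerivAt.clm_apply
      (hasFDerivAt_const (EuclideanSpace.single i (1 : ℝ) : EuclideanSpace ℝ (Fin n)) y)).clm_apply
      (hasFDerivAt_const (EuclideanSpace.single j (1 : ℝ) : EuclideanSpace ℝ (Fin n)) y)
    have h2 := h1.congr_of_eventuallyEq
      (f₁ := fun z => gram g c ((extChartAt (𝓡∂ n) c).symm z) i j)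
      (Filter.Eventually.of_forall fun z => (metricCoord_single g c z i j).symm)
    rw [h2.fderiv]
    simp
  have hΓ : ∀ i j m, 2 * metricCoord g c y (christoffelCoord g c y (EuclideanSpace.single i 1)
      (EuclideanSpace.single j 1)) (EuclideanSpace.single m 1)
      = chartDeriv c (fun x' => gram g c x' j m) i ((extChartAt (𝓡∂ n) c).symm y)
        + chartDeriv c (fun x' => gram g c x' i m) j ((extChartAt (𝓡∂ n) c).symm y)
        - chartDeriv c (fun x' => gram g c x' i j) m ((extChartAt (𝓡∂ n) c).symm y) := by
    intro i j m
    set x := (extChartAt (𝓡∂ n) c).symm y with hxdef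
    set δ : Fin n → ℝ := fun l => chartDeriv c (fun x' => gram g c x' j l) i x
        + chartDeriv c (fun x' => gram g c x' i l) j x
        - chartDeriv c (fun x' => gram g c x' i j) l x with hδ
    have e1 : ∀ k, christoffelCoord g c y (EuclideanSpace.single i 1)
        (EuclideanSpace.single j 1) k = 1 / 2 * ((gram g c x)⁻¹.mulVec δ) k := fun k => by
      rw [christoffelCoord_apply, ← hxdef]
      clear_value x
      simp [christoffel, Matrix.mulVec, dotProduct, hδ]
    have e2 : (gram g c x).mulVec ((gram g c x)⁻¹.mulVec δ) = δ := by
      rw [Matrix.mulVec_mulVec, gram_mul_inv g hx, Matrix.one_mulVec]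
    rw [metricCoord_symm, metricCoord_apply]
    have e3 := congrFun e2 m
    simp only [Matrix.mulVec, dotProduct] at e3
    rw [show chartDeriv c (fun x' => gram g c x' j m) i x
        + chartDeriv c (fun x' => gram g c x' i m) j x
        - chartDeriv c (fun x' => gram g c x' i j) m x = δ m from rfl, ← e3, Finset.mul_sum,
      Finset.sum_eq_single m]
    · rw [Finset.mul_sum]
      refine Finset.sum_congr rfl fun k _ => ?_
      rw [e1, ← hxdef]
      clear_value x
      simp only [Matrix.mulVec, dotProduct, PiLp.single_apply, if_true]
      ring
    · intro b _ hb
      simp [hb]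
    · simp
  intro v w z
  set DG := fderiv ℝ (metricCoord g c) y with hDG
  have key := trilinear_eq_zero (T := (2 : ℝ) • ((ContinuousLinearMap.compL ℝ _ _ _
      (metricCoord g c y)).comp (christoffelCoord g c y)) - DG - DG.flip
      + ((ContinuousLinearMap.flipₗᵢ ℝ (EuclideanSpace ℝ (Fin n)) (EuclideanSpace ℝ (Fin n))
        ℝ).toContinuousLinearEquiv.toContinuousLinearMap).comp DG.flip)
    (fun i j m => by
      have h1 := hΓ i j m
      rw [← hder, ← hder, ← hder] at h1
      change 2 * metricCoord g c y (christoffelCoord g c y (EuclideanSpace.single i 1)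
        (EuclideanSpace.single j 1)) (EuclideanSpace.single m 1)
        - DG (EuclideanSpace.single i 1) (EuclideanSpace.single j 1) (EuclideanSpace.single m 1)
        - DG (EuclideanSpace.single j 1) (EuclideanSpace.single i 1) (EuclideanSpace.single m 1)
        + DG (EuclideanSpace.single m 1) (EuclideanSpace.single i 1) (EuclideanSpace.single j 1) = 0
      linarith) v w z
  have key' : 2 * metricCoord g c y (christoffelCoord g c y v w) z - DG v w z - DG w v z
    + DG z v w = 0 := key
  linarith

end MetricInCharts

/-! ### Interior points: changes of chart and the Hessian in an arbitrary chart. -/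

section InteriorPoints

variable {n : ℕ} [NeZero n] {M : Type*} [TopologicalSpace M] [ChartedSpace (EuclideanHalfSpace n) M]
  [IsManifold (𝓡∂ n) ∞ M]

theorem mem_interior_target {c x : M} (hi : (𝓡∂ n).IsInteriorPoint x)
    (hx : x ∈ (extChartAt (𝓡∂ n) c).source) :
    extChartAt (𝓡∂ n) c x ∈ interior (extChartAt (𝓡∂ n) c).target :=
  ((𝓡∂ n).isInteriorPoint_iff_of_mem_atlas (n := ∞) (by simp)
    (chart_mem_atlas (EuclideanHalfSpace n) c) (by rwa [extChartAt_source] at hx)).1 hi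

theorem isInteriorPoint_symm {c : M} {y : EuclideanSpace ℝ (Fin n)}
    (hy : y ∈ interior (extChartAt (𝓡∂ n) c).target) :
    (𝓡∂ n).IsInteriorPoint ((extChartAt (𝓡∂ n) c).symm y) := by
  have hx := (extChartAt (𝓡∂ n) c).map_target (interior_subset hy)
  refine ((𝓡∂ n).isInteriorPoint_iff_of_mem_atlas (n := ∞) (by simp)
    (chart_mem_atlas (EuclideanHalfSpace n) c) (by rwa [extChartAt_source] at hx)).2 ?_
  change extChartAt (𝓡∂ n) c ((extChartAt (𝓡∂ n) c).symm y) ∈ interior (extChartAt (𝓡∂ n) c).target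
  rwa [(extChartAt (𝓡∂ n) c).right_inv (interior_subset hy)]

theorem contDiffAt_comp_symm {F : Type*} [NormedAddCommGroup F] [NormedSpace ℝ F] {h : M → F}
    {k : WithTop ℕ∞} (hk : k ≤ ∞) {c : M} {y : EuclideanSpace ℝ (Fin n)}
    (hy : y ∈ interior (extChartAt (𝓡∂ n) c).target)
    (hh : ContMDiffAt (𝓡∂ n) 𝓘(ℝ, F) k h ((extChartAt (𝓡∂ n) c).symm y)) :
    ContDiffAt ℝ k (fun z => h ((extChartAt (𝓡∂ n) c).symm z)) y := by
  have h1 := ((contMDiffOn_extChartAt_symm (I := 𝓡∂ n) (n := ∞) c).contMDiffAt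
    (mem_interior_iff_mem_nhds.1 hy)).of_le hk
  exact contMDiffAt_iff_contDiffAt.1 (hh.comp y h1)

/-- The change of coordinates from the chart at `c` to the chart at `c'`. -/
def transition (c c' : M) (y : EuclideanSpace ℝ (Fin n)) : EuclideanSpace ℝ (Fin n) :=
  extChartAt (𝓡∂ n) c' ((extChartAt (𝓡∂ n) c).symm y)

theorem eventually_mem_charts {c c' x : M} (hi : (𝓡∂ n).IsInteriorPoint x)
    (hx : x ∈ (extChartAt (𝓡∂ n) c).source) (hx' : x ∈ (extChartAt (𝓡∂ n) c').source) :
    ∀ᶠ z in nhds (extChartAt (𝓡∂ n) c x), z ∈ interior (extChartAt (𝓡∂ n) c).target ∧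
      (extChartAt (𝓡∂ n) c).symm z ∈ (extChartAt (𝓡∂ n) c').source := by
  refine Filter.Eventually.and (isOpen_interior.mem_nhds (mem_interior_target hi hx)) ?_
  refine (continuousAt_extChartAt_symm' hx).eventually ?_
  rw [(extChartAt (𝓡∂ n) c).left_inv hx]
  exact (isOpen_extChartAt_source c').mem_nhds hx'

theorem contDiffAt_transition {c c' x : M} (hi : (𝓡∂ n).IsInteriorPoint x)
    (hx : x ∈ (extChartAt (𝓡∂ n) c).source) (hx' : x ∈ (extChartAt (𝓡∂ n) c').source) :
    ContDiffAt ℝ ∞ (transition c c') (extChartAt (𝓡∂ n) c x) := by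
  refine contDiffAt_comp_symm le_rfl (mem_interior_target hi hx) ?_
  rw [(extChartAt (𝓡∂ n) c).left_inv hx]
  exact contMDiffAt_extChartAt' (by rwa [extChartAt_source] at hx')

theorem chartD_transition {c c' x : M} (hi : (𝓡∂ n).IsInteriorPoint x)
    (hx : x ∈ (extChartAt (𝓡∂ n) c).source) (hx' : x ∈ (extChartAt (𝓡∂ n) c').source)
    (ξ : TangentSpace (𝓡∂ n) x) :
    chartD c' x ξ = fderiv ℝ (transition c c') (extChartAt (𝓡∂ n) c x) (chartD c x ξ) := by
  have : IsManifold (𝓡∂ n) 1 M := .of_le (n := ∞) (by simp)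
  have h := mfderiv_eq_fderivWithin_comp hx (h := extChartAt (𝓡∂ n) c')
    (mdifferentiableAt_extChartAt (by rwa [extChartAt_source] at hx')) ξ
  rw [fderivWithin_range_eq_fderiv (mem_interior_target hi hx)] at h
  exact h

omit [IsManifold (𝓡∂ n) ∞ M] in
theorem transition_transition {c c' x : M} (hx : x ∈ (extChartAt (𝓡∂ n) c).source) :
    transition c c' (extChartAt (𝓡∂ n) c x) = extChartAt (𝓡∂ n) c' x := by
  rw [transition, (extChartAt (𝓡∂ n) c).left_inv hx]

theorem diff_eq_fderiv {u : M → ℝ} {c x : M} (hi : (𝓡∂ n).IsInteriorPoint x)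
    (hx : x ∈ (extChartAt (𝓡∂ n) c).source) (hu : ContMDiffAt (𝓡∂ n) 𝓘(ℝ, ℝ) 1 u x)
    (ξ : TangentSpace (𝓡∂ n) x) :
    diff u x ξ = fderiv ℝ (fun z => u ((extChartAt (𝓡∂ n) c).symm z)) (extChartAt (𝓡∂ n) c x)
      (chartD c x ξ) := by
  rw [← fderivWithin_range_eq_fderiv (mem_interior_target hi hx)]
  exact mfderiv_eq_fderivWithin_comp hx (hu.mdifferentiableAt (by simp)) ξ

variable (g : Bundle.ContMDiffRiemannianMetric (𝓡∂ n) ∞ (EuclideanSpace ℝ (Fin n))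
    (fun x : M => TangentSpace (𝓡∂ n) x))

theorem metricCoord_differentiableAt {c : M} {y : EuclideanSpace ℝ (Fin n)}
    (hy : y ∈ interior (extChartAt (𝓡∂ n) c).target) :
    DifferentiableAt ℝ (metricCoord g c) y :=
  ((contDiffOn_metricCoord g c).contDiffAt (mem_interior_iff_mem_nhds.1 hy)).differentiableAt
    (by simp)

/-- The two coordinate metrics are related by pullback along the transition map and both families of
symbols satisfy the Koszul formula, so the general transformation law applies. -/
theorem christoffelCoord_transform {c c' x : M} (hi : (𝓡∂ n).IsInteriorPoint x)
    (hx : x ∈ (extChartAt (𝓡∂ n) c).source) (hx' : x ∈ (extChartAt (𝓡∂ n) c').source)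
    (v w : EuclideanSpace ℝ (Fin n)) :
    fderiv ℝ (fderiv ℝ (transition c c')) (extChartAt (𝓡∂ n) c x) v w
      = fderiv ℝ (transition c c') (extChartAt (𝓡∂ n) c x)
          (christoffelCoord g c (extChartAt (𝓡∂ n) c x) v w)
        - christoffelCoord g c' (extChartAt (𝓡∂ n) c' x)
          (fderiv ℝ (transition c c') (extChartAt (𝓡∂ n) c x) v)
          (fderiv ℝ (transition c c') (extChartAt (𝓡∂ n) c x) w) := by
  have hy := mem_interior_target hi hx
  have hy' := mem_interior_target hi hx'
  have hφ := contDiffAt_transition hi hx hx'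
  rw [← transition_transition (c' := c') hx] at hy' ⊢
  refine christoffel_transform (G := metricCoord g c) (G' := metricCoord g c')
    (hφ.of_le (WithTop.coe_le_coe.2 le_top)) (metricCoord_differentiableAt g hy')
    (metricCoord_symm g) ?_ ?_ ?_ (metricCoord_differentiableAt g hy)
    (isChristoffelAt_christoffelCoord g hy) (isChristoffelAt_christoffelCoord g hy') v w
  · intro v hv
    by_contra h
    exact (metricCoord_pos g (interior_subset hy') h).ne' hv
  · intro v
    refine ⟨chartD c x (chartDInv c' x v), ?_⟩
    rw [← chartD_transition hi hx hx', chartD_chartDInv hx']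
  · filter_upwards [eventually_mem_charts hi hx hx'] with z hz v w
    have hz1 := (extChartAt (𝓡∂ n) c).map_target (interior_subset hz.1)
    have ez := (extChartAt (𝓡∂ n) c).right_inv (interior_subset hz.1)
    have hc := chartD_transition (isInteriorPoint_symm hz.1) hz1 hz.2
    rw [ez] at hc
    have e1 := metricCoord_eq_inner g hz1 v w
    rw [ez] at e1
    rw [e1, ← metricCoord_chartD g hz.2, hc, hc, chartD_chartDInv hz1, chartD_chartDInv hz1]
    rfl

/-- The defining chart of the Hessian varies with `x`; reading it in one fixed chart `c` is what
allows the equation to be differentiated near a point. -/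
theorem hess_eq_covHess {u : M → ℝ} {c x : M} (hi : (𝓡∂ n).IsInteriorPoint x)
    (hx : x ∈ (extChartAt (𝓡∂ n) c).source) (hu : ContMDiffAt (𝓡∂ n) 𝓘(ℝ, ℝ) 2 u x)
    (ξ η : TangentSpace (𝓡∂ n) x) :
    hess g u x ξ η = covHess (fun z => u ((extChartAt (𝓡∂ n) c).symm z)) (christoffelCoord g c)
      (extChartAt (𝓡∂ n) c x) (chartD c x ξ) (chartD c x η) := by
  have hx₀ := mem_extChartAt_source (I := 𝓡∂ n) x
  have hy₀ := mem_interior_target hi hx₀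
  have e0 := (extChartAt (𝓡∂ n) x).left_inv hx₀
  set y₀ := extChartAt (𝓡∂ n) x x with hy₀def
  set w := fun z => u ((extChartAt (𝓡∂ n) x).symm z) with hw
  have hwd : ContDiffAt ℝ 2 w y₀ := contDiffAt_comp_symm (WithTop.coe_le_coe.2 le_top) hy₀ (by rwa [e0])
  have own : ∀ a b, hess g u x a b = covHess w (christoffelCoord g x) y₀ (chartD x x a) (chartD x x b) := by
    intro a b
    have h1 : ∀ j, ∀ᶠ z in nhds y₀, chartDeriv x u j ((extChartAt (𝓡∂ n) x).symm z)
        = fderiv ℝ w z (EuclideanSpace.single j 1) := fun j => by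
      filter_upwards [isOpen_interior.mem_nhds hy₀] with z hz
      rw [chartDeriv_symm _ _ (interior_subset hz), fderivWithin_range_eq_fderiv hz]
    have h2 : ∀ i j, hessCoord g u x x i j = covHess w (christoffelCoord g x) y₀
        (EuclideanSpace.single i 1) (EuclideanSpace.single j 1) := fun i j => by
      have hd1 : ContDiffAt ℝ 1 (fderiv ℝ w) y₀ := hwd.fderiv_right (by norm_num)
      have h3 := (hd1.differentiableAt (by norm_num)).hasFDerivAt.clm_apply
        (hasFDerivAt_const (EuclideanSpace.single j (1 : ℝ) : EuclideanSpace ℝ (Fin n)) y₀)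
      have h4 := (h3.congr_of_eventuallyEq (h1 j)).fderiv
      rw [hessCoord, chartDeriv, ← hy₀def, fderivWithin_range_eq_fderiv hy₀, h4, covHess_apply,
        euclidean_eq_sum (christoffelCoord g x y₀ _ _)]
      have h5 : ∀ k, chartDeriv x u k x = fderiv ℝ w y₀ (EuclideanSpace.single k 1) := fun k => by
        have := (h1 k).self_of_nhds
        rwa [e0] at this
      simp only [christoffelCoord_apply, e0, map_sum, map_smul, h5]
      simp
    rw [hess, euclidean_eq_sum (chartD x x a), euclidean_eq_sum (chartD x x b)]
    simp only [h2, coordForm_apply, map_sum, map_smul, sum_apply, smul_apply, smul_eq_mul,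
      Finset.mul_sum]
    rw [Finset.sum_comm]
    refine Finset.sum_congr rfl fun i _ => Finset.sum_congr rfl fun j _ => ?_
    ring
  rw [own, covHess_transform (Γ' := christoffelCoord g c) (φ := transition x c)
    (u' := fun z => u ((extChartAt (𝓡∂ n) c).symm z))
    ((contDiffAt_transition hi hx₀ hx).of_le (WithTop.coe_le_coe.2 le_top)) ?_ ?_
    (fun v w => by
      rw [transition_transition hx₀]; exact christoffelCoord_transform g hi hx₀ hx v w),
    ← chartD_transition hi hx₀ hx, ← chartD_transition hi hx₀ hx, transition_transition hx₀]
  · rw [transition_transition hx₀]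
    exact contDiffAt_comp_symm (WithTop.coe_le_coe.2 le_top) (mem_interior_target hi hx)
      (by rwa [(extChartAt (𝓡∂ n) c).left_inv hx])
  · filter_upwards [eventually_mem_charts hi hx₀ hx] with z hz
    rw [hw, transition, (extChartAt (𝓡∂ n) c).left_inv hz.2]

end InteriorPoints

/-! ### Raising indices, and the gradient in a chart. -/

section GradientInCharts

variable {n : ℕ} [NeZero n] {M : Type*} [TopologicalSpace M] [ChartedSpace (EuclideanHalfSpace n) M]
  [IsManifold (𝓡∂ n) ∞ M]
  (g : Bundle.ContMDiffRiemannianMetric (𝓡∂ n) ∞ (EuclideanSpace ℝ (Fin n))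
    (fun x : M => TangentSpace (𝓡∂ n) x))

omit [NeZero n] in
theorem sum_single_apply (a : Fin n → ℝ) (k : Fin n) :
    (∑ i, a i • (EuclideanSpace.single i 1 : EuclideanSpace ℝ (Fin n))) k = a k := by
  simp [Pi.single_apply]

/-- The vector dual to a covector. -/
def raisedVec (x : M) (p : TangentSpace (𝓡∂ n) x →L[ℝ] ℝ) : TangentSpace (𝓡∂ n) x :=
  chartDInv x x (∑ k, raised g x p k • (EuclideanSpace.single k 1 : EuclideanSpace ℝ (Fin n)))

theorem chartD_raisedVec (x : M) (p : TangentSpace (𝓡∂ n) x →L[ℝ] ℝ) (k : Fin n) :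
    chartD x x (raisedVec g x p) k = raised g x p k := by
  rw [raisedVec, chartD_chartDInv (mem_extChartAt_source (I := 𝓡∂ n) x), sum_single_apply]

theorem gram_symm (c x : M) (i j : Fin n) : gram g c x i j = gram g c x j i := g.symm _ _ _

/-- Raising an index with the inverse matrix of the metric. -/
theorem sum_gram_raise {c x : M} (hx : x ∈ (extChartAt (𝓡∂ n) c).source) (q : Fin n → ℝ)
    (j : Fin n) : ∑ k, (∑ l, (gram g c x)⁻¹ k l * q l) * gram g c x k j = q j := by
  have h := congrFun (congrArg (fun A : Matrix (Fin n) (Fin n) ℝ => A.mulVec q) (gram_mul_inv g hx)) j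
  simp only [Matrix.one_mulVec] at h
  rw [← Matrix.mulVec_mulVec] at h
  rw [← h]
  simp only [Matrix.mulVec, dotProduct]
  refine Finset.sum_congr rfl fun k _ => ?_
  rw [gram_symm g c x k j, mul_comm]

theorem inner_raisedVec (x : M) (p : TangentSpace (𝓡∂ n) x →L[ℝ] ℝ) (w : TangentSpace (𝓡∂ n) x) :
    g.inner x (raisedVec g x p) w = p w := by
  have hx := mem_extChartAt_source (I := 𝓡∂ n) x
  rw [← metricCoord_chartD g hx, metricCoord_apply, (extChartAt (𝓡∂ n) x).left_inv hx]
  simp only [chartD_raisedVec]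
  conv_rhs => rw [← chartDInv_chartD hx w, euclidean_eq_sum (chartD x x w)]
  simp only [map_sum, map_smul, smul_eq_mul, ← coordVec_eq]
  rw [Finset.sum_comm]
  refine Finset.sum_congr rfl fun j _ => ?_
  rw [← show comps x x p j = p (coordVec x x j) from rfl, ← sum_gram_raise g hx (comps x x p) j,
    Finset.mul_sum]
  refine Finset.sum_congr rfl fun k _ => ?_
  rw [raised]
  ring

theorem apply_raisedVec (x : M) (p : TangentSpace (𝓡∂ n) x →L[ℝ] ℝ) :
    p (raisedVec g x p) = ∑ k, raised g x p k * comps x x p k := by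
  rw [raisedVec]
  simp only [map_sum, map_smul, smul_eq_mul, ← coordVec_eq]
  rfl

theorem inner_self_nonneg (x : M) (ξ : TangentSpace (𝓡∂ n) x) : 0 ≤ g.inner x ξ ξ := by
  by_cases h : ξ = 0
  · simp [h]
  · exact (g.pos x ξ h).le

theorem covNorm_sq (x : M) (p : TangentSpace (𝓡∂ n) x →L[ℝ] ℝ) :
    covNorm g x p ^ 2 = p (raisedVec g x p) := by
  have h : 0 ≤ p (raisedVec g x p) := by
    rw [← inner_raisedVec]; exact inner_self_nonneg g x _
  rw [covNorm, ← apply_raisedVec, Real.sq_sqrt h]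

theorem vecNorm_sq (x : M) (ξ : TangentSpace (𝓡∂ n) x) : vecNorm g x ξ ^ 2 = g.inner x ξ ξ :=
  Real.sq_sqrt (inner_self_nonneg g x ξ)

theorem eq_of_inner_eq {x : M} {ξ η : TangentSpace (𝓡∂ n) x}
    (h : ∀ w, g.inner x ξ w = g.inner x η w) : ξ = η := by
  by_contra hne
  have := g.pos x (ξ - η) (sub_ne_zero.2 hne)
  rw [map_sub (g.inner x), sub_apply, h, sub_self] at this
  exact lt_irrefl _ this

/-- The gradient of a function in the chart at `c`. -/
def gradCoord (c : M) (u : M → ℝ) (y : EuclideanSpace ℝ (Fin n)) : EuclideanSpace ℝ (Fin n) :=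
  ∑ k, (∑ l, (gram g c ((extChartAt (𝓡∂ n) c).symm y))⁻¹ k l *
    chartDeriv c u l ((extChartAt (𝓡∂ n) c).symm y)) • EuclideanSpace.single k 1

theorem metricCoord_gradCoord {c : M} {y : EuclideanSpace ℝ (Fin n)}
    (hy : y ∈ (extChartAt (𝓡∂ n) c).target) (u : M → ℝ) (w : EuclideanSpace ℝ (Fin n)) :
    metricCoord g c y (gradCoord g c u y) w
      = fderivWithin ℝ (fun y => u ((extChartAt (𝓡∂ n) c).symm y)) (Set.range (𝓡∂ n)) y w := by
  have hx := (extChartAt (𝓡∂ n) c).map_target hy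
  rw [metricCoord_apply]
  conv_rhs => rw [euclidean_eq_sum w]
  simp only [map_sum, map_smul, smul_eq_mul]
  rw [Finset.sum_comm]
  refine Finset.sum_congr rfl fun j _ => ?_
  rw [← chartDeriv_symm u j hy, ← sum_gram_raise g hx
    (fun l => chartDeriv c u l ((extChartAt (𝓡∂ n) c).symm y)) j, Finset.mul_sum]
  refine Finset.sum_congr rfl fun k _ => ?_
  have : gradCoord g c u y k = ∑ l, (gram g c ((extChartAt (𝓡∂ n) c).symm y))⁻¹ k l *
      chartDeriv c u l ((extChartAt (𝓡∂ n) c).symm y) := sum_single_apply _ k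
  rw [this]
  ring

theorem contDiffOn_comp_symm {u : M → ℝ} {k : WithTop ℕ∞} (hk : k ≤ ∞)
    (hu : ContMDiff (𝓡∂ n) 𝓘(ℝ, ℝ) k u) (c : M) :
    ContDiffOn ℝ k (fun y => u ((extChartAt (𝓡∂ n) c).symm y)) (extChartAt (𝓡∂ n) c).target :=
  contMDiffOn_iff_contDiffOn.1 ((hu.contMDiffOn (s := Set.univ)).comp
    ((contMDiffOn_extChartAt_symm (I := 𝓡∂ n) (n := ∞) c).of_le hk) fun _ _ => Set.mem_univ _)

theorem contDiffOn_gradCoord {u : M → ℝ} {m k : WithTop ℕ∞} (hmk : m + 1 ≤ k) (hm : m ≤ ∞)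
    (hk : k ≤ ∞) (hu : ContMDiff (𝓡∂ n) 𝓘(ℝ, ℝ) k u) (c : M) :
    ContDiffOn ℝ m (gradCoord g c u) (extChartAt (𝓡∂ n) c).target :=
  ContDiffOn.sum fun k' _ => contDiffOn_smul_vector (ContDiffOn.sum fun l _ =>
    ((contDiffOn_gram_inv g c k' l).of_le hm).mul
      (contDiffOn_chartDeriv hmk (contDiffOn_comp_symm hk hu c) l)) _

theorem chartD_raisedVec_diff {u : M → ℝ} (hu : ContMDiff (𝓡∂ n) 𝓘(ℝ, ℝ) 1 u) {c x : M}
    (hx : x ∈ (extChartAt (𝓡∂ n) c).source) :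
    chartD c x (raisedVec g x (diff u x)) = gradCoord g c u (extChartAt (𝓡∂ n) c x) := by
  have h : raisedVec g x (diff u x)
      = chartDInv c x (gradCoord g c u (extChartAt (𝓡∂ n) c x)) := by
    refine eq_of_inner_eq g fun w => ?_
    rw [inner_raisedVec, ← metricCoord_chartD g hx, chartD_chartDInv hx,
      metricCoord_gradCoord g ((extChartAt (𝓡∂ n) c).map_source hx)]
    exact mfderiv_eq_fderivWithin_comp hx (hu.contMDiffAt.mdifferentiableAt (by simp)) w
  rw [h, chartD_chartDInv hx]

theorem gradNorm_sq {u : M → ℝ} (hu : ContMDiff (𝓡∂ n) 𝓘(ℝ, ℝ) 1 u) {c x : M}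
    (hx : x ∈ (extChartAt (𝓡∂ n) c).source) :
    gradNorm g u x ^ 2 = metricCoord g c (extChartAt (𝓡∂ n) c x)
      (gradCoord g c u (extChartAt (𝓡∂ n) c x)) (gradCoord g c u (extChartAt (𝓡∂ n) c x)) := by
  rw [gradNorm, covNorm_sq, ← inner_raisedVec, ← metricCoord_chartD g hx,
    chartD_raisedVec_diff g hu hx]

theorem gradNorm_nonneg (u : M → ℝ) (x : M) : 0 ≤ gradNorm g u x := Real.sqrt_nonneg _

/-- The definition uses the preferred chart at `x`, which may jump with `x`. Near `c` the square of
the norm equals a continuous expression in the one chart at `c`. -/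
theorem continuous_gradNorm {u : M → ℝ} (hu : ContMDiff (𝓡∂ n) 𝓘(ℝ, ℝ) 1 u) :
    Continuous (gradNorm g u) := by
  rw [continuous_iff_continuousAt]
  intro c
  have hc := contDiffOn_gradCoord g (m := 0) (k := 1) (by simp) (by simp)
    (WithTop.coe_le_coe.2 le_top) hu c
  have hco : ContinuousOn (fun y => metricCoord g c y (gradCoord g c u y) (gradCoord g c u y))
      (extChartAt (𝓡∂ n) c).target :=
    ((contDiffOn_metricCoord g c).continuousOn.clm_apply hc.continuousOn).clm_apply hc.continuousOn
  have h2 : ContinuousOn (fun x => gradNorm g u x ^ 2) (extChartAt (𝓡∂ n) c).source :=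
    (hco.comp (continuousOn_extChartAt c) (extChartAt (𝓡∂ n) c).mapsTo).congr
      fun x hx => gradNorm_sq g hu hx
  have h3 := (h2.continuousAt (extChartAt_source_mem_nhds c)).sqrt
  refine h3.congr (Filter.Eventually.of_forall fun x => ?_)
  exact Real.sqrt_sq (gradNorm_nonneg g u x)

end GradientInCharts

/-! ### The data `A` and `ψ` as functions on open sets of coordinates. -/

section TensorsInCharts

variable {n : ℕ} [NeZero n] {M : Type*} [TopologicalSpace M] [ChartedSpace (EuclideanHalfSpace n) M]

/-- The components of a covector of `ℝⁿ`. -/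
def flatComps : (EuclideanSpace ℝ (Fin n) →L[ℝ] ℝ) →L[ℝ] (Fin n → ℝ) :=
  ContinuousLinearMap.pi fun l => ContinuousLinearMap.apply ℝ ℝ (EuclideanSpace.single l 1)

theorem covec_flatComps (c x : M) (q : EuclideanSpace ℝ (Fin n) →L[ℝ] ℝ) :
    covec c x (flatComps q) = q.comp (chartD c x) := by
  rw [covec_eq]
  congr 1
  exact (eq_flatCovec q).symm

/-- A function of `(x, z, p)` in the chart at `c`. -/
def scalarCoord (ψ : (x : M) → ℝ → (TangentSpace (𝓡∂ n) x →L[ℝ] ℝ) → ℝ) (c : M)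
    (w : EuclideanSpace ℝ (Fin n) × ℝ × (EuclideanSpace ℝ (Fin n) →L[ℝ] ℝ)) : ℝ :=
  ψ ((extChartAt (𝓡∂ n) c).symm w.1) w.2.1 (w.2.2.comp (chartD c _))

/-- The quadratic form of a tensor depending on `(x, z, p)`, in the chart at `c`. -/
def tensorCoord (A : (x : M) → ℝ → (TangentSpace (𝓡∂ n) x →L[ℝ] ℝ) →
    LinearMap.BilinForm ℝ (TangentSpace (𝓡∂ n) x)) (c : M)
    (w : EuclideanSpace ℝ (Fin n) × ℝ × (EuclideanSpace ℝ (Fin n) →L[ℝ] ℝ) ×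
      EuclideanSpace ℝ (Fin n)) : ℝ :=
  A ((extChartAt (𝓡∂ n) c).symm w.1) w.2.1 (w.2.2.1.comp (chartD c _))
    (chartDInv c _ w.2.2.2) (chartDInv c _ w.2.2.2)

/-- The components of a tensor depending on `(x, z, p)`, in the chart at `c`. -/
def tensorComp (A : (x : M) → ℝ → (TangentSpace (𝓡∂ n) x →L[ℝ] ℝ) →
    LinearMap.BilinForm ℝ (TangentSpace (𝓡∂ n) x)) (c : M) (i j : Fin n)
    (w : EuclideanSpace ℝ (Fin n) × ℝ × (Fin n → ℝ)) : ℝ :=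
  A ((extChartAt (𝓡∂ n) c).symm w.1) w.2.1 (covec c _ w.2.2) (coordVec c _ i) (coordVec c _ j)

variable {A : (x : M) → ℝ → (TangentSpace (𝓡∂ n) x →L[ℝ] ℝ) →
    LinearMap.BilinForm ℝ (TangentSpace (𝓡∂ n) x)}
  {ψ : (x : M) → ℝ → (TangentSpace (𝓡∂ n) x →L[ℝ] ℝ) → ℝ}

theorem tensorCoord_eq (c : M) (w : EuclideanSpace ℝ (Fin n) × ℝ ×
    (EuclideanSpace ℝ (Fin n) →L[ℝ] ℝ) × EuclideanSpace ℝ (Fin n)) :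
    tensorCoord A c w = ∑ i, ∑ j, w.2.2.2 i * w.2.2.2 j *
      tensorComp A c i j (w.1, w.2.1, flatComps w.2.2.1) := by
  obtain ⟨y, t, q, v⟩ := w
  simp only [tensorCoord, tensorComp, covec_flatComps]
  generalize q.comp (chartD c _) = p
  generalize A _ t p = B
  have e : chartDInv c ((extChartAt (𝓡∂ n) c).symm y) v
      = ∑ i, v i • coordVec c ((extChartAt (𝓡∂ n) c).symm y) i := by
    conv_lhs => rw [euclidean_eq_sum v]
    simp only [map_sum, map_smul, coordVec_eq]
  rw [e]
  simp only [map_sum, map_smul, LinearMap.sum_apply, LinearMap.smul_apply, smul_eq_mul,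
    Finset.mul_sum]
  rw [Finset.sum_comm]
  refine Finset.sum_congr rfl fun i _ => Finset.sum_congr rfl fun j _ => ?_
  ring

theorem contDiffOn_scalarCoord (hψ : SmoothScalar ψ) (c : M) :
    ContDiffOn ℝ ∞ (scalarCoord ψ c) ((extChartAt (𝓡∂ n) c).target ×ˢ Set.univ) := by
  have hL : ContDiff ℝ ∞ (fun w : EuclideanSpace ℝ (Fin n) × ℝ ×
      (EuclideanSpace ℝ (Fin n) →L[ℝ] ℝ) => (w.1, w.2.1, flatComps w.2.2)) :=
    contDiff_fst.prodMk ((contDiff_fst.comp contDiff_snd).prodMk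
      (flatComps.contDiff.comp (contDiff_snd.comp contDiff_snd)))
  refine ((hψ c).comp hL.contDiffOn fun w hw => ⟨hw.1, trivial⟩).congr fun w _ => ?_
  simp only [scalarCoord, Function.comp, covec_flatComps]

theorem contDiffOn_tensorCoord (hA : SmoothTensor A) (c : M) :
    ContDiffOn ℝ ∞ (tensorCoord A c) ((extChartAt (𝓡∂ n) c).target ×ˢ Set.univ) := by
  have hL : ContDiff ℝ ∞ (fun w : EuclideanSpace ℝ (Fin n) × ℝ ×
      (EuclideanSpace ℝ (Fin n) →L[ℝ] ℝ) × EuclideanSpace ℝ (Fin n) =>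
      (w.1, w.2.1, flatComps w.2.2.1)) :=
    contDiff_fst.prodMk ((contDiff_fst.comp contDiff_snd).prodMk
      (flatComps.contDiff.comp (contDiff_fst.comp (contDiff_snd.comp contDiff_snd))))
  have hv : ∀ i, ContDiff ℝ ∞ (fun w : EuclideanSpace ℝ (Fin n) × ℝ ×
      (EuclideanSpace ℝ (Fin n) →L[ℝ] ℝ) × EuclideanSpace ℝ (Fin n) => w.2.2.2 i) := fun i =>
    (EuclideanSpace.proj i : EuclideanSpace ℝ (Fin n) →L[ℝ] ℝ).contDiff.comp
      (contDiff_snd.comp (contDiff_snd.comp contDiff_snd))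
  refine ContDiffOn.congr (f := fun w => ∑ i, ∑ j, w.2.2.2 i * w.2.2.2 j *
      tensorComp A c i j (w.1, w.2.1, flatComps w.2.2.1)) ?_ fun w _ => tensorCoord_eq c w
  exact ContDiffOn.sum fun i _ => ContDiffOn.sum fun j _ =>
    ((hv i).mul (hv j)).contDiffOn.mul
      ((hA c i j).comp hL.contDiffOn fun w hw => ⟨hw.1, trivial⟩)

end TensorsInCharts

/-! ### Horizontal derivatives and their independence of the chart. -/

section HorizontalDerivative

variable {n : ℕ} [NeZero n] {M : Type*} [TopologicalSpace M] [ChartedSpace (EuclideanHalfSpace n) M]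
  [IsManifold (𝓡∂ n) ∞ M]
  (g : Bundle.ContMDiffRiemannianMetric (𝓡∂ n) ∞ (EuclideanSpace ℝ (Fin n))
    (fun x : M => TangentSpace (𝓡∂ n) x))
  {A : (x : M) → ℝ → (TangentSpace (𝓡∂ n) x →L[ℝ] ℝ) →
    LinearMap.BilinForm ℝ (TangentSpace (𝓡∂ n) x)}
  {ψ : (x : M) → ℝ → (TangentSpace (𝓡∂ n) x →L[ℝ] ℝ) → ℝ}

omit [IsManifold (𝓡∂ n) ∞ M] in
theorem differentiableAt_scalarCoord (hψ : SmoothScalar ψ) {c : M} {y : EuclideanSpace ℝ (Fin n)}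
    (hy : y ∈ interior (extChartAt (𝓡∂ n) c).target) (t : ℝ) (q : EuclideanSpace ℝ (Fin n) →L[ℝ] ℝ) :
    DifferentiableAt ℝ (scalarCoord ψ c) (y, t, q) :=
  ((contDiffOn_scalarCoord hψ c).contDiffAt
    (prod_mem_nhds (mem_interior_iff_mem_nhds.1 hy) Filter.univ_mem)).differentiableAt (by simp)

omit [IsManifold (𝓡∂ n) ∞ M] in
theorem differentiableAt_tensorCoord (hA : SmoothTensor A) {c : M} {y : EuclideanSpace ℝ (Fin n)}
    (hy : y ∈ interior (extChartAt (𝓡∂ n) c).target) (t : ℝ) (q : EuclideanSpace ℝ (Fin n) →L[ℝ] ℝ)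
    (v : EuclideanSpace ℝ (Fin n)) : DifferentiableAt ℝ (tensorCoord A c) (y, t, q, v) :=
  ((contDiffOn_tensorCoord hA c).contDiffAt
    (prod_mem_nhds (mem_interior_iff_mem_nhds.1 hy) Filter.univ_mem)).differentiableAt (by simp)

/-- The derivative in the direction of the horizontal lift of `a`, for fixed `z`. -/
def scalarHoriz (ψ : (x : M) → ℝ → (TangentSpace (𝓡∂ n) x →L[ℝ] ℝ) → ℝ) (c : M)
    (y : EuclideanSpace ℝ (Fin n)) (z : ℝ) (q : EuclideanSpace ℝ (Fin n) →L[ℝ] ℝ)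
    (a : EuclideanSpace ℝ (Fin n)) : ℝ :=
  fderiv ℝ (scalarCoord ψ c) (y, z, q) (a, 0, q.comp (christoffelCoord g c y a))

/-- The derivative in the direction of the horizontal lift of `a`, for fixed `z`. -/
def tensorHoriz (A : (x : M) → ℝ → (TangentSpace (𝓡∂ n) x →L[ℝ] ℝ) →
    LinearMap.BilinForm ℝ (TangentSpace (𝓡∂ n) x)) (c : M)
    (y : EuclideanSpace ℝ (Fin n)) (z : ℝ) (q : EuclideanSpace ℝ (Fin n) →L[ℝ] ℝ)
    (v a : EuclideanSpace ℝ (Fin n)) : ℝ :=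
  fderiv ℝ (tensorCoord A c) (y, z, q, v)
    (a, 0, q.comp (christoffelCoord g c y a), -christoffelCoord g c y a v)

theorem scalarHoriz_sum (ψ : (x : M) → ℝ → (TangentSpace (𝓡∂ n) x →L[ℝ] ℝ) → ℝ) (c : M)
    (y : EuclideanSpace ℝ (Fin n)) (z : ℝ) (q : EuclideanSpace ℝ (Fin n) →L[ℝ] ℝ)
    (a : EuclideanSpace ℝ (Fin n)) : scalarHoriz g ψ c y z q a
      = ∑ k, a k * scalarHoriz g ψ c y z q (EuclideanSpace.single k 1) := by
  have e : ((a, 0, q.comp (christoffelCoord g c y a)) : EuclideanSpace ℝ (Fin n) × ℝ ×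
      (EuclideanSpace ℝ (Fin n) →L[ℝ] ℝ)) = ∑ k, a k • (EuclideanSpace.single k 1, (0 : ℝ),
        q.comp (christoffelCoord g c y (EuclideanSpace.single k 1))) := by
    refine Prod.ext ?_ (Prod.ext ?_ ?_)
    · simpa [Prod.fst_sum] using euclidean_eq_sum a
    · simp [Prod.fst_sum, Prod.snd_sum]
    · conv_lhs => rw [euclidean_eq_sum a]
      ext w
      simp [Prod.snd_sum, sum_apply, map_sum]
  rw [scalarHoriz, e, map_sum]
  simp only [map_smul, smul_eq_mul]
  rfl

theorem tensorHoriz_sum (A : (x : M) → ℝ → (TangentSpace (𝓡∂ n) x →L[ℝ] ℝ) →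
    LinearMap.BilinForm ℝ (TangentSpace (𝓡∂ n) x)) (c : M)
    (y : EuclideanSpace ℝ (Fin n)) (z : ℝ) (q : EuclideanSpace ℝ (Fin n) →L[ℝ] ℝ)
    (v a : EuclideanSpace ℝ (Fin n)) : tensorHoriz g A c y z q v a
      = ∑ k, a k * tensorHoriz g A c y z q v (EuclideanSpace.single k 1) := by
  have e : ((a, 0, q.comp (christoffelCoord g c y a), -christoffelCoord g c y a v) :
      EuclideanSpace ℝ (Fin n) × ℝ × (EuclideanSpace ℝ (Fin n) →L[ℝ] ℝ) × EuclideanSpace ℝ (Fin n))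
      = ∑ k, a k • (EuclideanSpace.single k 1, (0 : ℝ),
        q.comp (christoffelCoord g c y (EuclideanSpace.single k 1)),
        -christoffelCoord g c y (EuclideanSpace.single k 1) v) := by
    refine Prod.ext ?_ (Prod.ext ?_ (Prod.ext ?_ ?_))
    · simpa [Prod.fst_sum] using euclidean_eq_sum a
    · simp [Prod.fst_sum, Prod.snd_sum]
    · conv_lhs => rw [euclidean_eq_sum a]
      ext w
      simp [Prod.snd_sum, Prod.fst_sum, sum_apply, map_sum]
    · conv_lhs => rw [euclidean_eq_sum a]
      simp only [Prod.snd_sum, map_sum, map_smul, sum_apply, smul_apply, Prod.smul_mk, smul_neg,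
        Finset.sum_neg_distrib]
  rw [tensorHoriz, e, map_sum]
  simp only [map_smul, smul_eq_mul]
  rfl

theorem comp_chartDInv_transition {c c' x : M} (hi : (𝓡∂ n).IsInteriorPoint x)
    (hx : x ∈ (extChartAt (𝓡∂ n) c).source) (hx' : x ∈ (extChartAt (𝓡∂ n) c').source)
    (p : TangentSpace (𝓡∂ n) x →L[ℝ] ℝ) :
    p.comp (chartDInv c x) = (p.comp (chartDInv c' x)).comp
      (fderiv ℝ (transition c c') (extChartAt (𝓡∂ n) c x)) := by
  ext v
  have h := chartD_transition hi hx hx' (chartDInv c x v)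
  rw [chartD_chartDInv hx] at h
  simp only [ContinuousLinearMap.comp_apply]
  rw [← h, chartDInv_chartD hx']

theorem eventually_coord_transition {c c' x : M} (hi : (𝓡∂ n).IsInteriorPoint x)
    (hx : x ∈ (extChartAt (𝓡∂ n) c).source) (hx' : x ∈ (extChartAt (𝓡∂ n) c').source) :
    ∀ᶠ y in nhds (extChartAt (𝓡∂ n) c x),
      (extChartAt (𝓡∂ n) c').symm (transition c c' y) = (extChartAt (𝓡∂ n) c).symm y ∧
      (∀ q : EuclideanSpace ℝ (Fin n) →L[ℝ] ℝ, (q.comp (fderiv ℝ (transition c c') y)).comp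
        (chartD c ((extChartAt (𝓡∂ n) c).symm y)) =
          q.comp (chartD c' ((extChartAt (𝓡∂ n) c).symm y))) ∧
      ∀ v, chartDInv c' ((extChartAt (𝓡∂ n) c).symm y) (fderiv ℝ (transition c c') y v)
        = chartDInv c ((extChartAt (𝓡∂ n) c).symm y) v := by
  filter_upwards [eventually_mem_charts hi hx hx'] with y hy
  have hz1 := (extChartAt (𝓡∂ n) c).map_target (interior_subset hy.1)
  have ez := (extChartAt (𝓡∂ n) c).right_inv (interior_subset hy.1)
  have hc := chartD_transition (isInteriorPoint_symm hy.1) hz1 hy.2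
  rw [ez] at hc
  refine ⟨(extChartAt (𝓡∂ n) c').left_inv hy.2, fun q => ?_, fun v => ?_⟩
  · ext w
    simp only [ContinuousLinearMap.comp_apply]
    rw [hc]
  · have h3 := hc (chartDInv c ((extChartAt (𝓡∂ n) c).symm y) v)
    rw [chartD_chartDInv hz1] at h3
    rw [← h3, chartDInv_chartD hy.2]

theorem tensorHoriz_transform (hA : SmoothTensor A) {c c' x : M} (hi : (𝓡∂ n).IsInteriorPoint x)
    (hx : x ∈ (extChartAt (𝓡∂ n) c).source) (hx' : x ∈ (extChartAt (𝓡∂ n) c').source) (z : ℝ)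
    (p : TangentSpace (𝓡∂ n) x →L[ℝ] ℝ) (η ξ : TangentSpace (𝓡∂ n) x) :
    tensorHoriz g A c (extChartAt (𝓡∂ n) c x) z (p.comp (chartDInv c x)) (chartD c x η)
        (chartD c x ξ)
      = tensorHoriz g A c' (extChartAt (𝓡∂ n) c' x) z (p.comp (chartDInv c' x)) (chartD c' x η)
        (chartD c' x ξ) := by
  have hy := mem_interior_target hi hx
  have hy' := mem_interior_target hi hx'
  have e1 := transition_transition (c' := c') hx
  have h := horizontal_fderiv_transform (Γ := christoffelCoord g c (extChartAt (𝓡∂ n) c x))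
    (Γ' := christoffelCoord g c' (extChartAt (𝓡∂ n) c' x)) (T := tensorCoord A c)
    (T' := tensorCoord A c') (t := z) (q := p.comp (chartDInv c' x)) (v := chartD c x η)
    ((contDiffAt_transition hi hx hx').of_le (WithTop.coe_le_coe.2 le_top))
    (christoffelCoord_transform g hi hx hx') ?_ (differentiableAt_tensorCoord hA hy _ _ _)
    (by rw [e1]; exact differentiableAt_tensorCoord hA hy' _ _ _) (chartD c x ξ)
  · rw [← comp_chartDInv_transition hi hx hx', e1, ← chartD_transition hi hx hx',
      ← chartD_transition hi hx hx'] at h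
    exact h
  · filter_upwards [eventually_coord_transition hi hx hx'] with y hy t q v
    -- The base points in the two charts are equal but not definitionally so, and the tangent space
    -- depends on the point; hence the identity is stated for an arbitrary equal point.
    have key : ∀ x', x' = (extChartAt (𝓡∂ n) c).symm y →
        A x' t (q.comp (chartD c' x')) (chartDInv c' x' (fderiv ℝ (transition c c') y v))
          (chartDInv c' x' (fderiv ℝ (transition c c') y v))
        = tensorCoord A c (y, t, q.comp (fderiv ℝ (transition c c') y), v) := by
      rintro _ rfl
      rw [hy.2.2, ← hy.2.1]
      rfl
    exact (key _ hy.1).symm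

theorem scalarHoriz_transform (hψ : SmoothScalar ψ) {c c' x : M} (hi : (𝓡∂ n).IsInteriorPoint x)
    (hx : x ∈ (extChartAt (𝓡∂ n) c).source) (hx' : x ∈ (extChartAt (𝓡∂ n) c').source) (z : ℝ)
    (p : TangentSpace (𝓡∂ n) x →L[ℝ] ℝ) (ξ : TangentSpace (𝓡∂ n) x) :
    scalarHoriz g ψ c (extChartAt (𝓡∂ n) c x) z (p.comp (chartDInv c x)) (chartD c x ξ)
      = scalarHoriz g ψ c' (extChartAt (𝓡∂ n) c' x) z (p.comp (chartDInv c' x)) (chartD c' x ξ) := by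
  have hy := mem_interior_target hi hx
  have hy' := mem_interior_target hi hx'
  have e1 := transition_transition (c' := c') hx
  -- A scalar is treated as a function that ignores its vector argument, so that the transformation
  -- law for functions of a covector and a vector applies.
  let T : M → EuclideanSpace ℝ (Fin n) × ℝ × (EuclideanSpace ℝ (Fin n) →L[ℝ] ℝ) ×
    EuclideanSpace ℝ (Fin n) → ℝ := fun c w => scalarCoord ψ c (w.1, w.2.1, w.2.2.1)
  have hT : ∀ c y t q v, y ∈ interior (extChartAt (𝓡∂ n) c).target →
      DifferentiableAt ℝ (T c) (y, t, q, v) ∧ ∀ a b d e,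
        fderiv ℝ (T c) (y, t, q, v) (a, b, d, e) = fderiv ℝ (scalarCoord ψ c) (y, t, q) (a, b, d) := by
    intro c y t q v hy
    let L : (EuclideanSpace ℝ (Fin n) × ℝ × (EuclideanSpace ℝ (Fin n) →L[ℝ] ℝ) ×
        EuclideanSpace ℝ (Fin n)) →L[ℝ] EuclideanSpace ℝ (Fin n) × ℝ ×
        (EuclideanSpace ℝ (Fin n) →L[ℝ] ℝ) :=
      (ContinuousLinearMap.fst ℝ _ _).prod
        (((ContinuousLinearMap.fst ℝ _ _).comp (ContinuousLinearMap.snd ℝ _ _)).prod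
          ((ContinuousLinearMap.fst ℝ _ _).comp
            ((ContinuousLinearMap.snd ℝ _ _).comp (ContinuousLinearMap.snd ℝ _ _))))
    have h : HasFDerivAt (T c) ((fderiv ℝ (scalarCoord ψ c) (y, t, q)).comp L) (y, t, q, v) :=
      HasFDerivAt.comp (g := scalarCoord ψ c) (f := L) (y, t, q, v)
        (differentiableAt_scalarCoord hψ hy t q).hasFDerivAt L.hasFDerivAt
    refine ⟨h.differentiableAt, fun a b d e => ?_⟩
    rw [h.fderiv]
    rfl
  have h := horizontal_fderiv_transform (Γ := christoffelCoord g c (extChartAt (𝓡∂ n) c x))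
    (Γ' := christoffelCoord g c' (extChartAt (𝓡∂ n) c' x)) (T := T c)
    (T' := T c') (t := z) (q := p.comp (chartDInv c' x)) (v := 0)
    ((contDiffAt_transition hi hx hx').of_le (WithTop.coe_le_coe.2 le_top))
    (christoffelCoord_transform g hi hx hx') ?_ (hT _ _ _ _ _ hy).1
    (by rw [e1]; exact (hT _ _ _ _ _ hy').1) (chartD c x ξ)
  · rw [← comp_chartDInv_transition hi hx hx', e1, ← chartD_transition hi hx hx',
      (hT _ _ _ _ _ hy).2, (hT _ _ _ _ _ hy').2] at h
    exact h
  · filter_upwards [eventually_coord_transition hi hx hx'] with y hy t q v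
    have key : ∀ x', x' = (extChartAt (𝓡∂ n) c).symm y → ψ x' t (q.comp (chartD c' x'))
        = scalarCoord ψ c (y, t, q.comp (fderiv ℝ (transition c c') y)) := by
      rintro _ rfl
      rw [← hy.2.1]
      rfl
    exact (key _ hy.1).symm

end HorizontalDerivative

/-! ### The index formulas for covariant derivatives are horizontal derivatives. -/

section CovariantDerivatives

variable {n : ℕ} [NeZero n] {M : Type*} [TopologicalSpace M] [ChartedSpace (EuclideanHalfSpace n) M]
  [IsManifold (𝓡∂ n) ∞ M]
  (g : Bundle.ContMDiffRiemannianMetric (𝓡∂ n) ∞ (EuclideanSpace ℝ (Fin n))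
    (fun x : M => TangentSpace (𝓡∂ n) x))
  {A : (x : M) → ℝ → (TangentSpace (𝓡∂ n) x →L[ℝ] ℝ) →
    LinearMap.BilinForm ℝ (TangentSpace (𝓡∂ n) x)}
  {ψ : (x : M) → ℝ → (TangentSpace (𝓡∂ n) x →L[ℝ] ℝ) → ℝ}

theorem christoffelCoord_single (c : M) (y : EuclideanSpace ℝ (Fin n)) (k i m : Fin n) :
    christoffelCoord g c y (EuclideanSpace.single k 1) (EuclideanSpace.single i 1) m
      = christoffel g c ((extChartAt (𝓡∂ n) c).symm y) m k i := by
  rw [christoffelCoord_apply]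
  generalize (extChartAt (𝓡∂ n) c).symm y = x
  simp

theorem christoffelCoord_single_left (c : M) (y : EuclideanSpace ℝ (Fin n)) (k m : Fin n)
    (v : EuclideanSpace ℝ (Fin n)) : christoffelCoord g c y (EuclideanSpace.single k 1) v m
      = ∑ i, christoffel g c ((extChartAt (𝓡∂ n) c).symm y) m k i * v i := by
  rw [christoffelCoord_apply]
  generalize (extChartAt (𝓡∂ n) c).symm y = x
  simp

omit [IsManifold (𝓡∂ n) ∞ M] in
theorem apply_eq_sum_comps (x : M) (p : TangentSpace (𝓡∂ n) x →L[ℝ] ℝ)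
    (w : EuclideanSpace ℝ (Fin n)) : p (chartDInv x x w) = ∑ m, w m * comps x x p m := by
  conv_lhs => rw [euclidean_eq_sum w]
  simp only [map_sum, map_smul, smul_eq_mul, ← coordVec_eq]
  rfl

omit [NeZero n] in
theorem fderiv_prod_split {F : EuclideanSpace ℝ (Fin n) × ℝ × (Fin n → ℝ) →L[ℝ] ℝ}
    (a : EuclideanSpace ℝ (Fin n)) (κ : Fin n → ℝ) :
    F (a, 0, κ) = F (a, 0, 0) + ∑ l, κ l * F (0, 0, Pi.single l 1) := by
  have e : ((a, 0, κ) : EuclideanSpace ℝ (Fin n) × ℝ × (Fin n → ℝ))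
      = (a, 0, 0) + ∑ l, κ l • ((0, 0, Pi.single l 1) : EuclideanSpace ℝ (Fin n) × ℝ × (Fin n → ℝ)) := by
    refine Prod.ext ?_ (Prod.ext ?_ ?_)
    · simp [Prod.fst_sum]
    · simp [Prod.fst_sum, Prod.snd_sum]
    · ext m
      simp [Prod.snd_sum, Finset.sum_apply, Pi.single_apply]
  rw [e, map_add, map_sum]
  simp only [map_smul, smul_eq_mul]

-- A relabelling of indices: connection terms acting on the components of a tensor become connection
-- terms acting on the vector with which it is contracted.
omit [NeZero n] in
theorem sum_contract_covariant (D S a Γ : Fin n → Fin n → ℝ) (v : Fin n → ℝ) :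
    ∑ i, ∑ j, (D i j + S i j - ∑ m, Γ m i * a m j - ∑ m, Γ m j * a i m) * v i * v j
      = ∑ i, ∑ j, (v i * v j * (D i j + S i j)
        + a i j * (v i * -∑ k, Γ j k * v k + v j * -∑ k, Γ i k * v k)) := by
  have s1 : ∑ i, ∑ j, (∑ m, Γ m i * a m j) * (v i * v j)
      = ∑ i, ∑ j, a i j * (v j * ∑ k, Γ i k * v k) := by
    simp only [Finset.sum_mul, Finset.mul_sum]
    rw [Finset.sum_congr rfl fun i _ => Finset.sum_comm, Finset.sum_comm,
      Finset.sum_congr rfl fun i _ => Finset.sum_comm]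
    refine Finset.sum_congr rfl fun i _ => Finset.sum_congr rfl fun j _ =>
      Finset.sum_congr rfl fun k _ => ?_
    ring
  have s2 : ∑ i, ∑ j, (∑ m, Γ m j * a i m) * (v i * v j)
      = ∑ i, ∑ j, a i j * (v i * ∑ k, Γ j k * v k) := by
    simp only [Finset.sum_mul, Finset.mul_sum]
    rw [Finset.sum_congr rfl fun i _ => Finset.sum_comm]
    refine Finset.sum_congr rfl fun i _ => Finset.sum_congr rfl fun j _ =>
      Finset.sum_congr rfl fun k _ => ?_
    ring
  have e1 : ∀ i j, (D i j + S i j - ∑ m, Γ m i * a m j - ∑ m, Γ m j * a i m) * v i * v j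
      = v i * v j * (D i j + S i j) - (∑ m, Γ m i * a m j) * (v i * v j)
        - (∑ m, Γ m j * a i m) * (v i * v j) := fun i j => by ring
  have e2 : ∀ i j, v i * v j * (D i j + S i j)
        + a i j * (v i * -∑ k, Γ j k * v k + v j * -∑ k, Γ i k * v k)
      = v i * v j * (D i j + S i j) - a i j * (v j * ∑ k, Γ i k * v k)
        - a i j * (v i * ∑ k, Γ j k * v k) := fun i j => by ring
  simp only [e1, e2, Finset.sum_sub_distrib, s1, s2]

/-- The forgetful map from `(y, z, q, v)` to `(y, z, q_1, …, q_n)`. -/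
def forgetVec : (EuclideanSpace ℝ (Fin n) × ℝ × (EuclideanSpace ℝ (Fin n) →L[ℝ] ℝ) ×
    EuclideanSpace ℝ (Fin n)) →L[ℝ] EuclideanSpace ℝ (Fin n) × ℝ × (Fin n → ℝ) :=
  (ContinuousLinearMap.fst ℝ _ _).prod
    (((ContinuousLinearMap.fst ℝ _ _).comp (ContinuousLinearMap.snd ℝ _ _)).prod
      (flatComps.comp ((ContinuousLinearMap.fst ℝ _ _).comp
        ((ContinuousLinearMap.snd ℝ _ _).comp (ContinuousLinearMap.snd ℝ _ _)))))

/-- The vector component of `(y, z, q, v)`. -/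
def vecComp (i : Fin n) : (EuclideanSpace ℝ (Fin n) × ℝ × (EuclideanSpace ℝ (Fin n) →L[ℝ] ℝ) ×
    EuclideanSpace ℝ (Fin n)) →L[ℝ] ℝ :=
  (EuclideanSpace.proj i : EuclideanSpace ℝ (Fin n) →L[ℝ] ℝ).comp
    ((ContinuousLinearMap.snd ℝ _ _).comp
        ((ContinuousLinearMap.snd ℝ _ _).comp (ContinuousLinearMap.snd ℝ _ _)))

omit [IsManifold (𝓡∂ n) ∞ M] in
theorem fderiv_tensorCoord (hA : SmoothTensor A) {c : M} {y : EuclideanSpace ℝ (Fin n)}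
    (hy : y ∈ interior (extChartAt (𝓡∂ n) c).target) (z : ℝ)
    (q : EuclideanSpace ℝ (Fin n) →L[ℝ] ℝ) (v a : EuclideanSpace ℝ (Fin n))
    (κ : EuclideanSpace ℝ (Fin n) →L[ℝ] ℝ) (θ : EuclideanSpace ℝ (Fin n)) :
    fderiv ℝ (tensorCoord A c) (y, z, q, v) (a, 0, κ, θ)
      = ∑ i, ∑ j, (v i * v j * fderiv ℝ (tensorComp A c i j) (y, z, flatComps q) (a, 0, flatComps κ)
        + tensorComp A c i j (y, z, flatComps q) * (v i * θ j + v j * θ i)) := by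
  have hD : ∀ i j, HasFDerivAt (fun w => tensorComp A c i j (forgetVec w))
      ((fderiv ℝ (tensorComp A c i j) (y, z, flatComps q)).comp forgetVec) (y, z, q, v) := fun i j =>
    HasFDerivAt.comp (g := tensorComp A c i j) (f := forgetVec) (y, z, q, v)
      (((hA c i j).contDiffAt (x := (y, z, flatComps q)) (prod_mem_nhds
        (mem_interior_iff_mem_nhds.1 hy) Filter.univ_mem)).differentiableAt (by simp)).hasFDerivAt
      forgetVec.hasFDerivAt
  have h : HasFDerivAt (fun w => ∑ i, ∑ j, vecComp i w * vecComp j w *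
      tensorComp A c i j (forgetVec w)) _ (y, z, q, v) :=
    HasFDerivAt.fun_sum fun i _ => HasFDerivAt.fun_sum fun j _ =>
      ((vecComp i).hasFDerivAt.mul (vecComp j).hasFDerivAt).mul (hD i j)
  have e : tensorCoord A c = fun w => ∑ i, ∑ j, vecComp i w * vecComp j w *
      tensorComp A c i j (forgetVec w) := funext fun w => tensorCoord_eq c w
  rw [e, h.fderiv]
  simp only [sum_apply, add_apply, smul_apply, ContinuousLinearMap.comp_apply, smul_eq_mul]
  rfl

/-- The connection terms in the index formula are the velocities of the parallel transport of `p`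
and `ξ`. In this form the derivative can be moved to any other chart. -/
theorem pDotGradTensor_eq (hA : SmoothTensor A) {x : M} (hi : (𝓡∂ n).IsInteriorPoint x) (z : ℝ)
    (p : TangentSpace (𝓡∂ n) x →L[ℝ] ℝ) (ξ : TangentSpace (𝓡∂ n) x) :
    pDotGradTensor g A x z p ξ = tensorHoriz g A x (extChartAt (𝓡∂ n) x x) z
      (p.comp (chartDInv x x)) (chartD x x ξ) (chartD x x (raisedVec g x p)) := by
  have hx := mem_extChartAt_source (I := 𝓡∂ n) x
  have hy := mem_interior_target hi hx
  have e0 := (extChartAt (𝓡∂ n) x).left_inv hx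
  rw [pDotGradTensor, tensorHoriz_sum]
  simp only [chartD_raisedVec]
  refine Finset.sum_congr rfl fun k _ => ?_
  congr 1
  set y := extChartAt (𝓡∂ n) x x with hydef
  have hq : flatComps (p.comp (chartDInv x x)) = comps x x p := rfl
  have hval : ∀ i j, tensorComp A x i j (y, z, comps x x p)
      = A x z p (coordVec x x i) (coordVec x x j) := by
    intro i j
    have key : ∀ x', x' = x → A x' z (covec x x' (comps x x p)) (coordVec x x' i) (coordVec x x' j)
        = A x z p (coordVec x x i) (coordVec x x j) := by
      rintro _ rfl
      congr 4
      rw [← hq, covec_flatComps]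
      ext w
      exact congrArg p (chartDInv_chartD hx w)
    exact key _ e0
  have hd1 : ∀ i j, chartDeriv x
      (fun x' => A x' z (covec x x' (comps x x p)) (coordVec x x' i) (coordVec x x' j)) k x
      = fderiv ℝ (tensorComp A x i j) (y, z, comps x x p) (EuclideanSpace.single k 1, 0, 0) := by
    intro i j
    rw [chartDeriv, fderivWithin_range_eq_fderiv hy]
    have hdiff := ((hA x i j).contDiffAt (x := (y, z, comps x x p)) (prod_mem_nhds
        (mem_interior_iff_mem_nhds.1 hy) Filter.univ_mem)).differentiableAt (by simp)
    have h := HasFDerivAt.comp (g := tensorComp A x i j) (f := fun y' => (y', z, comps x x p)) y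
      hdiff.hasFDerivAt ((hasFDerivAt_id y).prodMk (hasFDerivAt_const (z, comps x x p) y))
    exact congrArg (fun L => L (EuclideanSpace.single k 1)) h.fderiv
  have hd2 : ∀ i j l, fderiv ℝ (fun q => A x z (covec x x q) (coordVec x x i) (coordVec x x j))
      (comps x x p) (Pi.single l 1)
      = fderiv ℝ (tensorComp A x i j) (y, z, comps x x p) (0, 0, Pi.single l 1) := by
    intro i j l
    have hdiff := ((hA x i j).contDiffAt (x := (y, z, comps x x p)) (prod_mem_nhds
        (mem_interior_iff_mem_nhds.1 hy) Filter.univ_mem)).differentiableAt (by simp)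
    have h := HasFDerivAt.comp (g := tensorComp A x i j) (f := fun q' => (y, z, q')) (comps x x p)
      hdiff.hasFDerivAt ((hasFDerivAt_const y (comps x x p)).prodMk
        ((hasFDerivAt_const z (comps x x p)).prodMk (hasFDerivAt_id (comps x x p))))
    have key : ∀ x', x' = x → (fun q => A x z (covec x x q) (coordVec x x i) (coordVec x x j))
        = fun q => A x' z (covec x x' q) (coordVec x x' i) (coordVec x x' j) := by
      rintro _ rfl
      rfl
    rw [key _ e0]
    exact congrArg (fun L => L (Pi.single l 1)) h.fderiv
  have hκ : ∀ l, flatComps ((p.comp (chartDInv x x)).comp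
      (christoffelCoord g x y (EuclideanSpace.single k 1))) l
      = ∑ m, christoffel g x x m k l * comps x x p m := by
    intro l
    change p (chartDInv x x (christoffelCoord g x y _ _)) = _
    rw [apply_eq_sum_comps]
    simp only [christoffelCoord_single, e0]
  have hθ : ∀ m, (-christoffelCoord g x y (EuclideanSpace.single k 1) (chartD x x ξ)) m
      = -∑ i, christoffel g x x m k i * chartD x x ξ i := by
    intro m
    rw [PiLp.neg_apply, christoffelCoord_single_left, e0]
  rw [tensorHoriz, fderiv_tensorCoord hA hy]
  simp only [fderiv_prod_split (EuclideanSpace.single k 1) (flatComps _), hκ, hθ, hq, hval,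
    ← hd1, ← hd2, covDerivTensor, coordForm_apply]
  generalize chartD x x ξ = v
  simp only [← Finset.sum_mul]
  exact sum_contract_covariant _ _ _ _ _

theorem pDotGradScalar_eq (hψ : SmoothScalar ψ) {x : M} (hi : (𝓡∂ n).IsInteriorPoint x) (z : ℝ)
    (p : TangentSpace (𝓡∂ n) x →L[ℝ] ℝ) :
    pDotGradScalar g ψ x z p = scalarHoriz g ψ x (extChartAt (𝓡∂ n) x x) z
      (p.comp (chartDInv x x)) (chartD x x (raisedVec g x p)) := by
  have hx := mem_extChartAt_source (I := 𝓡∂ n) x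
  have hy := mem_interior_target hi hx
  have e0 := (extChartAt (𝓡∂ n) x).left_inv hx
  rw [pDotGradScalar, scalarHoriz_sum]
  simp only [chartD_raisedVec]
  refine Finset.sum_congr rfl fun k _ => ?_
  congr 1
  set y := extChartAt (𝓡∂ n) x x with hydef
  have hq : flatComps (p.comp (chartDInv x x)) = comps x x p := rfl
  let S : EuclideanSpace ℝ (Fin n) × ℝ × (Fin n → ℝ) → ℝ := fun w =>
    ψ ((extChartAt (𝓡∂ n) x).symm w.1) w.2.1 (covec x _ w.2.2)
  have hS : DifferentiableAt ℝ S (y, z, comps x x p) :=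
    ((hψ x).contDiffAt (x := (y, z, comps x x p)) (prod_mem_nhds
        (mem_interior_iff_mem_nhds.1 hy) Filter.univ_mem)).differentiableAt (by simp)
  have hd1 : chartDeriv x (fun x' => ψ x' z (covec x x' (comps x x p))) k x
      = fderiv ℝ S (y, z, comps x x p) (EuclideanSpace.single k 1, 0, 0) := by
    rw [chartDeriv, fderivWithin_range_eq_fderiv hy]
    have h := HasFDerivAt.comp (g := S) (f := fun y' => (y', z, comps x x p)) y
      hS.hasFDerivAt ((hasFDerivAt_id y).prodMk (hasFDerivAt_const (z, comps x x p) y))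
    exact congrArg (fun L => L (EuclideanSpace.single k 1)) h.fderiv
  have hd2 : ∀ l, fderiv ℝ (fun q => ψ x z (covec x x q)) (comps x x p) (Pi.single l 1)
      = fderiv ℝ S (y, z, comps x x p) (0, 0, Pi.single l 1) := by
    intro l
    have h := HasFDerivAt.comp (g := S) (f := fun q' => (y, z, q')) (comps x x p)
      hS.hasFDerivAt ((hasFDerivAt_const y (comps x x p)).prodMk
        ((hasFDerivAt_const z (comps x x p)).prodMk (hasFDerivAt_id (comps x x p))))
    have key : ∀ x', x' = x → (fun q => ψ x z (covec x x q)) = fun q => ψ x' z (covec x x' q) := by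
      rintro _ rfl
      rfl
    rw [key _ e0]
    exact congrArg (fun L => L (Pi.single l 1)) h.fderiv
  have hκ : ∀ l, flatComps ((p.comp (chartDInv x x)).comp
      (christoffelCoord g x y (EuclideanSpace.single k 1))) l
      = ∑ m, christoffel g x x m k l * comps x x p m := by
    intro l
    change p (chartDInv x x (christoffelCoord g x y _ _)) = _
    rw [apply_eq_sum_comps]
    simp only [christoffelCoord_single, e0]
  have hT : ∀ a κ, fderiv ℝ (scalarCoord ψ x) (y, z, p.comp (chartDInv x x)) (a, 0, κ)
      = fderiv ℝ S (y, z, comps x x p) (a, 0, flatComps κ) := by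
    intro a κ
    let L : (EuclideanSpace ℝ (Fin n) × ℝ × (EuclideanSpace ℝ (Fin n) →L[ℝ] ℝ)) →L[ℝ]
        EuclideanSpace ℝ (Fin n) × ℝ × (Fin n → ℝ) :=
      (ContinuousLinearMap.fst ℝ _ _).prod
        (((ContinuousLinearMap.fst ℝ _ _).comp (ContinuousLinearMap.snd ℝ _ _)).prod
          (flatComps.comp ((ContinuousLinearMap.snd ℝ _ _).comp (ContinuousLinearMap.snd ℝ _ _))))
    have e : scalarCoord ψ x = fun w => S (L w) := by
      funext w
      change ψ _ _ _ = ψ _ _ (covec x _ (flatComps w.2.2))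
      rw [covec_flatComps]
      rfl
    have h : HasFDerivAt (fun w => S (L w)) ((fderiv ℝ S (y, z, comps x x p)).comp L)
        (y, z, p.comp (chartDInv x x)) :=
      HasFDerivAt.comp (g := S) (f := L) (y, z, p.comp (chartDInv x x)) hS.hasFDerivAt L.hasFDerivAt
    rw [e, h.fderiv]
    rfl
  rw [scalarHoriz, hT, fderiv_prod_split]
  simp only [hκ, ← hd1, ← hd2, covDerivScalar, Finset.sum_mul]

end CovariantDerivatives

/-! ### Total derivatives of `A` and `ψ` along the gradient. -/

section TotalDerivatives

variable {n : ℕ} [NeZero n] {M : Type*} [TopologicalSpace M] [ChartedSpace (EuclideanHalfSpace n) M]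
  [IsManifold (𝓡∂ n) ∞ M]
  (g : Bundle.ContMDiffRiemannianMetric (𝓡∂ n) ∞ (EuclideanSpace ℝ (Fin n))
    (fun x : M => TangentSpace (𝓡∂ n) x))
  {A : (x : M) → ℝ → (TangentSpace (𝓡∂ n) x →L[ℝ] ℝ) →
    LinearMap.BilinForm ℝ (TangentSpace (𝓡∂ n) x)}
  {ψ : (x : M) → ℝ → (TangentSpace (𝓡∂ n) x →L[ℝ] ℝ) → ℝ}

theorem tensorCoord_chartD (A : (x : M) → ℝ → (TangentSpace (𝓡∂ n) x →L[ℝ] ℝ) →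
    LinearMap.BilinForm ℝ (TangentSpace (𝓡∂ n) x)) {c x : M}
    (hx : x ∈ (extChartAt (𝓡∂ n) c).source) (s : ℝ) (q : EuclideanSpace ℝ (Fin n) →L[ℝ] ℝ)
    (ξ : TangentSpace (𝓡∂ n) x) :
    tensorCoord A c (extChartAt (𝓡∂ n) c x, s, q, chartD c x ξ)
      = A x s (q.comp (chartD c x)) ξ ξ := by
  have key : ∀ x', x' = x → A x' s (q.comp (chartD c x')) (chartDInv c x' (chartD c x ξ))
      (chartDInv c x' (chartD c x ξ)) = A x s (q.comp (chartD c x)) ξ ξ := by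
    rintro _ rfl
    rw [chartDInv_chartD hx]
  exact key _ ((extChartAt (𝓡∂ n) c).left_inv hx)

omit [IsManifold (𝓡∂ n) ∞ M] in
theorem scalarCoord_chart (ψ : (x : M) → ℝ → (TangentSpace (𝓡∂ n) x →L[ℝ] ℝ) → ℝ) {c x : M}
    (hx : x ∈ (extChartAt (𝓡∂ n) c).source) (s : ℝ) (q : EuclideanSpace ℝ (Fin n) →L[ℝ] ℝ) :
    scalarCoord ψ c (extChartAt (𝓡∂ n) c x, s, q) = ψ x s (q.comp (chartD c x)) := by
  have key : ∀ x', x' = x → ψ x' s (q.comp (chartD c x')) = ψ x s (q.comp (chartD c x)) := by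
    rintro _ rfl
    rfl
  exact key _ ((extChartAt (𝓡∂ n) c).left_inv hx)

theorem comp_chartDInv_comp_chartD {c x : M} (hx : x ∈ (extChartAt (𝓡∂ n) c).source)
    (p : TangentSpace (𝓡∂ n) x →L[ℝ] ℝ) : (p.comp (chartDInv c x)).comp (chartD c x) = p := by
  ext ξ
  exact congrArg p (chartDInv_chartD hx ξ)

/-- The direction splits into the horizontal lift of the gradient, a change of `z` at rate `s`, and
a radial change of `p` at rate `τ`. These are the three kinds of derivative that the growth
conditions control. -/
theorem fderiv_tensorCoord_total (hA : SmoothTensor A) {c x : M} (hi : (𝓡∂ n).IsInteriorPoint x)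
    (hx : x ∈ (extChartAt (𝓡∂ n) c).source) (z : ℝ) (p : TangentSpace (𝓡∂ n) x →L[ℝ] ℝ)
    (ξ : TangentSpace (𝓡∂ n) x) (s τ : ℝ) :
    fderiv ℝ (tensorCoord A c)
        (extChartAt (𝓡∂ n) c x, z, p.comp (chartDInv c x), chartD c x ξ)
        (chartD c x (raisedVec g x p), s,
          τ • p.comp (chartDInv c x) + (p.comp (chartDInv c x)).comp
            (christoffelCoord g c (extChartAt (𝓡∂ n) c x) (chartD c x (raisedVec g x p))),
          -christoffelCoord g c (extChartAt (𝓡∂ n) c x) (chartD c x (raisedVec g x p))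
            (chartD c x ξ))
      = pDotGradTensor g A x z p ξ + s * deriv (fun s => A x s p ξ ξ) z
        + τ * deriv (fun t : ℝ => A x z (t • p) ξ ξ) 1 := by
  have hd := (differentiableAt_tensorCoord hA (mem_interior_target hi hx) z
    (p.comp (chartDInv c x)) (chartD c x ξ)).hasFDerivAt
  have hz : deriv (fun s => A x s p ξ ξ) z = fderiv ℝ (tensorCoord A c)
      (extChartAt (𝓡∂ n) c x, z, p.comp (chartDInv c x), chartD c x ξ) (0, 1, 0, 0) := by
    have h := HasFDerivAt.comp_hasDerivAt (l := tensorCoord A c) z hd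
      ((hasDerivAt_const z (extChartAt (𝓡∂ n) c x)).prodMk ((hasDerivAt_id z).prodMk
        ((hasDerivAt_const z (p.comp (chartDInv c x))).prodMk
          (hasDerivAt_const z (chartD c x ξ)))))
    have e : (fun s => A x s p ξ ξ) = fun s => tensorCoord A c
        (extChartAt (𝓡∂ n) c x, s, p.comp (chartDInv c x), chartD c x ξ) := by
      funext s
      rw [tensorCoord_chartD A hx, comp_chartDInv_comp_chartD hx]
    rw [e]
    exact h.deriv
  have hr : deriv (fun t : ℝ => A x z (t • p) ξ ξ) 1 = fderiv ℝ (tensorCoord A c)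
      (extChartAt (𝓡∂ n) c x, z, p.comp (chartDInv c x), chartD c x ξ)
      (0, 0, p.comp (chartDInv c x), 0) := by
    have hs : HasDerivAt (fun t : ℝ => t • p.comp (chartDInv c x)) (p.comp (chartDInv c x)) 1 := by
      simpa using (hasDerivAt_id (1 : ℝ)).smul_const (p.comp (chartDInv c x))
    have hd' : HasFDerivAt (tensorCoord A c) (fderiv ℝ (tensorCoord A c)
        (extChartAt (𝓡∂ n) c x, z, p.comp (chartDInv c x), chartD c x ξ))
        (extChartAt (𝓡∂ n) c x, z, (1 : ℝ) • p.comp (chartDInv c x), chartD c x ξ) := by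
      rw [one_smul]; exact hd
    have h := HasFDerivAt.comp_hasDerivAt (l := tensorCoord A c) (1 : ℝ) hd'
      ((hasDerivAt_const (1 : ℝ) (extChartAt (𝓡∂ n) c x)).prodMk
        ((hasDerivAt_const (1 : ℝ) z).prodMk
        (hs.prodMk (hasDerivAt_const (1 : ℝ) (chartD c x ξ)))))
    have e : (fun t : ℝ => A x z (t • p) ξ ξ) = fun t => tensorCoord A c
        (extChartAt (𝓡∂ n) c x, z, t • p.comp (chartDInv c x), chartD c x ξ) := by
      funext t
      rw [tensorCoord_chartD A hx, ContinuousLinearMap.smul_comp, comp_chartDInv_comp_chartD hx]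
    rw [e]
    exact h.deriv
  rw [pDotGradTensor_eq g hA hi, tensorHoriz_transform g hA hi
    (mem_extChartAt_source (I := 𝓡∂ n) x) hx, hz, hr, tensorHoriz, ← smul_eq_mul, ← smul_eq_mul,
    ← map_smul, ← map_smul, ← map_add, ← map_add]
  congr 1
  simp [add_comm]

theorem fderiv_scalarCoord_total (hψ : SmoothScalar ψ) {c x : M} (hi : (𝓡∂ n).IsInteriorPoint x)
    (hx : x ∈ (extChartAt (𝓡∂ n) c).source) (z : ℝ) (p : TangentSpace (𝓡∂ n) x →L[ℝ] ℝ) (s τ : ℝ) :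
    fderiv ℝ (scalarCoord ψ c) (extChartAt (𝓡∂ n) c x, z, p.comp (chartDInv c x))
        (chartD c x (raisedVec g x p), s,
          τ • p.comp (chartDInv c x) + (p.comp (chartDInv c x)).comp
            (christoffelCoord g c (extChartAt (𝓡∂ n) c x) (chartD c x (raisedVec g x p))))
      = pDotGradScalar g ψ x z p + s * deriv (fun s => ψ x s p) z
        + τ * deriv (fun t : ℝ => ψ x z (t • p)) 1 := by
  have hd := (differentiableAt_scalarCoord hψ (mem_interior_target hi hx) z
    (p.comp (chartDInv c x))).hasFDerivAt
  have hz : deriv (fun s => ψ x s p) z = fderiv ℝ (scalarCoord ψ c)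
      (extChartAt (𝓡∂ n) c x, z, p.comp (chartDInv c x)) (0, 1, 0) := by
    have h := HasFDerivAt.comp_hasDerivAt (l := scalarCoord ψ c) z hd
      ((hasDerivAt_const z (extChartAt (𝓡∂ n) c x)).prodMk ((hasDerivAt_id z).prodMk
        (hasDerivAt_const z (p.comp (chartDInv c x)))))
    have e : (fun s => ψ x s p) = fun s => scalarCoord ψ c
        (extChartAt (𝓡∂ n) c x, s, p.comp (chartDInv c x)) := by
      funext s
      rw [scalarCoord_chart ψ hx, comp_chartDInv_comp_chartD hx]
    rw [e]
    exact h.deriv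
  have hr : deriv (fun t : ℝ => ψ x z (t • p)) 1 = fderiv ℝ (scalarCoord ψ c)
      (extChartAt (𝓡∂ n) c x, z, p.comp (chartDInv c x)) (0, 0, p.comp (chartDInv c x)) := by
    have hs : HasDerivAt (fun t : ℝ => t • p.comp (chartDInv c x)) (p.comp (chartDInv c x)) 1 := by
      simpa using (hasDerivAt_id (1 : ℝ)).smul_const (p.comp (chartDInv c x))
    have hd' : HasFDerivAt (scalarCoord ψ c) (fderiv ℝ (scalarCoord ψ c)
        (extChartAt (𝓡∂ n) c x, z, p.comp (chartDInv c x)))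
        (extChartAt (𝓡∂ n) c x, z, (1 : ℝ) • p.comp (chartDInv c x)) := by
      rw [one_smul]; exact hd
    have h := HasFDerivAt.comp_hasDerivAt (l := scalarCoord ψ c) (1 : ℝ) hd'
      ((hasDerivAt_const (1 : ℝ) (extChartAt (𝓡∂ n) c x)).prodMk
        ((hasDerivAt_const (1 : ℝ) z).prodMk hs))
    have e : (fun t : ℝ => ψ x z (t • p)) = fun t => scalarCoord ψ c
        (extChartAt (𝓡∂ n) c x, z, t • p.comp (chartDInv c x)) := by
      funext t
      rw [scalarCoord_chart ψ hx, ContinuousLinearMap.smul_comp, comp_chartDInv_comp_chartD hx]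
    rw [e]
    exact h.deriv
  rw [pDotGradScalar_eq g hψ hi, scalarHoriz_transform g hψ hi
    (mem_extChartAt_source (I := 𝓡∂ n) x) hx, hz, hr, scalarHoriz, ← smul_eq_mul, ← smul_eq_mul,
    ← map_smul, ← map_smul, ← map_add, ← map_add]
  congr 1
  simp [add_comm]

end TotalDerivatives

/-! ### The differential inequality at an interior maximum. -/

section InteriorMaximum

variable {n : ℕ} [NeZero n] {M : Type*} [TopologicalSpace M] [ChartedSpace (EuclideanHalfSpace n) M]
  [IsManifold (𝓡∂ n) ∞ M]
  (g : Bundle.ContMDiffRiemannianMetric (𝓡∂ n) ∞ (EuclideanSpace ℝ (Fin n))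
    (fun x : M => TangentSpace (𝓡∂ n) x))
  {A : (x : M) → ℝ → (TangentSpace (𝓡∂ n) x →L[ℝ] ℝ) →
    LinearMap.BilinForm ℝ (TangentSpace (𝓡∂ n) x)}
  {ψ : (x : M) → ℝ → (TangentSpace (𝓡∂ n) x →L[ℝ] ℝ) → ℝ}

theorem eq_sum_inner_smul {x : M} {e : Fin n → TangentSpace (𝓡∂ n) x}
    (he : ∀ i j, g.inner x (e i) (e j) = if i = j then 1 else 0) (v : TangentSpace (𝓡∂ n) x) :
    v = ∑ j, g.inner x v (e j) • e j := by
  have hx := mem_extChartAt_source (I := 𝓡∂ n) x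
  have h := eq_sum_of_orthonormal (n := n) (finrank_euclideanSpace_fin (𝕜 := ℝ) (n := n))
    (LinearMap.mk₂ ℝ (fun a b => metricCoord g x (extChartAt (𝓡∂ n) x x) a b)
      (by simp) (by simp) (by simp) (by simp)) (e := fun i => chartD x x (e i))
    (fun i j => by rw [← he i j]; exact metricCoord_chartD g hx _ _) (chartD x x v)
  change chartD x x v = ∑ j, metricCoord g x (extChartAt (𝓡∂ n) x x) (chartD x x v)
    (chartD x x (e j)) • chartD x x (e j) at h
  simp only [metricCoord_chartD g hx] at h
  have h' := congrArg (chartDInv x x) h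
  simpa only [map_sum, map_smul, chartDInv_chartD hx] using h'

/-- The tensor `A[u]` in the chart at `c`. -/
def tensorForm (A : (x : M) → ℝ → (TangentSpace (𝓡∂ n) x →L[ℝ] ℝ) →
    LinearMap.BilinForm ℝ (TangentSpace (𝓡∂ n) x)) (c : M) (u : EuclideanSpace ℝ (Fin n) → ℝ)
    (y : EuclideanSpace ℝ (Fin n)) : LinearMap.BilinForm ℝ (EuclideanSpace ℝ (Fin n)) :=
  (A ((extChartAt (𝓡∂ n) c).symm y) (u y) ((fderiv ℝ u y).comp (chartD c _))).compl₁₂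
    (chartDInv (n := n) c ((extChartAt (𝓡∂ n) c).symm y)).toLinearMap
    (chartDInv (n := n) c ((extChartAt (𝓡∂ n) c).symm y)).toLinearMap

theorem fderiv_comp_chartD {u : M → ℝ} {c x : M} (hi : (𝓡∂ n).IsInteriorPoint x)
    (hx : x ∈ (extChartAt (𝓡∂ n) c).source) (hu : ContMDiff (𝓡∂ n) 𝓘(ℝ, ℝ) 1 u) :
    (fderiv ℝ (fun z => u ((extChartAt (𝓡∂ n) c).symm z)) (extChartAt (𝓡∂ n) c x)).comp
      (chartD c x) = diff u x := by
  ext ξ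
  exact (diff_eq_fderiv hi hx hu.contMDiffAt ξ).symm

theorem fderiv_eq_diff_comp {u : M → ℝ} {c x : M} (hi : (𝓡∂ n).IsInteriorPoint x)
    (hx : x ∈ (extChartAt (𝓡∂ n) c).source) (hu : ContMDiff (𝓡∂ n) 𝓘(ℝ, ℝ) 1 u) :
    fderiv ℝ (fun z => u ((extChartAt (𝓡∂ n) c).symm z)) (extChartAt (𝓡∂ n) c x)
      = (diff u x).comp (chartDInv c x) := by
  ext v
  have h := diff_eq_fderiv hi hx hu.contMDiffAt (chartDInv c x v)
  rw [chartD_chartDInv hx] at h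
  exact h.symm

theorem tensorForm_chartD {u : M → ℝ} {c x : M} (hi : (𝓡∂ n).IsInteriorPoint x)
    (hx : x ∈ (extChartAt (𝓡∂ n) c).source) (hu : ContMDiff (𝓡∂ n) 𝓘(ℝ, ℝ) 1 u)
    (ξ η : TangentSpace (𝓡∂ n) x) :
    tensorForm A c (fun z => u ((extChartAt (𝓡∂ n) c).symm z)) (extChartAt (𝓡∂ n) c x)
      (chartD c x ξ) (chartD c x η) = A x (u x) (diff u x) ξ η := by
  have key : ∀ x', x' = x → A x' (u x')
      ((fderiv ℝ (fun z => u ((extChartAt (𝓡∂ n) c).symm z)) (extChartAt (𝓡∂ n) c x)).comp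
        (chartD c x')) (chartDInv c x' (chartD c x ξ)) (chartDInv c x' (chartD c x η))
      = A x (u x) (diff u x) ξ η := by
    rintro _ rfl
    rw [chartDInv_chartD hx, chartDInv_chartD hx, fderiv_comp_chartD hi hx hu]
  exact key _ ((extChartAt (𝓡∂ n) c).left_inv hx)

/-- The first and second order conditions at an interior maximum of `|∇u|⁴ / (κ - u)`, combined with
the commutation of covariant derivatives and with the differentiated equation. -/
theorem interior_maximum_conditions {cone : Set (Fin n → ℝ)} {f : (Fin n → ℝ) → ℝ}
    (hc : IsSymmetricCone cone) (hf : IsStructureFunction cone f)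
    (hA : SmoothTensor A) (hψ : SmoothScalar ψ) {u : M → ℝ} (hu : ContMDiff (𝓡∂ n) 𝓘(ℝ, ℝ) 3 u)
    (hadm : IsAdmissibleSolution g cone f A ψ u) {c x : M} (hi : (𝓡∂ n).IsInteriorPoint x)
    (hx : x ∈ (extChartAt (𝓡∂ n) c).source) {κ : ℝ} (hκ : ∀ x', u x' < κ)
    (hW : 0 < gradNorm g u x)
    (hmax : ∀ x', gradNorm g u x' ^ 4 / (κ - u x') ≤ gradNorm g u x ^ 4 / (κ - u x))
    {C : ℝ} (hC : ∀ v, |fderiv ℝ (fun z => u ((extChartAt (𝓡∂ n) c).symm z))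
      (extChartAt (𝓡∂ n) c x) (curvatureVec (christoffelCoord g c) (extChartAt (𝓡∂ n) c x) v
        (gradCoord g c u (extChartAt (𝓡∂ n) c x)))|
      ≤ C * gradNorm g u x ^ 2 * metricCoord g c (extChartAt (𝓡∂ n) c x) v v) :
    ∃ (e : Fin n → TangentSpace (𝓡∂ n) x) (l : Fin n → ℝ),
      (∀ i j, g.inner x (e i) (e j) = if i = j then 1 else 0) ∧ l ∈ cone ∧
      f l = ψ x (u x) (diff u x) ∧
      (∀ i, l i * diff u x (e i) = -(gradNorm g u x ^ 2 / (4 * (κ - u x))) * diff u x (e i)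
        + ∑ j, diff u x (e j) * A x (u x) (diff u x) (e i) (e j)) ∧
      (pDotGradScalar g ψ x (u x) (diff u x)
          + gradNorm g u x ^ 2 * deriv (fun s => ψ x s (diff u x)) (u x)
          - gradNorm g u x ^ 2 / (4 * (κ - u x)) * deriv (fun t : ℝ => ψ x (u x) (t • diff u x)) 1)
        + ∑ i, partialF f i l * (
          -(pDotGradTensor g A x (u x) (diff u x) (e i)
            + gradNorm g u x ^ 2 * deriv (fun s => A x s (diff u x) (e i) (e i)) (u x)
            - gradNorm g u x ^ 2 / (4 * (κ - u x))
              * deriv (fun t : ℝ => A x (u x) (t • diff u x) (e i) (e i)) 1)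
          - C * gradNorm g u x ^ 2
          + gradNorm g u x ^ 2 / (4 * (κ - u x)) * (l i - A x (u x) (diff u x) (e i) (e i))
          + gradNorm g u x ^ 2 / (8 * (κ - u x) ^ 2) * diff u x (e i) ^ 2) ≤ 0 := by
  have hu1 : ContMDiff (𝓡∂ n) 𝓘(ℝ, ℝ) 1 u := hu.of_le (by norm_num)
  have h3 : (3 : WithTop ℕ∞) ≤ ∞ := WithTop.coe_le_coe.2 le_top
  have hy := mem_interior_target hi hx
  have hyt := interior_subset hy
  have e0 := (extChartAt (𝓡∂ n) c).left_inv hx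
  set y := extChartAt (𝓡∂ n) c x with hydef
  have hyn : (extChartAt (𝓡∂ n) c).target ∈ nhds y := mem_interior_iff_mem_nhds.1 hy
  have hev : ∀ᶠ z in nhds y, z ∈ interior (extChartAt (𝓡∂ n) c).target :=
    isOpen_interior.mem_nhds hy
  set w := fun z => u ((extChartAt (𝓡∂ n) c).symm z) with hw
  set Γ := christoffelCoord g c with hΓdef
  set G := metricCoord g c with hGdef
  set X := gradCoord g c u with hX
  have hwy : w y = u x := congrArg u e0
  have hwd : ContDiffAt ℝ 3 w y := contDiffAt_comp_symm h3 hy hu.contMDiffAt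
  have hGd : ContDiffAt ℝ ∞ G y := (contDiffOn_metricCoord g c).contDiffAt hyn
  have hΓd : ContDiffAt ℝ ∞ Γ y := (contDiffOn_christoffelCoord g c).contDiffAt hyn
  have hXd : ContDiffAt ℝ 1 X y :=
    (contDiffOn_gradCoord g (k := 3) (by norm_num) (WithTop.coe_le_coe.2 le_top) h3 hu c).contDiffAt
      hyn
  have hGs : ∀ᶠ z in nhds y, ∀ v w, G z v w = G z w v :=
    Filter.Eventually.of_forall fun z v w => metricCoord_symm g v w
  have hcompat : ∀ᶠ z in nhds y, ∀ a v w,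
      fderiv ℝ G z a v w = G z (Γ z a v) w + G z v (Γ z a w) := by
    filter_upwards [hev] with z hz
    exact (isChristoffelAt_christoffelCoord g hz).compat (metricCoord_differentiableAt g hz)
      (Filter.Eventually.of_forall fun z v w => metricCoord_symm g v w)
  have hgrad : ∀ᶠ z in nhds y, G z (X z) = fderiv ℝ w z := by
    filter_upwards [hev] with z hz
    ext a
    rw [← fderivWithin_range_eq_fderiv hz]
    exact metricCoord_gradCoord g (interior_subset hz) u a
  have hWz : ∀ z ∈ interior (extChartAt (𝓡∂ n) c).target,
      fderiv ℝ w z (X z) = gradNorm g u ((extChartAt (𝓡∂ n) c).symm z) ^ 2 := by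
    intro z hz
    have hzt := interior_subset hz
    rw [gradNorm_sq g hu1 ((extChartAt (𝓡∂ n) c).map_target hzt),
      (extChartAt (𝓡∂ n) c).right_inv hzt, metricCoord_gradCoord g hzt,
      fderivWithin_range_eq_fderiv hz]
  have hWy : fderiv ℝ w y (X y) = gradNorm g u x ^ 2 := by rw [hWz y hy, e0]
  have hm : 0 < κ - u x := sub_pos.2 (hκ x)
  have hlocmax : IsLocalMax
      (fun z => Real.log (fderiv ℝ w z (X z)) - 1 / 2 * Real.log (κ - w z)) y := by
    have hcont : ContinuousAt (fun z => gradNorm g u ((extChartAt (𝓡∂ n) c).symm z)) y :=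
      (continuous_gradNorm g hu1).continuousAt.comp (continuousAt_extChartAt_symm' hx)
    have hpos : ∀ᶠ z in nhds y, 0 < gradNorm g u ((extChartAt (𝓡∂ n) c).symm z) :=
      hcont.eventually (lt_mem_nhds (by simp only [e0]; exact hW))
    filter_upwards [hev, hpos] with z hz hzpos
    -- The logarithmic function of the coordinate lemma is half the logarithm of `r⁴ / m`, so both
    -- have the same local maxima where `r > 0`.
    have hlog : ∀ r m : ℝ, 0 < r → 0 < m →
        Real.log (r ^ 2) - 1 / 2 * Real.log m = 1 / 2 * Real.log (r ^ 4 / m) := by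
      intro r m hr hm
      rw [Real.log_div (by positivity) hm.ne', Real.log_pow, Real.log_pow]
      push_cast
      ring
    have hmz : 0 < κ - w z := sub_pos.2 (hκ _)
    rw [hWz z hz, hWy, hlog _ _ hzpos hmz, hwy, hlog _ _ hW hm]
    have := Real.log_le_log (by positivity) (hmax ((extChartAt (𝓡∂ n) c).symm z))
    linarith
  obtain ⟨hfirst, hsecond⟩ := maximum_conditions hwd (hGd.of_le (WithTop.coe_le_coe.2 le_top)) hXd
    (hΓd.differentiableAt (by simp)) hGs
    (fun v => by
      by_cases hv : v = 0
      · simp [hv]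
      · exact (metricCoord_pos g hyt hv).le) hcompat hgrad
    (by rw [hWy]; positivity) (by rw [hwy]; exact hκ x) hlocmax
  rw [hWy, hwy] at hfirst hsecond
  obtain ⟨l, ⟨e, he, hel⟩, hl, hfl⟩ := hadm x
  set p : TangentSpace (𝓡∂ n) x →L[ℝ] ℝ := diff u x with hp
  have hRX : chartD c x (raisedVec g x p) = X y := chartD_raisedVec_diff g hu1 hx
  have hdw : fderiv ℝ w y = p.comp (chartDInv c x) := fderiv_eq_diff_comp hi hx hu1
  have hdwe : ∀ ξ, fderiv ℝ w y (chartD c x ξ) = p ξ := fun ξ => (diff_eq_fderiv hi hx hu1.contMDiffAt ξ).symm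
  have hHess : ∀ ξ η, covHess w Γ y (chartD c x ξ) (chartD c x η) = hess g u x ξ η :=
    fun ξ η => (hess_eq_covHess g hi hx (hu.of_le (by norm_num)).contMDiffAt ξ η).symm
  have hHs : ∀ a b, covHess w Γ y a b = covHess w Γ y b a :=
    covHess_symm (hwd.of_le (by norm_num)) (christoffelCoord_symm g c y)
  -- the differentiated equation
  have hdiffeq := differentiated_equation hc hf (by simp) (x := X y) (e := fun i => chartD c x (e i))
    hwd (hGd.differentiableAt (by simp)) (hΓd.differentiableAt (by simp)) hGs hcompat.self_of_nhds
    (B := tensorForm A c w) (T := tensorCoord A c) (P := scalarCoord ψ c) (l := l)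
    (Filter.Eventually.of_forall fun z v => rfl)
    (fun v => differentiableAt_tensorCoord hA hy _ _ v) (differentiableAt_scalarCoord hψ hy _ _)
    (by
      filter_upwards [hev] with z hz
      have hzt := interior_subset hz
      have hzs := (extChartAt (𝓡∂ n) c).map_target hzt
      have hzi := isInteriorPoint_symm hz
      have ez := (extChartAt (𝓡∂ n) c).right_inv hzt
      obtain ⟨l', ⟨e', he', hel'⟩, hl', hfl'⟩ := hadm ((extChartAt (𝓡∂ n) c).symm z)
      refine ⟨fun i => chartD c _ (e' i), l', fun i j => ?_, fun i j => ?_, hl', ?_⟩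
      · rw [← he', ← metricCoord_chartD g hzs, ez]
      · rw [← hel']
        simp only
        rw [hess_eq_covHess g hzi hzs (hu.of_le (by norm_num)).contMDiffAt,
          ← tensorForm_chartD hzi hzs hu1, ez]
      · rw [hfl', ← fderiv_comp_chartD hzi hzs hu1, ez]
        rfl)
    (fun i j => by rw [← he i j]; exact metricCoord_chartD g hx _ _)
    (fun i => by
      
      have h := hel i i
      rw [if_pos rfl] at h
      rw [hHess, tensorForm_chartD hi hx hu1, ← h]) hl
    (by rw [hfl, hdw, hwy, scalarCoord_chart ψ hx, comp_chartDInv_comp_chartD hx])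
  -- The Hessian along the gradient is a multiple of `du` by the first order condition, so `du`
  -- varies along `∇u` by a radial part and a horizontal part only.
  have hD2 : fderiv ℝ (fderiv ℝ w) y (X y) = (-(gradNorm g u x ^ 2 / (4 * (κ - u x)))) • fderiv ℝ w y
      + (fderiv ℝ w y).comp (Γ y (X y)) := by
    ext a
    have := covHess_apply w Γ y (X y) a
    rw [hHs, hfirst] at this
    simp only [add_apply, smul_apply, smul_eq_mul, ContinuousLinearMap.comp_apply]
    linarith
  rw [hD2, hWy, hwy, hdw, ← hRX, fderiv_scalarCoord_total g hψ hi hx] at hdiffeq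
  have hTi : ∀ i, fderiv ℝ (tensorCoord A c) (y, u x, p.comp (chartDInv c x), chartD c x (e i))
      (chartD c x (raisedVec g x p), gradNorm g u x ^ 2,
        -(gradNorm g u x ^ 2 / (4 * (κ - u x))) • p.comp (chartDInv c x)
          + (p.comp (chartDInv c x)).comp (Γ y (chartD c x (raisedVec g x p))),
        -Γ y (chartD c x (raisedVec g x p)) (chartD c x (e i)))
      = pDotGradTensor g A x (u x) p (e i)
        + gradNorm g u x ^ 2 * deriv (fun s => A x s p (e i) (e i)) (u x)
        + -(gradNorm g u x ^ 2 / (4 * (κ - u x)))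
          * deriv (fun t : ℝ => A x (u x) (t • p) (e i) (e i)) 1 :=
    fun i => fderiv_tensorCoord_total g hA hi hx (u x) p (e i) _ _
  simp only [hTi] at hdiffeq
  rw [hRX] at hdiffeq
  refine ⟨e, l, he, hl, hfl, fun i => ?_, ?_⟩
  -- Testing the first order condition on the eigenvectors and replacing `∇²u` by the diagonal form
  -- minus `A` gives the relation between `l i` and the components of `p`.
  · have hR : raisedVec g x p = ∑ j, p (e j) • e j := by
      have h := eq_sum_inner_smul g he (raisedVec g x p)
      simpa only [inner_raisedVec] using h
    have h1 := hfirst (chartD c x (e i))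
    rw [← hRX, hR, hdwe] at h1
    simp only [map_sum, map_smul, smul_eq_mul, hHess] at h1
    have h2 : ∀ j, p (e j) * hess g u x (e i) (e j)
        = p (e j) * (if i = j then l i else 0) - p (e j) * A x (u x) p (e i) (e j) := fun j => by
      rw [← mul_sub, ← eq_sub_of_add_eq (hel i j)]
    simp only [h2, Finset.sum_sub_distrib, mul_ite, mul_zero, Finset.sum_ite_eq,
      Finset.mem_univ, if_true] at h1
    linarith
  -- The second order condition on `e i`, multiplied by `|∇u|²`. Commutation puts the third
  -- derivative in the order of the differentiated equation, at the cost of the curvature term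
  -- bounded by `C |∇u|²`.
  · have hterm : ∀ i, covHessDeriv w Γ y (X y) (chartD c x (e i)) (chartD c x (e i))
        + (-(C * gradNorm g u x ^ 2)
          + gradNorm g u x ^ 2 / (4 * (κ - u x)) * (l i - A x (u x) p (e i) (e i))
          + gradNorm g u x ^ 2 / (8 * (κ - u x) ^ 2) * p (e i) ^ 2) ≤ 0 := by
      intro i
      have h1 := hsecond (chartD c x (e i))
      have h2 := covHessDeriv_comm hwd (hΓd.differentiableAt (by simp)) (christoffelCoord_symm g c y)
        (chartD c x (e i)) (X y)
      have h3 := hC (chartD c x (e i))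
      rw [metricCoord_chartD g hx, he, if_pos rfl, mul_one] at h3
      have h4 := (abs_le.1 h3).1
      have h5 : hess g u x (e i) (e i) = l i - A x (u x) p (e i) (e i) := by
        have h := hel i i
        rw [if_pos rfl] at h
        exact eq_sub_of_add_eq h
      rw [hHess, h5, hdwe] at h1
      have hW2 : 0 < gradNorm g u x ^ 2 := by positivity
      have h6 := mul_nonpos_of_nonneg_of_nonpos hW2.le h1
      have h7 : gradNorm g u x ^ 2 * (covHessDeriv w Γ y (chartD c x (e i)) (chartD c x (e i)) (X y)
          / gradNorm g u x ^ 2 + (l i - A x (u x) p (e i) (e i)) / (4 * (κ - u x))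
          + p (e i) ^ 2 / (8 * (κ - u x) ^ 2))
          = covHessDeriv w Γ y (chartD c x (e i)) (chartD c x (e i)) (X y)
            + gradNorm g u x ^ 2 / (4 * (κ - u x)) * (l i - A x (u x) p (e i) (e i))
            + gradNorm g u x ^ 2 / (8 * (κ - u x) ^ 2) * p (e i) ^ 2 := by
        field_simp
      rw [h7, h2] at h6
      linarith
    have hsum := Finset.sum_nonpos fun i (_ : i ∈ Finset.univ) =>
      mul_nonpos_of_nonneg_of_nonpos (hf.partial_pos l hl i).le (hterm i)
    refine le_trans (le_of_eq ?_) hsum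
    rw [sub_eq_add_neg, ← neg_mul, ← hdiffeq, ← Finset.sum_add_distrib]
    refine Finset.sum_congr rfl fun i _ => ?_
    ring

end InteriorMaximum

/-- Compactness turns local bounds into a global one: the constants are combined by maxima, which
monotonicity of `P` in the constant permits. -/
theorem exists_uniform_const {M : Type*} [TopologicalSpace M] [CompactSpace M] {P : M → ℝ → Prop}
    (hmono : ∀ x C C', C ≤ C' → P x C → P x C') (hloc : ∀ x, ∃ C, ∀ᶠ x' in nhds x, P x' C) :
    ∃ C, ∀ x, P x C := by
  have h := isCompact_univ.induction_on (X := M) (p := fun s => ∃ C, ∀ x ∈ s, P x C)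
    ⟨0, fun x hx => hx.elim⟩ (fun s t hst ⟨C, hC⟩ => ⟨C, fun x hx => hC x (hst hx)⟩)
    (fun s t ⟨C, hC⟩ ⟨C', hC'⟩ => ⟨max C C', fun x hx => hx.elim
      (fun h => hmono x _ _ (le_max_left _ _) (hC x h))
      fun h => hmono x _ _ (le_max_right _ _) (hC' x h)⟩)
    (fun x _ => by
      obtain ⟨C, hC⟩ := hloc x
      exact ⟨_, mem_nhdsWithin_of_mem_nhds hC, C, fun x' hx' => hx'⟩)
  obtain ⟨C, hC⟩ := h
  exact ⟨C, fun x => hC x trivial⟩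

theorem exists_norm_bound {E F : Type*} [TopologicalSpace E] [NormedAddCommGroup F] {Y : Set E}
    (hY : IsCompact Y) {h : E → F} (hh : ContinuousOn h Y) : ∃ B : ℝ, ∀ y ∈ Y, ‖h y‖ ≤ B :=
  hY.exists_bound_of_continuousOn hh

set_option maxSynthPendingDepth 3 in
theorem norm_curvatureVec_le {E : Type*} [NormedAddCommGroup E] [NormedSpace ℝ E]
    {Γ : E → E →L[ℝ] E →L[ℝ] E} {y : E} {B₁ B₂ : ℝ} (b₁ : ‖Γ y‖ ≤ B₁) (b₂ : ‖fderiv ℝ Γ y‖ ≤ B₂)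
    (v x : E) : ‖curvatureVec Γ y v x‖ ≤ (2 * B₂ + 2 * B₁ ^ 2) * ‖v‖ ^ 2 * ‖x‖ := by
  have hB₁ : 0 ≤ B₁ := (norm_nonneg _).trans b₁
  have hΓ : ∀ p q, ‖Γ y p q‖ ≤ B₁ * ‖p‖ * ‖q‖ := fun p q =>
    ((Γ y).le_opNorm₂ p q).trans (by gcongr)
  have hD : ∀ p q r, ‖fderiv ℝ Γ y p q r‖ ≤ B₂ * ‖p‖ * ‖q‖ * ‖r‖ :=
    fun p q r => ((fderiv ℝ Γ y p).le_opNorm₂ q r).trans (by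
      gcongr
      exact (ContinuousLinearMap.le_opNorm _ _).trans (by gcongr))
  rw [curvatureVec]
  have h1 := hD x v v
  have h2 := hD v v x
  have h3 : ‖Γ y x (Γ y v v)‖ ≤ B₁ * ‖x‖ * (B₁ * ‖v‖ * ‖v‖) :=
    (hΓ _ _).trans (by gcongr; exact hΓ _ _)
  have h4 : ‖Γ y v (Γ y v x)‖ ≤ B₁ * ‖v‖ * (B₁ * ‖v‖ * ‖x‖) :=
    (hΓ _ _).trans (by gcongr; exact hΓ _ _)
  refine (norm_sub_le _ _).trans ?_
  refine (add_le_add ((norm_add_le _ _).trans (add_le_add ((norm_sub_le _ _).trans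
    (add_le_add h1 h2)) h3)) h4).trans (le_of_eq ?_)
  ring

/-! ### Uniform bounds from compactness and from concavity. -/

section LocalBounds

variable {n : ℕ} [NeZero n] {M : Type*} [TopologicalSpace M] [ChartedSpace (EuclideanHalfSpace n) M]

theorem exists_compact_chart_nhds [T2Space M] [CompactSpace M] (c : M) :
    ∃ Y : Set (EuclideanSpace ℝ (Fin n)), IsCompact Y ∧ Y ⊆ (extChartAt (𝓡∂ n) c).target ∧
      ∀ᶠ x in nhds c, x ∈ (extChartAt (𝓡∂ n) c).source ∧ extChartAt (𝓡∂ n) c x ∈ Y := by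
  obtain ⟨N, hN, hNs, hNc⟩ := local_compact_nhds (extChartAt_source_mem_nhds (I := 𝓡∂ n) c)
  refine ⟨extChartAt (𝓡∂ n) c '' N, hNc.image_of_continuousOn ((continuousOn_extChartAt c).mono hNs),
    ?_, ?_⟩
  · rintro _ ⟨x, hx, rfl⟩
    exact (extChartAt (𝓡∂ n) c).map_source (hNs hx)
  · filter_upwards [hN] with x hx
    exact ⟨hNs hx, Set.mem_image_of_mem _ hx⟩

variable [IsManifold (𝓡∂ n) ∞ M]
  (g : Bundle.ContMDiffRiemannianMetric (𝓡∂ n) ∞ (EuclideanSpace ℝ (Fin n))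
    (fun x : M => TangentSpace (𝓡∂ n) x))
  {A : (x : M) → ℝ → (TangentSpace (𝓡∂ n) x →L[ℝ] ℝ) →
    LinearMap.BilinForm ℝ (TangentSpace (𝓡∂ n) x)}

theorem exists_metricCoord_lower_bound {c : M} {Y : Set (EuclideanSpace ℝ (Fin n))}
    (hY : IsCompact Y) (hYt : Y ⊆ (extChartAt (𝓡∂ n) c).target) :
    ∃ a : ℝ, 0 < a ∧ ∀ y ∈ Y, ∀ v, a * ‖v‖ ^ 2 ≤ metricCoord g c y v v := by
  have hcont : ContinuousOn (fun w : EuclideanSpace ℝ (Fin n) × EuclideanSpace ℝ (Fin n) =>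
      metricCoord g c w.1 w.2 w.2) (Y ×ˢ Metric.sphere 0 1) := by
    have h1 : ContinuousOn (fun w : EuclideanSpace ℝ (Fin n) × EuclideanSpace ℝ (Fin n) =>
        metricCoord g c w.1) (Y ×ˢ Metric.sphere 0 1) :=
      ((contDiffOn_metricCoord g c).continuousOn.mono hYt).comp continuousOn_fst fun w hw => hw.1
    exact (h1.clm_apply continuousOn_snd).clm_apply continuousOn_snd
  obtain ⟨a, ha, h⟩ := (hY.prod (isCompact_sphere 0 1)).exists_forall_le' hcont (a := 0)
    fun w hw => metricCoord_pos g (hYt hw.1) (ne_zero_of_mem_unit_sphere ⟨w.2, hw.2⟩)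
  refine ⟨a, ha, fun y hy v => ?_⟩
  by_cases hv : v = 0
  · simp [hv]
  have hn : 0 < ‖v‖ := norm_pos_iff.2 hv
  have h1 := h (y, ‖v‖⁻¹ • v) ⟨hy, by simp [norm_smul, hn.ne']⟩
  simp only [map_smul, smul_apply, smul_eq_mul] at h1
  calc a * ‖v‖ ^ 2 ≤ ‖v‖⁻¹ * (‖v‖⁻¹ * metricCoord g c y v v) * ‖v‖ ^ 2 := by gcongr
    _ = metricCoord g c y v v := by field_simp

theorem exists_metricCoord_upper_bound {c : M} {Y : Set (EuclideanSpace ℝ (Fin n))}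
    (hY : IsCompact Y) (hYt : Y ⊆ (extChartAt (𝓡∂ n) c).target) :
    ∃ B : ℝ, ∀ y ∈ Y, ‖metricCoord g c y‖ ≤ B :=
  exists_norm_bound (F := EuclideanSpace ℝ (Fin n) →L[ℝ] EuclideanSpace ℝ (Fin n) →L[ℝ] ℝ) hY
    ((contDiffOn_metricCoord g c).continuousOn.mono hYt)

set_option maxSynthPendingDepth 3 in
/-- The curvature term is bounded on a compact manifold. -/
theorem exists_curvature_bound [T2Space M] [CompactSpace M] :
    ∃ C : ℝ, ∀ x : M, ∃ c : M, x ∈ (extChartAt (𝓡∂ n) c).source ∧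
      ((𝓡∂ n).IsInteriorPoint x → ∀ v X, |metricCoord g c (extChartAt (𝓡∂ n) c x) X
        (curvatureVec (christoffelCoord g c) (extChartAt (𝓡∂ n) c x) v X)|
        ≤ C * metricCoord g c (extChartAt (𝓡∂ n) c x) X X
          * metricCoord g c (extChartAt (𝓡∂ n) c x) v v) := by
  refine exists_uniform_const ?_ ?_
  · rintro x C C' hCC ⟨c, hx, h⟩
    refine ⟨c, hx, fun hi v X => (h hi v X).trans ?_⟩
    have hy := (extChartAt (𝓡∂ n) c).map_source hx
    have hpos : ∀ v, 0 ≤ metricCoord g c (extChartAt (𝓡∂ n) c x) v v := fun v => by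
      by_cases hv : v = 0
      · simp [hv]
      · exact (metricCoord_pos g hy hv).le
    exact mul_le_mul_of_nonneg_right (mul_le_mul_of_nonneg_right hCC (hpos X)) (hpos v)
  intro c
  obtain ⟨Y, hY, hYt, hev⟩ := exists_compact_chart_nhds (n := n) c
  obtain ⟨a, ha, hlow⟩ := exists_metricCoord_lower_bound g hY hYt
  obtain ⟨B, hB⟩ := exists_metricCoord_upper_bound g hY hYt
  obtain ⟨B₁, hB₁⟩ := exists_norm_bound hY
    ((contDiffOn_christoffelCoord g c).continuousOn.mono hYt)
  obtain ⟨B₂, hB₂⟩ := exists_norm_bound hY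
    ((contDiffOn_fderivWithin_range (m := ∞) (k := ∞) (by simp)
      (contDiffOn_christoffelCoord g c)).continuousOn.mono hYt)
  -- The numerator bounds the expression in Euclidean norms; each factor `1/a` converts a squared
  -- Euclidean norm into the metric. The bound `B₂` is for the derivative within the half-space,
  -- which stays continuous up to the boundary and is the full derivative at interior points.
  refine ⟨|B| * (2 * |B₂| + 2 * |B₁| ^ 2) / a ^ 2, hev.mono fun x hx => ⟨c, hx.1, fun hi v X => ?_⟩⟩
  have hy := mem_interior_target hi hx.1
  generalize extChartAt (𝓡∂ n) c x = y at hx hy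
  have hyY := hx.2
  have b0 : ‖metricCoord g c y‖ ≤ |B| := (hB y hyY).trans (le_abs_self _)
  have b1 : ‖christoffelCoord g c y‖ ≤ |B₁| := (hB₁ y hyY).trans (le_abs_self _)
  have b2 := (hB₂ y hyY).trans (le_abs_self _)
  rw [fderivWithin_range_eq_fderiv hy] at b2
  have hcurv := norm_curvatureVec_le b1 b2 v X
  have hv := hlow y hyY v
  have hX := hlow y hyY X
  calc |metricCoord g c y X (curvatureVec (christoffelCoord g c) y v X)|
      ≤ |B| * ‖X‖ * ((2 * |B₂| + 2 * |B₁| ^ 2) * ‖v‖ ^ 2 * ‖X‖) :=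
        ((metricCoord g c y).le_opNorm₂ X _).trans (by gcongr)
    _ = |B| * (2 * |B₂| + 2 * |B₁| ^ 2) / a ^ 2 * (a * ‖X‖ ^ 2) * (a * ‖v‖ ^ 2) := by
        field_simp
    _ ≤ _ := by
        have : 0 ≤ metricCoord g c y X X := le_trans (by positivity) hX
        gcongr

theorem inner_sq_le {x : M} (ξ η : TangentSpace (𝓡∂ n) x) :
    g.inner x ξ η ^ 2 ≤ g.inner x ξ ξ * g.inner x η η := by
  have h : ∀ t : ℝ, 0 ≤ (g.inner x η η) * (t * t) + (2 * g.inner x ξ η) * t + g.inner x ξ ξ := by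
    intro t
    have h := inner_self_nonneg g x (ξ + t • η)
    simp only [map_add, map_smul, add_apply, smul_apply, smul_eq_mul, g.symm x η ξ] at h
    linarith
  have := discrim_le_zero h
  rw [discrim] at this
  linarith

theorem abs_apply_le (x : M) (p : TangentSpace (𝓡∂ n) x →L[ℝ] ℝ) (ξ : TangentSpace (𝓡∂ n) x) :
    |p ξ| ≤ covNorm g x p * vecNorm g x ξ := by
  refine abs_le_of_sq_le_sq ?_ (mul_nonneg (Real.sqrt_nonneg _) (Real.sqrt_nonneg _))
  rw [mul_pow, covNorm_sq, vecNorm_sq, ← inner_raisedVec g x p ξ, ← inner_raisedVec g x p]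
  exact inner_sq_le g _ _

theorem covNorm_smul (x : M) (t : ℝ) (p : TangentSpace (𝓡∂ n) x →L[ℝ] ℝ) :
    covNorm g x (t • p) = |t| * covNorm g x p := by
  have hR : raisedVec g x (t • p) = t • raisedVec g x p := eq_of_inner_eq g fun w => by
    rw [inner_raisedVec, map_smul (g.inner x), smul_apply, smul_apply, inner_raisedVec]
  have h : covNorm g x (t • p) ^ 2 = (|t| * covNorm g x p) ^ 2 := by
    rw [mul_pow, sq_abs, covNorm_sq, covNorm_sq, hR, smul_apply, map_smul, smul_eq_mul, smul_eq_mul]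
    ring
  exact (sq_eq_sq₀ (Real.sqrt_nonneg _) (mul_nonneg (abs_nonneg _) (Real.sqrt_nonneg _))).1 h

/-- In a compact piece of a chart, `|p| ≤ 1` and `|z| ≤ K` confine all arguments, with `ξ` scaled to
unit Euclidean length, to a compact set on which `A` is continuous. Homogeneity in `ξ` restores the
general case. -/
theorem exists_tensor_bound_of_covNorm_le_one [T2Space M] [CompactSpace M] (hA : SmoothTensor A)
    (K : ℝ) : ∃ C : ℝ, ∀ (x : M) (z : ℝ) (p : TangentSpace (𝓡∂ n) x →L[ℝ] ℝ)
      (ξ : TangentSpace (𝓡∂ n) x), |z| ≤ K → covNorm g x p ≤ 1 →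
        |A x z p ξ ξ| ≤ C * vecNorm g x ξ ^ 2 := by
  refine exists_uniform_const ?_ ?_
  · intro x C C' hCC h z p ξ hz hp
    exact (h z p ξ hz hp).trans (by gcongr)
  intro c
  obtain ⟨Y, hY, hYt, hev⟩ := exists_compact_chart_nhds (n := n) c
  obtain ⟨a, ha, hlow⟩ := exists_metricCoord_lower_bound g hY hYt
  obtain ⟨B, hB⟩ := exists_metricCoord_upper_bound g hY hYt
  obtain ⟨B₁, hB₁⟩ := (hY.prod ((isCompact_Icc (a := -K) (b := K)).prod
    ((isCompact_closedBall (0 : EuclideanSpace ℝ (Fin n) →L[ℝ] ℝ) (√|B|)).prod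
      (isCompact_closedBall (0 : EuclideanSpace ℝ (Fin n)) 1)))).exists_bound_of_continuousOn
    ((contDiffOn_tensorCoord hA c).continuousOn.mono fun w hw => ⟨hYt hw.1, trivial⟩)
  refine ⟨|B₁| / a, hev.mono fun x hx z p ξ hz hp => ?_⟩
  have hyY := hx.2
  have hq : ‖p.comp (chartDInv c x)‖ ≤ √|B| := by
    refine ContinuousLinearMap.opNorm_le_bound _ (Real.sqrt_nonneg _) fun v => ?_
    have h1 := abs_apply_le g x p (chartDInv c x v)
    have h2 : vecNorm g x (chartDInv c x v) ≤ √|B| * ‖v‖ := by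
      refine abs_le_of_sq_le_sq' ?_ (by positivity) |>.2
      rw [vecNorm_sq, ← metricCoord_eq_inner g hx.1, mul_pow, Real.sq_sqrt (abs_nonneg _)]
      refine (le_abs_self _).trans (((metricCoord g c _).le_opNorm₂ v v).trans ?_)
      rw [mul_assoc, ← sq]
      gcongr
      exact (hB _ hyY).trans (le_abs_self _)
    refine h1.trans (le_trans ?_ h2)
    exact mul_le_of_le_one_left (Real.sqrt_nonneg _) hp
  have hunit : ∀ η : TangentSpace (𝓡∂ n) x, ‖chartD c x η‖ ≤ 1 → |A x z p η η| ≤ |B₁| := by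
    intro η hη
    have h := hB₁ (extChartAt (𝓡∂ n) c x, z, p.comp (chartDInv c x), chartD c x η)
      ⟨hyY, abs_le.1 hz, by simpa using hq, by simpa using hη⟩
    rw [tensorCoord_chartD A hx.1, comp_chartDInv_comp_chartD hx.1] at h
    exact h.trans (le_abs_self _)
  have hlo := hlow _ hyY (chartD c x ξ)
  rw [metricCoord_chartD g hx.1, ← vecNorm_sq] at hlo
  have hmain : |A x z p ξ ξ| ≤ |B₁| * ‖chartD c x ξ‖ ^ 2 := by
    by_cases h0 : chartD c x ξ = 0
    · have : ξ = 0 := by rw [← chartDInv_chartD hx.1 ξ, h0, map_zero]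
      simp [this]
    have hn : 0 < ‖chartD c x ξ‖ := norm_pos_iff.2 h0
    have h := hunit (‖chartD c x ξ‖⁻¹ • ξ) (by
      rw [map_smul, norm_smul, norm_inv, norm_norm, inv_mul_cancel₀ hn.ne'])
    simp only [map_smul, LinearMap.smul_apply, smul_eq_mul, abs_mul, abs_inv, abs_norm] at h
    calc |A x z p ξ ξ| = ‖chartD c x ξ‖⁻¹ * (‖chartD c x ξ‖⁻¹ * |A x z p ξ ξ|) * ‖chartD c x ξ‖ ^ 2 := by
          field_simp
      _ ≤ _ := by gcongr
  refine hmain.trans ?_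
  calc |B₁| * ‖chartD c x ξ‖ ^ 2 = |B₁| / a * (a * ‖chartD c x ξ‖ ^ 2) := by field_simp
    _ ≤ _ := by gcongr

/-- By concavity in `p`, the tensor `A` grows at most linearly from above. -/
theorem exists_tensor_linear_bound [T2Space M] [CompactSpace M] (hA : SmoothTensor A)
    (hconc : ∀ x z ξ, ConcaveOn ℝ Set.univ (fun p => A x z p ξ ξ)) (K : ℝ) :
    ∃ C : ℝ, 0 ≤ C ∧ ∀ (x : M) (z : ℝ) (p : TangentSpace (𝓡∂ n) x →L[ℝ] ℝ)
      (ξ : TangentSpace (𝓡∂ n) x), |z| ≤ K →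
        A x z p ξ ξ ≤ C * (1 + covNorm g x p) * vecNorm g x ξ ^ 2 := by
  obtain ⟨C, hC⟩ := exists_tensor_bound_of_covNorm_le_one g hA K
  refine ⟨2 * |C|, by positivity, fun x z p ξ hz => ?_⟩
  have hp0 : 0 ≤ covNorm g x p := Real.sqrt_nonneg _
  have hC' : ∀ q, covNorm g x q ≤ 1 → |A x z q ξ ξ| ≤ |C| * vecNorm g x ξ ^ 2 := fun q hq =>
    (hC x z q ξ hz hq).trans (by gcongr; exact le_abs_self _)
  have hCv : 0 ≤ |C| * vecNorm g x ξ ^ 2 := by positivity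
  rcases le_total (covNorm g x p) 1 with hp | hp
  · have h := (le_abs_self _).trans (hC' p hp)
    nlinarith
  · have hp' : 0 < covNorm g x p := by linarith
    -- Concavity on the segment from 0 to `p`, at the point `t p` of norm 1: `A(p)` is controlled
    -- through `t A(p) ≤ A(tp) - (1 - t) A(0)`, both of which lie in the bounded range.
    set t := (covNorm g x p)⁻¹ with ht
    have ht0 : 0 < t := inv_pos.2 hp'
    have ht1 : t ≤ 1 := inv_le_one_of_one_le₀ hp
    have h := (hconc x z ξ).2 (Set.mem_univ 0) (Set.mem_univ p) (sub_nonneg.2 ht1) ht0.le (by ring)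
    simp only [smul_zero, zero_add, smul_eq_mul] at h
    have h1 := (abs_le.1 (hC' 0 (by
      have := covNorm_smul g x 0 p
      rw [zero_smul, abs_zero, zero_mul] at this
      rw [this]; exact zero_le_one))).1
    have h2 := (le_abs_self _).trans (hC' (t • p) (by
      rw [covNorm_smul, abs_of_pos ht0, ht, inv_mul_cancel₀ hp'.ne']))
    have h3 : t * A x z p ξ ξ ≤ 2 * (|C| * vecNorm g x ξ ^ 2) := by nlinarith
    calc A x z p ξ ξ = covNorm g x p * (t * A x z p ξ ξ) := by rw [ht]; field_simp
      _ ≤ covNorm g x p * (2 * (|C| * vecNorm g x ξ ^ 2)) := by gcongr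
      _ ≤ _ := by nlinarith

end LocalBounds

/-! ### The threshold beyond which the leading powers dominate. -/

section Thresholds

theorem eventually_mul_rpow_le {a b : ℝ} (hab : a < b) (C : ℝ) {ε : ℝ} (hε : 0 < ε) :
    ∀ᶠ r : ℝ in Filter.atTop, C * r ^ a ≤ ε * r ^ b := by
  filter_upwards [(tendsto_rpow_atTop (sub_pos.2 hab)).eventually_ge_atTop (C / ε),
    Filter.eventually_gt_atTop 0] with r hr hr0
  have h : r ^ b = r ^ a * r ^ (b - a) := by rw [← Real.rpow_add hr0]; congr 1; ring
  have h1 : C ≤ ε * r ^ (b - a) := by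
    rw [div_le_iff₀ hε] at hr
    linarith
  calc C * r ^ a ≤ ε * r ^ (b - a) * r ^ a := by gcongr
    _ = ε * r ^ b := by rw [h]; ring

/-- Every term on the left has a power of `r` strictly below that on the right. Two terms receive a
third of `ε` each and five a sixth of `δ` each, which leaves a remainder for strictness. -/
theorem eventually_growth_lt {γ₁ γ₂ γ : ℝ} (hγ₁ : 0 < γ₁ ∧ γ₁ < 4) (hγ₂ : 0 < γ₂ ∧ γ₂ < 4)
    (hγ : 0 < γ ∧ γ < 2) {B B₁ B₂ a d N ε δ : ℝ} (hB : 0 ≤ B) (hB₁ : 0 ≤ B₁) (hB₂ : 0 ≤ B₂)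
    (ha : 0 ≤ a) (hN : 0 ≤ N) (hε : 0 < ε) (hδ : 0 < δ) :
    ∀ᶠ r : ℝ in Filter.atTop, a * (1 + r) + N * (B * (1 + r ^ γ)) < ε * r ^ 2 ∧
      B₂ * (1 + r ^ γ₂) + r ^ 2 * (B * (1 + r ^ γ)) + B₁ * (1 + r ^ γ₁) + d * r ^ 2
        + r ^ 2 * (a * (1 + r)) < δ * r ^ 4 := by
  filter_upwards [Filter.eventually_ge_atTop 1,
    eventually_mul_rpow_le (by norm_num : (1 : ℝ) < 2) (2 * a) (by positivity : 0 < ε / 3),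
    eventually_mul_rpow_le hγ.2 (2 * (N * B)) (by positivity : 0 < ε / 3),
    eventually_mul_rpow_le hγ₂.2 (2 * B₂) (by positivity : 0 < δ / 6),
    eventually_mul_rpow_le hγ₁.2 (2 * B₁) (by positivity : 0 < δ / 6),
    eventually_mul_rpow_le (by linarith [hγ.2] : 2 + γ < 4) (2 * B) (by positivity : 0 < δ / 6),
    eventually_mul_rpow_le (by norm_num : (2 : ℝ) < 4) d (by positivity : 0 < δ / 6),
    eventually_mul_rpow_le (by norm_num : (3 : ℝ) < 4) (2 * a) (by positivity : 0 < δ / 6)]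
    with r h1 e1 e2 e3 e4 e5 e6 e7
  have hr : 0 < r := by linarith
  have p1 : r ^ (1 : ℝ) = r := Real.rpow_one r
  have p2 : r ^ (2 : ℝ) = r ^ 2 := Real.rpow_ofNat r 2
  have p3 : r ^ (3 : ℝ) = r ^ 3 := Real.rpow_ofNat r 3
  have p4 : r ^ (4 : ℝ) = r ^ 4 := Real.rpow_ofNat r 4
  have p5 : r ^ (2 + γ) = r ^ 2 * r ^ γ := by rw [Real.rpow_add hr, p2]
  rw [p1, p2] at e1
  rw [p2] at e2
  rw [p4] at e3 e4
  rw [p4, p5] at e5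
  rw [p2, p4] at e6
  rw [p3, p4] at e7
  have q : 1 ≤ r ^ γ := Real.one_le_rpow h1 hγ.1.le
  have q1 : 1 ≤ r ^ γ₁ := Real.one_le_rpow h1 hγ₁.1.le
  have q2 : 1 ≤ r ^ γ₂ := Real.one_le_rpow h1 hγ₂.1.le
  have r2 : 0 < ε * r ^ 2 := by positivity
  have r4 : 0 < δ * r ^ 4 := by positivity
  have f1 : a * (1 + r) ≤ 2 * a * r := by nlinarith
  have f2 : B * (1 + r ^ γ) ≤ 2 * B * r ^ γ := by nlinarith
  have f3 : B₁ * (1 + r ^ γ₁) ≤ 2 * B₁ * r ^ γ₁ := by nlinarith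
  have f4 : B₂ * (1 + r ^ γ₂) ≤ 2 * B₂ * r ^ γ₂ := by nlinarith
  have g1 := mul_le_mul_of_nonneg_left f2 hN
  have g2 := mul_le_mul_of_nonneg_left f2 (sq_nonneg r)
  have g3 := mul_le_mul_of_nonneg_left f1 (sq_nonneg r)
  constructor
  · linarith
  · have k1 : r ^ 2 * (2 * a * r) = 2 * a * r ^ 3 := by ring
    have k2 : r ^ 2 * (2 * B * r ^ γ) = 2 * B * (r ^ 2 * r ^ γ) := by ring
    linarith

end Thresholds

/-! ### The contradiction at an interior maximum with large gradient. -/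

section GradientBound

variable {n : ℕ} [NeZero n] {M : Type*} [TopologicalSpace M] [ChartedSpace (EuclideanHalfSpace n) M]
  [IsManifold (𝓡∂ n) ∞ M]
  (g : Bundle.ContMDiffRiemannianMetric (𝓡∂ n) ∞ (EuclideanSpace ℝ (Fin n))
    (fun x : M => TangentSpace (𝓡∂ n) x))
  {A : (x : M) → ℝ → (TangentSpace (𝓡∂ n) x →L[ℝ] ℝ) →
    LinearMap.BilinForm ℝ (TangentSpace (𝓡∂ n) x)}
  {ψ : (x : M) → ℝ → (TangentSpace (𝓡∂ n) x →L[ℝ] ℝ) → ℝ}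

theorem sum_sq_apply_eq {x : M} {e : Fin n → TangentSpace (𝓡∂ n) x}
    (he : ∀ i j, g.inner x (e i) (e j) = if i = j then 1 else 0)
    (p : TangentSpace (𝓡∂ n) x →L[ℝ] ℝ) : ∑ i, p (e i) ^ 2 = covNorm g x p ^ 2 := by
  rw [covNorm_sq]
  conv_rhs => rw [eq_sum_inner_smul g he (raisedVec g x p)]
  simp only [inner_raisedVec, map_sum, map_smul, smul_eq_mul, sq]

omit [NeZero n] in
/-- In the direction of the largest component of the gradient the eigenvalue is negative, if the
gradient is large. -/
theorem eigenvalue_neg_of_large {p l : Fin n → ℝ} {a : Fin n → Fin n → ℝ} {r m m₁ c₀ c₁ : ℝ}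
    {i : Fin n} (hm : 0 < m) (hmm : m ≤ m₁) (hr : 0 < r) (hp : ∑ j, p j ^ 2 = r ^ 2)
    (hi : r ^ 2 ≤ n * p i ^ 2) (hdiag : a i i ≤ c₀) (hoff : ∀ j, j ≠ i → |a i j| ≤ c₁)
    (hc₁ : 0 ≤ c₁) (hlarge : c₀ + (n : ℝ) ^ 2 * c₁ < 1 / (4 * m₁) * r ^ 2)
    (hl : l i * p i = -(r ^ 2 / (4 * m)) * p i + ∑ j, p j * a i j) : l i < 0 := by
  have hpi : 0 < p i ^ 2 := by
    by_contra h
    have h0 : p i ^ 2 = 0 := le_antisymm (not_lt.1 h) (sq_nonneg _)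
    rw [h0, mul_zero] at hi
    have : 0 < r ^ 2 := by positivity
    linarith
  have habs : ∀ j, |p j| ≤ r := fun j => by
    refine abs_le_of_sq_le_sq ?_ hr.le
    rw [← hp]
    exact Finset.single_le_sum (f := fun j => p j ^ 2) (fun j _ => sq_nonneg _) (Finset.mem_univ j)
  have hterm : ∀ j, p i * (p j * a i j) ≤ (if j = i then p i ^ 2 * c₀ else 0) + r ^ 2 * c₁ := by
    intro j
    have hrc : 0 ≤ r ^ 2 * c₁ := by positivity
    by_cases h : j = i
    · subst h
      rw [if_pos rfl]
      nlinarith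
    · rw [if_neg h, zero_add]
      calc p i * (p j * a i j) ≤ |p i * (p j * a i j)| := le_abs_self _
        _ = |p i| * (|p j| * |a i j|) := by rw [abs_mul, abs_mul]
        _ ≤ r * (r * c₁) := by
          have := hoff j h
          gcongr
          · exact habs i
          · exact habs j
        _ = r ^ 2 * c₁ := by ring
  have hsum : ∑ j, p i * (p j * a i j) ≤ p i ^ 2 * c₀ + n * (r ^ 2 * c₁) := by
    refine (Finset.sum_le_sum fun j _ => hterm j).trans (le_of_eq ?_)
    rw [Finset.sum_add_distrib]
    simp
  have hkey : l i * p i ^ 2 = -(r ^ 2 / (4 * m)) * p i ^ 2 + ∑ j, p i * (p j * a i j) := by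
    rw [← Finset.mul_sum, sq, ← mul_assoc, hl]
    ring
  have h1 : 1 / (4 * m₁) * r ^ 2 ≤ r ^ 2 / (4 * m) := by
    rw [one_div, inv_mul_eq_div]
    gcongr
  -- One factor `n` counts the terms off the diagonal and the other comes from `r² ≤ n p_i²`; hence
  -- the `n² c₁` in the threshold.
  have h2 : n * (r ^ 2 * c₁) ≤ n * ((n * p i ^ 2) * c₁) := by gcongr
  have h3 : l i * p i ^ 2 ≤ p i ^ 2 * (c₀ + (n : ℝ) ^ 2 * c₁ - 1 / (4 * m₁) * r ^ 2) := by
    have h4 := mul_le_mul_of_nonneg_right h1 hpi.le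
    rw [hkey]
    linarith
  have h5 : l i * p i ^ 2 < 0 := lt_of_le_of_lt h3 (mul_neg_of_pos_of_neg hpi (by linarith))
  exact neg_of_mul_neg_left h5 hpi.le

/-- The gradient is bounded at an interior maximum of `|∇u|⁴ / (κ - u)`. -/
theorem gradNorm_le_of_interior_maximum {cone : Set (Fin n → ℝ)} {f : (Fin n → ℝ) → ℝ}
    (hc : IsSymmetricCone cone) (hf : IsStructureFunction cone f)
    (hfl : ∀ l ∈ cone, 0 ≤ ∑ i, partialF f i l * l i) {ν : ℝ} (hν : 0 < ν)
    (hneg : ∀ l ∈ cone, 0 < f l → ∀ j, l j < 0 → ν * (1 + ∑ i, partialF f i l) ≤ partialF f j l)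
    (hA : SmoothTensor A) (hψ : SmoothScalar ψ) (hψpos : ∀ x z p, 0 < ψ x z p)
    {b₁ b₂ b : M → ℝ → ℝ} {γ₁ γ₂ γ : ℝ}
    (hxz : GrowthXZ g A ψ b₁ b₂ γ₁ γ₂) (hp : GrowthP g A ψ b γ) (hoff : GrowthOffDiagonal g A b γ)
    {u : M → ℝ} (hu : ContMDiff (𝓡∂ n) 𝓘(ℝ, ℝ) 3 u)
    (hadm : IsAdmissibleSolution g cone f A ψ u) {c x : M} (hi : (𝓡∂ n).IsInteriorPoint x)
    (hx : x ∈ (extChartAt (𝓡∂ n) c).source) {κ m₁ : ℝ} (hκ : ∀ x', 1 ≤ κ - u x')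
    (hm₁ : κ - u x ≤ m₁)
    (hmax : ∀ x', gradNorm g u x' ^ 4 / (κ - u x') ≤ gradNorm g u x ^ 4 / (κ - u x))
    {B B₁ B₂ a d : ℝ} (hB : b x (u x) ≤ B) (hB₁ : b₁ x (u x) ≤ B₁) (hB₂ : b₂ x (u x) ≤ B₂)
    (hB0 : 0 ≤ B) (hB₁0 : 0 ≤ B₁) (hB₂0 : 0 ≤ B₂) (ha0 : 0 ≤ a) (hd0 : 0 ≤ d)
    (ha : ∀ p ξ, A x (u x) p ξ ξ ≤ a * (1 + covNorm g x p) * vecNorm g x ξ ^ 2)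
    (hd : ∀ v X, |metricCoord g c (extChartAt (𝓡∂ n) c x) X
        (curvatureVec (christoffelCoord g c) (extChartAt (𝓡∂ n) c x) v X)|
        ≤ d * metricCoord g c (extChartAt (𝓡∂ n) c x) X X
          * metricCoord g c (extChartAt (𝓡∂ n) c x) v v)
    {R : ℝ} (hR0 : 0 ≤ R)
    (hR : ∀ r, R < r → a * (1 + r) + (n : ℝ) ^ 2 * (B * (1 + r ^ γ)) < 1 / (4 * m₁) * r ^ 2 ∧
      B₂ * (1 + r ^ γ₂) + r ^ 2 * (B * (1 + r ^ γ)) + B₁ * (1 + r ^ γ₁) + d * r ^ 2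
        + r ^ 2 * (a * (1 + r)) < ν / (8 * n * m₁ ^ 2) * r ^ 4) :
    gradNorm g u x ≤ R := by
  by_contra! hlt
  have hW : 0 < gradNorm g u x := lt_of_le_of_lt hR0 hlt
  have hu1 : ContMDiff (𝓡∂ n) 𝓘(ℝ, ℝ) 1 u := hu.of_le (by norm_num)
  obtain ⟨hlarge, hcontra⟩ := hR _ hlt
  obtain ⟨e, l, he, hl, hfeq, hfirst, hmain⟩ := interior_maximum_conditions g hc hf hA hψ hu hadm hi hx
    (κ := κ) (fun x' => by linarith [hκ x']) hW hmax (C := d) (fun v => by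
      have hy := mem_interior_target hi hx
      have h1 := metricCoord_gradCoord g (interior_subset hy) u
        (curvatureVec (christoffelCoord g c) (extChartAt (𝓡∂ n) c x) v
          (gradCoord g c u (extChartAt (𝓡∂ n) c x)))
      rw [fderivWithin_range_eq_fderiv hy] at h1
      rw [← h1, gradNorm_sq g hu1 hx]
      exact hd _ _)
  obtain ⟨hxzA, hxzψ⟩ := hxz x (u x) (diff u x)
  obtain ⟨-, hpψ, hpA⟩ := hp x (u x) (diff u x)
  have hsq := sum_sq_apply_eq g he (diff u x)
  have hoff' : ∀ i j, i ≠ j → |A x (u x) (diff u x) (e i) (e j)|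
      ≤ B * (1 + gradNorm g u x ^ γ) := by
    intro i j hij
    have h := hoff x (u x) (diff u x) (e i) (e j) (by rw [he, if_neg hij])
    have hv : ∀ i, vecNorm g x (e i) = 1 := fun i => by rw [vecNorm, he, if_pos rfl, Real.sqrt_one]
    rw [hv, hv, mul_one, mul_one] at h
    refine h.trans (mul_le_mul_of_nonneg_right hB ?_)
    have : 0 ≤ covNorm g x (diff u x) ^ γ := Real.rpow_nonneg (Real.sqrt_nonneg _) _
    linarith
  have hvsq : ∀ i, vecNorm g x (e i) ^ 2 = 1 := fun i => by rw [vecNorm_sq, he, if_pos rfl]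
  have hene : ∀ i, e i ≠ 0 := fun i h => by
    have := he i i
    rw [h, if_pos rfl] at this
    simp at this
  have hdiag : ∀ i, A x (u x) (diff u x) (e i) (e i) ≤ a * (1 + gradNorm g u x) := fun i => by
    have h := ha (diff u x) (e i)
    rwa [hvsq, mul_one] at h
  have hA1 : ∀ i, pDotGradTensor g A x (u x) (diff u x) (e i)
      + gradNorm g u x ^ 2 * deriv (fun s => A x s (diff u x) (e i) (e i)) (u x)
      ≤ B₁ * (1 + gradNorm g u x ^ γ₁) := fun i => by
    have h := hxzA (e i)
    rw [hvsq, mul_one] at h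
    refine h.trans (mul_le_mul_of_nonneg_right hB₁ ?_)
    have : 0 ≤ covNorm g x (diff u x) ^ γ₁ := Real.rpow_nonneg (Real.sqrt_nonneg _) _
    linarith
  have hA2 : ∀ i, -deriv (fun t : ℝ => A x (u x) (t • diff u x) (e i) (e i)) 1
      ≤ B * (1 + gradNorm g u x ^ γ) := fun i => by
    have h := hpA (e i) (hene i)
    rw [hvsq, div_one] at h
    refine h.trans (mul_le_mul_of_nonneg_right hB ?_)
    have : 0 ≤ covNorm g x (diff u x) ^ γ := Real.rpow_nonneg (Real.sqrt_nonneg _) _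
    linarith
  have hψ1 : -(B₂ * (1 + gradNorm g u x ^ γ₂)) ≤ pDotGradScalar g ψ x (u x) (diff u x)
      + gradNorm g u x ^ 2 * deriv (fun s => ψ x s (diff u x)) (u x) := by
    refine le_trans (neg_le_neg (mul_le_mul_of_nonneg_right hB₂ ?_)) hxzψ
    have : 0 ≤ covNorm g x (diff u x) ^ γ₂ := Real.rpow_nonneg (Real.sqrt_nonneg _) _
    change 0 ≤ 1 + covNorm g x (diff u x) ^ γ₂
    linarith
  have hψ2 : deriv (fun t : ℝ => ψ x (u x) (t • diff u x)) 1 ≤ B * (1 + gradNorm g u x ^ γ) := by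
    refine hpψ.trans (mul_le_mul_of_nonneg_right hB ?_)
    have : 0 ≤ covNorm g x (diff u x) ^ γ := Real.rpow_nonneg (Real.sqrt_nonneg _) _
    linarith
  change ∑ i, diff u x (e i) ^ 2 = gradNorm g u x ^ 2 at hsq
  have hq : 0 ≤ gradNorm g u x ^ γ := Real.rpow_nonneg hW.le _
  have hq1 : 0 ≤ gradNorm g u x ^ γ₁ := Real.rpow_nonneg hW.le _
  have hq2 : 0 ≤ gradNorm g u x ^ γ₂ := Real.rpow_nonneg hW.le _
  generalize gradNorm g u x = r at *
  have hn : 0 < (n : ℝ) := Nat.cast_pos.2 (NeZero.pos n)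
  have hm := hκ x
  generalize κ - u x = m at *
  -- Some component of the gradient has square at least the average `r² / n`.
  obtain ⟨i₁, hi₁⟩ : ∃ i, r ^ 2 ≤ n * diff u x (e i) ^ 2 := by
    by_contra! h
    have h1 : ∑ i : Fin n, n * diff u x (e i) ^ 2 < ∑ i : Fin n, r ^ 2 :=
      Finset.sum_lt_sum_of_nonempty Finset.univ_nonempty fun i _ => h i
    rw [← Finset.mul_sum, hsq] at h1
    simp at h1
  have hli : l i₁ < 0 := eigenvalue_neg_of_large (p := fun j => diff u x (e j)) (l := l)
    (a := fun i j => A x (u x) (diff u x) (e i) (e j)) (by linarith) hm₁ hW hsq hi₁ (hdiag i₁)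
    (fun j hj => hoff' i₁ j hj.symm) (by positivity) hlarge (hfirst i₁)
  -- Positivity of `ψ` gives only `f l > 0`, with no uniform lower bound; this is where the constant
  -- valid on all of `{f > 0}` is needed.
  have hF1 := hneg l hl (by rw [hfeq]; exact hψpos _ _ _) i₁ hli
  have hF0 : ∀ i, 0 < partialF f i l := hf.partial_pos l hl
  set S := ∑ i, partialF f i l with hS
  have hS0 : 0 ≤ S := Finset.sum_nonneg fun i _ => (hF0 i).le
  set k := r ^ 2 / (4 * m) with hk
  have hk0 : 0 ≤ k := by positivity
  -- Since `m ≥ 1`. Terms multiplied by `k` may thus be bounded with `r²` in its place.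
  have hkr : k ≤ r ^ 2 := by
    rw [hk, div_le_iff₀ (by positivity)]
    nlinarith [sq_nonneg r]
  set q := B * (1 + r ^ γ) with hqdef
  set q₁ := B₁ * (1 + r ^ γ₁) with hq1def
  set q₂ := B₂ * (1 + r ^ γ₂) with hq2def
  have hq0 : 0 ≤ q := by positivity
  have hq10 : 0 ≤ q₁ := by positivity
  have hq20 : 0 ≤ q₂ := by positivity
  have hkq : k * q ≤ r ^ 2 * q := by gcongr
  have har : 0 ≤ a * (1 + r) := by positivity
  have hka : k * (a * (1 + r)) ≤ r ^ 2 * (a * (1 + r)) := by gcongr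
  have hterm : ∀ i, partialF f i l * (-(q₁ + r ^ 2 * q + d * r ^ 2 + r ^ 2 * (a * (1 + r)))
      + k * l i + r ^ 2 / (8 * m ^ 2) * diff u x (e i) ^ 2)
      ≤ partialF f i l * (-(pDotGradTensor g A x (u x) (diff u x) (e i)
            + r ^ 2 * deriv (fun s => A x s (diff u x) (e i) (e i)) (u x)
            - k * deriv (fun t : ℝ => A x (u x) (t • diff u x) (e i) (e i)) 1)
          - d * r ^ 2 + k * (l i - A x (u x) (diff u x) (e i) (e i))
          + r ^ 2 / (8 * m ^ 2) * diff u x (e i) ^ 2) := by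
    intro i
    refine mul_le_mul_of_nonneg_left ?_ (hF0 i).le
    have h1 := hA1 i
    have h2 := mul_le_mul_of_nonneg_left (hA2 i) hk0
    have h3 := mul_le_mul_of_nonneg_left (hdiag i) hk0
    linarith
  have hsum := Finset.sum_le_sum fun i (_ : i ∈ Finset.univ) => hterm i
  have hexp : ∑ i, partialF f i l * (-(q₁ + r ^ 2 * q + d * r ^ 2 + r ^ 2 * (a * (1 + r)))
      + k * l i + r ^ 2 / (8 * m ^ 2) * diff u x (e i) ^ 2)
      = -(q₁ + r ^ 2 * q + d * r ^ 2 + r ^ 2 * (a * (1 + r))) * S + k * ∑ i, partialF f i l * l i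
        + r ^ 2 / (8 * m ^ 2) * ∑ i, partialF f i l * diff u x (e i) ^ 2 := by
    rw [hS, Finset.mul_sum, Finset.mul_sum, Finset.mul_sum, ← Finset.sum_add_distrib,
      ← Finset.sum_add_distrib]
    exact Finset.sum_congr rfl fun i _ => by ring
  -- The eigenvalues contribute `k ∑ f_i l_i`, which is discarded as nonnegative.
  have hlsum := mul_nonneg hk0 (hfl l hl)
  -- The leading term: keep only the index `i₁`, where `f_i ≥ ν (1 + S)` and `p_i² ≥ r² / n`, and
  -- use `m ≤ m₁`.
  have hgood : ν / (8 * n * m₁ ^ 2) * r ^ 4 * (1 + S)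
      ≤ r ^ 2 / (8 * m ^ 2) * ∑ i, partialF f i l * diff u x (e i) ^ 2 := by
    have h1 : partialF f i₁ l * diff u x (e i₁) ^ 2 ≤ ∑ i, partialF f i l * diff u x (e i) ^ 2 :=
      Finset.single_le_sum (f := fun i => partialF f i l * diff u x (e i) ^ 2)
        (fun i _ => mul_nonneg (hF0 i).le (sq_nonneg _)) (Finset.mem_univ i₁)
    have h2 : r ^ 2 / n ≤ diff u x (e i₁) ^ 2 := by
      rw [div_le_iff₀ hn]
      linarith
    have hm₁0 : 0 < m₁ := by linarith
    have hF := (hF0 i₁).le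
    calc ν / (8 * n * m₁ ^ 2) * r ^ 4 * (1 + S)
        = r ^ 2 / (8 * m₁ ^ 2) * (ν * (1 + S) * (r ^ 2 / n)) := by field_simp
      _ ≤ r ^ 2 / (8 * m ^ 2) * (partialF f i₁ l * diff u x (e i₁) ^ 2) := by gcongr
      _ ≤ _ := by gcongr
  have hψ3 := mul_le_mul_of_nonneg_left hψ2 hk0
  -- The error terms carry either 1 (from `ψ`) or `S` (from `A` and the curvature), so together they
  -- are at most the left side of the threshold inequality times `1 + S`. The leading term exceeds
  -- this, contrary to the maximum condition.
  have hcS := mul_lt_mul_of_pos_right hcontra (by linarith : 0 < 1 + S)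
  have hdr : 0 ≤ d * r ^ 2 := by positivity
  have hrq : 0 ≤ r ^ 2 * q := by positivity
  have hra : 0 ≤ r ^ 2 * (a * (1 + r)) := by positivity
  have hq2S := mul_nonneg hq20 hS0
  linarith

end GradientBound
end HessianEquation

end

/-! ### Choice of constants and the maximum over the whole manifold. -/

theorem theorem6p3 (n : ℕ) [NeZero n] (hn : 2 ≤ n)
    {M : Type*} [TopologicalSpace M] [T2Space M] [CompactSpace M]
    [ChartedSpace (EuclideanHalfSpace n) M] [IsManifold (𝓡∂ n) ∞ M]
    (g : Bundle.ContMDiffRiemannianMetric (𝓡∂ n) ∞ (EuclideanSpace ℝ (Fin n))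
      (fun x : M => TangentSpace (𝓡∂ n) x))
    -- the function `f` on its cone
    (cone : Set (Fin n → ℝ)) (f : (Fin n → ℝ) → ℝ)
    (hcone : IsSymmetricCone cone) (hf : IsStructureFunction cone f)
    (hfl : ∀ l ∈ cone, 0 ≤ ∑ i, partialF f i l * l i)
    (hneg : ∀ σ : ℝ, 0 < σ → ∃ ν₀ : ℝ, 0 < ν₀ ∧ ∀ l ∈ cone, σ < f l → ∀ j, l j < 0 →
      ν₀ * (1 + ∑ i, partialF f i l) ≤ partialF f j l)
    -- the tensor `A` and the right-hand side `ψ`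
    (A : (x : M) → ℝ → (TangentSpace (𝓡∂ n) x →L[ℝ] ℝ) →
      LinearMap.BilinForm ℝ (TangentSpace (𝓡∂ n) x))
    (ψ : (x : M) → ℝ → (TangentSpace (𝓡∂ n) x →L[ℝ] ℝ) → ℝ)
    (hAsmooth : SmoothTensor A) (hAsymm : ∀ x z p ξ η, A x z p ξ η = A x z p η ξ)
    (hψsmooth : SmoothScalar ψ) (hψpos : ∀ x z p, 0 < ψ x z p)
    (hψconvex : ∀ x z, ConvexOn ℝ Set.univ (ψ x z))
    (hAconcave : ∀ x z ξ, ConcaveOn ℝ Set.univ (fun p => A x z p ξ ξ))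
    -- the growth conditions
    (b₁ b₂ b : M → ℝ → ℝ) (γ₁ γ₂ γ : ℝ)
    (hb₁ : ∀ x z, 0 < b₁ x z) (hb₂ : ∀ x z, 0 < b₂ x z) (hb : ∀ x z, 0 ≤ b x z)
    (hb₁' : LocBddAbove b₁) (hb₂' : LocBddAbove b₂) (hb' : LocBddAbove b)
    (hγ₁ : 0 < γ₁ ∧ γ₁ < 4) (hγ₂ : 0 < γ₂ ∧ γ₂ < 4) (hγ : 0 < γ ∧ γ < 2)
    (hxz : GrowthXZ g A ψ b₁ b₂ γ₁ γ₂)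
    (hp : GrowthP g A ψ b γ)
    (hoff : GrowthOffDiagonal g A b γ) :
    ∀ K : ℝ, ∃ C₁ : ℝ, 0 < C₁ ∧
      ∀ u : M → ℝ, ContMDiff (𝓡∂ n) 𝓘(ℝ, ℝ) 3 u → IsAdmissibleSolution g cone f A ψ u →
        (∀ x, |u x| ≤ K) →
        ∀ x : M, gradNorm g u x ≤
          C₁ * (1 + ⨆ y : (𝓡∂ n).boundary M, gradNorm g u y) := by
  intro K
  obtain ⟨ν, hν, hν'⟩ := hf.exists_partialF_lower_bound hcone hfl hneg
  obtain ⟨B, hB⟩ := hb' |K|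
  obtain ⟨B₁, hB₁⟩ := hb₁' |K|
  obtain ⟨B₂, hB₂⟩ := hb₂' |K|
  obtain ⟨a, ha0, ha⟩ := exists_tensor_linear_bound g hAsmooth hAconcave |K|
  obtain ⟨d, hd⟩ := exists_curvature_bound g
  -- Upper bound for `κ - u` with `κ = |K| + 1`; the lower bound is 1.
  set m₁ : ℝ := 2 * |K| + 1 with hm₁
  have hK := abs_nonneg K
  have hm₁1 : 1 ≤ m₁ := by linarith
  have hn0 : 0 < (n : ℝ) := Nat.cast_pos.2 (NeZero.pos n)
  obtain ⟨R, hR⟩ := Filter.eventually_atTop.1 (eventually_growth_lt (a := a) (d := |d|)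
    (N := (n : ℝ) ^ 2) (ε := 1 / (4 * m₁)) (δ := ν / (8 * n * m₁ ^ 2)) hγ₁ hγ₂ hγ (abs_nonneg B)
    (abs_nonneg B₁) (abs_nonneg B₂) ha0 (by positivity) (by positivity) (by positivity))
  refine ⟨m₁ * (|R| + 1), by positivity, fun u hu hadm huK x => ?_⟩
  have huK' : ∀ x, |u x| ≤ |K| := fun x => (huK x).trans (le_abs_self K)
  have hu1 : ContMDiff (𝓡∂ n) 𝓘(ℝ, ℝ) 1 u := hu.of_le (by norm_num)
  have hcont := continuous_gradNorm g hu1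
  have hκ : ∀ x, 1 ≤ |K| + 1 - u x := fun x => by linarith [(abs_le.1 (huK' x)).2]
  have hκ' : ∀ x, |K| + 1 - u x ≤ m₁ := fun x => by linarith [(abs_le.1 (huK' x)).1]
  obtain ⟨x₀, -, hx₀⟩ := isCompact_univ.exists_isMaxOn ⟨x, Set.mem_univ x⟩
    (f := fun x => gradNorm g u x ^ 4 / (|K| + 1 - u x)) ((hcont.pow 4).div
      (continuous_const.sub hu.continuous) fun x => (lt_of_lt_of_le one_pos (hκ x)).ne').continuousOn
  have hmax : ∀ x', gradNorm g u x' ^ 4 / (|K| + 1 - u x')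
      ≤ gradNorm g u x₀ ^ 4 / (|K| + 1 - u x₀) := fun x' => hx₀ (Set.mem_univ x')
  -- This includes an empty boundary, for which the real supremum is 0 by convention.
  have hsup0 : 0 ≤ ⨆ y : (𝓡∂ n).boundary M, gradNorm g u y :=
    Real.iSup_nonneg fun y => gradNorm_nonneg g u y
  have hx₀b : gradNorm g u x₀ ≤ (|R| + 1) * (1 + ⨆ y : (𝓡∂ n).boundary M, gradNorm g u y) := by
    have hR0 := abs_nonneg R
    rcases (𝓡∂ n).isInteriorPoint_or_isBoundaryPoint x₀ with hi | hbd
    · obtain ⟨c, hxc, hcurv⟩ := hd x₀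
      have h := gradNorm_le_of_interior_maximum g hcone hf hfl hν hν' hAsmooth hψsmooth hψpos hxz hp
        hoff hu hadm hi hxc hκ (hκ' x₀) hmax ((hB x₀ _ (huK' x₀)).trans (le_abs_self B))
        ((hB₁ x₀ _ (huK' x₀)).trans (le_abs_self B₁)) ((hB₂ x₀ _ (huK' x₀)).trans (le_abs_self B₂))
        (abs_nonneg B) (abs_nonneg B₁) (abs_nonneg B₂) ha0 (abs_nonneg d)
        (fun p ξ => ha x₀ _ p ξ (huK' x₀)) (fun v X => (hcurv hi v X).trans ?_) hR0
        (fun r hr => hR r ((le_abs_self R).trans hr.le))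
      · nlinarith
      · have hpos : ∀ v, 0 ≤ metricCoord g c (extChartAt (𝓡∂ n) c x₀) v v := fun v => by
          rw [metricCoord_eq_inner g hxc]
          exact inner_self_nonneg g x₀ _
        exact mul_le_mul_of_nonneg_right (mul_le_mul_of_nonneg_right (le_abs_self d) (hpos X))
          (hpos v)
    -- Boundedness, from compactness of `M`, is needed for the real supremum to dominate its values.
    · have hbdd : BddAbove (Set.range fun y : (𝓡∂ n).boundary M => gradNorm g u y) :=
        (isCompact_range hcont).bddAbove.mono (by
          rintro _ ⟨y, rfl⟩
          exact ⟨y, rfl⟩)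
      have h := le_ciSup hbdd ⟨x₀, hbd⟩
      change gradNorm g u x₀ ≤ _ at h
      nlinarith
  -- Comparing the test function at `x` and at its maximum costs a factor `κ - u x ≤ m₁`; as `m₁ ≥
  -- 1` it is enlarged to `m₁⁴` so that the fourth root is explicit.
  have h4 : gradNorm g u x ^ 4 ≤ (m₁ * gradNorm g u x₀) ^ 4 := by
    have h1 := hmax x
    have h2 : gradNorm g u x₀ ^ 4 / (|K| + 1 - u x₀) ≤ gradNorm g u x₀ ^ 4 :=
      div_le_self (by positivity) (hκ x₀)
    have h3 := (div_le_iff₀ (by linarith [hκ x])).1 (h1.trans h2)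
    calc gradNorm g u x ^ 4 ≤ gradNorm g u x₀ ^ 4 * (|K| + 1 - u x) := h3
      _ ≤ gradNorm g u x₀ ^ 4 * m₁ ^ 4 := by
        gcongr
        exact (hκ' x).trans (le_self_pow₀ hm₁1 (by norm_num))
      _ = (m₁ * gradNorm g u x₀) ^ 4 := by ring
  have hle := le_of_pow_le_pow_left₀ (by norm_num)
    (mul_nonneg (by positivity) (gradNorm_nonneg g u x₀)) h4
  calc gradNorm g u x ≤ m₁ * gradNorm g u x₀ := hle
    _ ≤ m₁ * ((|R| + 1) * (1 + ⨆ y : (𝓡∂ n).boundary M, gradNorm g u y)) := by gcongr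
    _ = m₁ * (|R| + 1) * (1 + ⨆ y : (𝓡∂ n).boundary M, gradNorm g u y) := by ring
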